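/- **Definitions.** An *algebraic weak factorisation system* (AWFS) on a category $\mathcal C$ consists of a functorial factorisation $f=Rf\circ Lf\colon X\to Ef\to Y$ of the arrows $f\colon X\to Y$ of $\mathcal C$, together with an extension of the copointed endofunctor $(L,\varepsilon)$ of $\mathcal C^{\mathbf 2}$, $\varepsilon_f=(1,Rf)\colon Lf\to f$, to a comonad $\mathsf L=(L,\varepsilon,\Delta)$ and of the pointed endofunctor $(R,\eta)$, $\eta_f=(Lf,1)\colon f\to Rf$, to a monad $\mathsf R=(R,\eta,\mu)$, such that the maps $\delta_f\colon LRf\to RLf$ with domain component $\mathrm{cod}\,\Delta_f\colon Ef\to ELf$ and codomain component $\mathrm{dom}\,\mu_f\colon ERf\to Ef$ form a distributive law of $\mathsf L$ over $\mathsf R$. The 2-category $\mathbf{AWFS}_{\mathrm{lax}}$ has as objects categories equipped with an AWFS; its 1-cells $(\mathcal C,\mathsf L,\mathsf R)\to(\mathcal C',\mathsf L',\mathsf R')$ are functors $F\colon\mathcal C\to\mathcal C'$ with a natural family of maps $\alpha_f\colon E'Ff\to FEf$ such that $(\alpha,1)\colon R'F^{\mathbf 2}\Rightarrow F^{\mathbf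 2}R$ is a lax monad morphism $\mathsf R\to\mathsf R'$ and $(1,\alpha)\colon L'F^{\mathbf 2}\Rightarrow F^{\mathbf 2}L$ is a lax comonad morphism $\mathsf L\to\mathsf L'$; its 2-cells $(F,\alpha)\Rightarrow(G,\beta)$ are natural transformations $\tau\colon F\Rightarrow G$ with $\tau_{Ef}\circ\alpha_f=\beta_f\circ E'(\tau_X,\tau_Y)$ for all $f\colon X\to Y$. A (strict) double category $\mathbb A$ has a category $\mathcal A_0$ of objects and horizontal arrows and a category $\mathcal A_1$ of vertical arrows and squares (under horizontal composition), with domain and codomain functors $\mathcal A_1\rightrightarrows\mathcal A_0$, an identities functor $i\colon\mathcal A_0\to\mathcal A_1$ and a vertical composition making it an internal category in categories. $\mathbf{DBL}$ is the 2-category of double categories, double functors and horizontal natural transformations, and $\mathbf{DBL}^{\mathbf 2}$ is its arrow 2-category (1-cells: strictly commuting squares; 2-cells: compatible pairs of 2-cells). $\mathrm{Sq}(\mathcal C)$ is the double category of commutative squares in $\mathcal C$. For an AWFS, $\mathsf R\text{-}\mathbb{A}\mathrm{lg}$ is the double category with objects and horizontal arrows those of $\mathcal C$, vertical arrows the $\mathsf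 R$-algebras, squares the maps of $\mathsf R$-algebras, and vertical composition of algebras determined by the canonical liftings of $\mathsf L$-coalgebras against $\mathsf R$-algebras: the composite of algebras $\boldsymbol g\colon X\to Y$ and $\boldsymbol h\colon Y\to Z$ has the arrow $hg$, and its structure map is obtained by filling the square $L(hg)\to hg$ first against $\boldsymbol h$ and then against $\boldsymbol g$. The assignment of the forgetful double functor $\mathsf R\text{-}\mathbb{A}\mathrm{lg}\to\mathrm{Sq}(\mathcal C)$ to $(\mathcal C,\mathsf L,\mathsf R)$ extends to the *semantics 2-functor* $\mathbf{AWFS}_{\mathrm{lax}}\to\mathbf{DBL}^{\mathbf 2}$, in which a lax morphism $(F,\alpha)$ sends an $\mathsf R$-algebra $(g,p)$ to $(Fg,\,Fp\circ\alpha_g)$. A *concrete double category* is a double functor $V\colon\mathbb A\to\mathrm{Sq}(\mathcal C)$ with $\mathcal C=\mathcal A_0$, $V_0$ the identity and $V_1\colon\mathcal A_1\to\mathcal C^{\mathbf 2}$ faithful. It is *right-connected* if for each vertical arrow $\boldsymbol f\colon A\to B$ with underlying arrow $f=V\boldsymbol f$ there is a square of $\mathbb A$ with left side $\boldsymbol f$,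 right side the vertical identity of $B$, top side $f$ and bottom side $1_B$; it is *monadic right-connected* if moreover $V_1$ is strictly monadic, that is, it has a left adjoint whose comparison functor is an isomorphism of categories. A double category $\mathbb A$ (without specified $V$) is *right-connected* if for each vertical arrow $\boldsymbol f\colon A\to B$ and each object $C$ the map $\mathcal A_1(\boldsymbol f,iC)\to\mathcal A_0(B,C)$ taking a square to its bottom side is bijective. It then has unit squares $\boldsymbol f\to iB$ with bottom side $1_B$, and an induced functor $\mathcal A_1\to\mathcal A_0^{\mathbf 2}$ sending $\boldsymbol f$ to the top side of its unit square; $\mathbb A$ is *monadic right-connected* if this functor is strictly monadic. An equivalence of 2-categories is a 2-functor that has a 2-functor as inverse up to 2-natural isomorphisms. **Theorem.** 1. The semantics 2-functor $(\mathcal C,\mathsf L,\mathsf R)\mapsto(\mathsf R\text{-}\mathbb{A}\mathrm{lg}\to\mathrm{Sq}(\mathcal C))$ takes its values in, and is an equivalence of 2-categories from $\mathbf{AWFS}_{\mathrm{lax}}$ onto, the full sub-2-category of $\mathbf{DBL}^{\mathbf 2}$ on the monadic right-connected concrete double categories. 2. The 2-functor $(\mathcal C,\mathsf L,\mathsf R)\mapsto\mathsf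 R\text{-}\mathbb{A}\mathrm{lg}$ takes its values in, and is an equivalence of 2-categories from $\mathbf{AWFS}_{\mathrm{lax}}$ onto, the full sub-2-category of $\mathbf{DBL}$ on the monadic right-connected double categories. -/

import Mathlib

universe v u w

open CategoryTheory

namespace DoubleBeck

/-! ### Strict 2-functors, 2-natural isomorphisms and equivalences of 2-categories -/

section TwoCategories

open Bicategory

universe w₁ w₂ v₁ v₂ u₁ u₂

variable {B : Type u₁} [Bicategory.{w₁, v₁} B] {C : Type u₂} [Bicategory.{w₂, v₂} C]

/-- A 2-natural isomorphism between strict 2-functors: invertible 1-cells `hom X`, strictly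
natural with respect to 1-cells and natural with respect to 2-cells. -/
structure TwoNatIso (F G : StrictPseudofunctor B C) where
  hom (X : B) : F.obj X ⟶ G.obj X
  inv (X : B) : G.obj X ⟶ F.obj X
  hom_inv (X : B) : hom X ≫ inv X = 𝟙 (F.obj X)
  inv_hom (X : B) : inv X ≫ hom X = 𝟙 (G.obj X)
  naturality {X Y : B} (f : X ⟶ Y) : F.map f ≫ hom Y = hom X ≫ G.map f
  naturality₂ {X Y : B} {f g : X ⟶ Y} (η : f ⟶ g) :
    F.map₂ η ▷ hom Y ≫ eqToHom (naturality g) = eqToHom (naturality f) ≫ hom X ◁ G.map₂ η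

/-- A strict 2-functor is an equivalence of 2-categories if it has a strict 2-functor as
inverse up to 2-natural isomorphisms. -/
def IsTwoEquivalence (F : StrictPseudofunctor B C) : Prop :=
  ∃ G : StrictPseudofunctor C B,
    Nonempty (TwoNatIso (StrictPseudofunctor.id B) (F.comp G)) ∧
      Nonempty (TwoNatIso (G.comp F) (StrictPseudofunctor.id C))

end TwoCategories

/-! ### The arrow 2-category of a 2-category -/

section ArrowTwo

open Bicategory

universe w₁ v₁ u₁

/-- Objects of the arrow 2-category: 1-cells of `B`. -/
structure ArrowTwo (B : Type u₁) [Bicategory.{w₁, v₁} B] where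
  src : B
  tgt : B
  arr : src ⟶ tgt

namespace ArrowTwo

variable {B : Type u₁} [Bicategory.{w₁, v₁} B]

/-- 1-cells of the arrow 2-category: strictly commuting squares. -/
@[ext]
structure Hom (X Y : ArrowTwo B) where
  top : X.src ⟶ Y.src
  bot : X.tgt ⟶ Y.tgt
  comm : top ≫ Y.arr = X.arr ≫ bot

/-- 2-cells of the arrow 2-category: pairs of 2-cells whose whiskerings agree. -/
@[ext]
structure Hom₂ {X Y : ArrowTwo B} (f g : Hom X Y) where
  top : f.top ⟶ g.top
  bot : f.bot ⟶ g.bot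
  comm : top ▷ Y.arr ≫ eqToHom g.comm = eqToHom f.comm ≫ X.arr ◁ bot

variable [Strict B]

instance categoryStruct : CategoryStruct (ArrowTwo B) where
  Hom X Y := Hom X Y
  id X := ⟨𝟙 _, 𝟙 _, by rw [Strict.id_comp, Strict.comp_id]⟩
  comp {X Y Z} f g := ⟨f.top ≫ g.top, f.bot ≫ g.bot, by
    rw [Strict.assoc, g.comm, ← Strict.assoc, f.comm, Strict.assoc]⟩

instance homCategory (X Y : ArrowTwo B) : Category (X ⟶ Y) where
  Hom f g := Hom₂ f g
  id f := ⟨𝟙 _, 𝟙 _, by simp⟩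
  comp {f g h} a b := ⟨a.top ≫ b.top, a.bot ≫ b.bot, by
    rw [comp_whiskerRight, Category.assoc, b.comm, ← Category.assoc, a.comm,
      Category.assoc, whiskerLeft_comp]⟩
  id_comp _ := Hom₂.ext (Category.id_comp _) (Category.id_comp _)
  comp_id _ := Hom₂.ext (Category.comp_id _) (Category.comp_id _)
  assoc _ _ _ := Hom₂.ext (Category.assoc _ _ _) (Category.assoc _ _ _)

section simps
variable {X Y Z : ArrowTwo B}

@[simp] lemma id_top : (𝟙 X : X ⟶ X).top = 𝟙 X.src := rfl
@[simp] lemma id_bot : (𝟙 X : X ⟶ X).bot = 𝟙 X.tgt := rfl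
@[simp] lemma comp_top (f : X ⟶ Y) (g : Y ⟶ Z) : (f ≫ g).top = f.top ≫ g.top := rfl
@[simp] lemma comp_bot (f : X ⟶ Y) (g : Y ⟶ Z) : (f ≫ g).bot = f.bot ≫ g.bot := rfl
@[simp] lemma id₂_top (f : X ⟶ Y) : (𝟙 f : f ⟶ f).top = 𝟙 f.top := rfl
@[simp] lemma id₂_bot (f : X ⟶ Y) : (𝟙 f : f ⟶ f).bot = 𝟙 f.bot := rfl
@[simp] lemma comp₂_top {f g h : X ⟶ Y} (a : f ⟶ g) (b : g ⟶ h) :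
    (a ≫ b).top = a.top ≫ b.top := rfl
@[simp] lemma comp₂_bot {f g h : X ⟶ Y} (a : f ⟶ g) (b : g ⟶ h) :
    (a ≫ b).bot = a.bot ≫ b.bot := rfl

lemma hom₂_ext {f g : X ⟶ Y} {a b : f ⟶ g} (ht : a.top = b.top) (hb : a.bot = b.bot) : a = b :=
  Hom₂.ext ht hb

@[simp] lemma eqToHom_top {f g : X ⟶ Y} (h : f = g) :
    (eqToHom h).top = eqToHom (congrArg Hom.top h) := by subst h; rfl
@[simp] lemma eqToHom_bot {f g : X ⟶ Y} (h : f = g) :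
    (eqToHom h).bot = eqToHom (congrArg Hom.bot h) := by subst h; rfl

end simps

/-- Invertible 2-cells of the arrow 2-category from invertible 2-cells of `B`. -/
def isoMk {X Y : ArrowTwo B} {f g : X ⟶ Y} (s : f.top ≅ g.top) (t : f.bot ≅ g.bot)
    (h : s.hom ▷ Y.arr ≫ eqToHom g.comm = eqToHom f.comm ≫ X.arr ◁ t.hom) : f ≅ g where
  hom := ⟨s.hom, t.hom, h⟩
  inv := ⟨s.inv, t.inv, by
    rw [← cancel_epi (s.hom ▷ Y.arr), ← cancel_mono (X.arr ◁ t.hom)]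
    simp [h]⟩
  hom_inv_id := hom₂_ext s.hom_inv_id t.hom_inv_id
  inv_hom_id := hom₂_ext s.inv_hom_id t.inv_hom_id


lemma whiskerLeft_comm {X Y Z : ArrowTwo B} (h : X ⟶ Y) {f g : Y ⟶ Z} (η : f ⟶ g) :
    (h.top ◁ η.top) ▷ Z.arr ≫ eqToHom (h ≫ g).comm =
      eqToHom (h ≫ f).comm ≫ X.arr ◁ (h.bot ◁ η.bot) := by
  have e := congrArg (fun t => h.top ◁ t) η.comm
  simp only [whiskerLeft_comp, whiskerLeft_eqToHom] at e
  have k : h.top ◁ (Y.arr ◁ η.bot) = eqToHom (by rw [← Strict.assoc, h.comm, Strict.assoc]) ≫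
      X.arr ◁ (h.bot ◁ η.bot) ≫
        eqToHom (by rw [← Strict.assoc, ← h.comm, Strict.assoc]) := by
    have aux : ∀ {m : X.src ⟶ Y.tgt} (q : h.top ≫ Y.arr = m), h.top ◁ (Y.arr ◁ η.bot) =
        eqToHom (by rw [← Strict.assoc, q]) ≫ (m ◁ η.bot) ≫
          eqToHom (by rw [← q, Strict.assoc]) := by
      rintro _ rfl
      simp [Strict.associator_eqToIso]
    rw [aux h.comm]
    simp [Strict.associator_eqToIso]
  rw [k] at e
  simp only [whisker_assoc, Strict.associator_eqToIso, eqToIso.hom, eqToIso.inv, Category.assoc,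
    eqToHom_trans]
  rw [← cancel_mono (eqToHom (show X.arr ≫ h.bot ≫ g.bot = h.top ≫ Y.arr ≫ g.bot by
    rw [← Strict.assoc, ← h.comm, Strict.assoc]))]
  simp only [Category.assoc, eqToHom_trans]
  rw [e]
  simp

lemma whiskerRight_comm {X Y Z : ArrowTwo B} {f g : X ⟶ Y} (η : f ⟶ g) (h : Y ⟶ Z) :
    (η.top ▷ h.top) ▷ Z.arr ≫ eqToHom (g ≫ h).comm =
      eqToHom (f ≫ h).comm ≫ X.arr ◁ (η.bot ▷ h.bot) := by
  have e := congrArg (fun t => t ▷ h.bot) η.comm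
  simp only [comp_whiskerRight, eqToHom_whiskerRight] at e
  have k : (η.top ▷ Y.arr) ▷ h.bot = eqToHom (by rw [Strict.assoc, ← h.comm, Strict.assoc]) ≫
      (η.top ▷ h.top) ▷ Z.arr ≫
        eqToHom (by rw [Strict.assoc, h.comm, Strict.assoc]) := by
    have aux : ∀ {m : Y.src ⟶ Z.tgt} (q : Y.arr ≫ h.bot = m), (η.top ▷ Y.arr) ▷ h.bot =
        eqToHom (by rw [Strict.assoc, q]) ≫ (η.top ▷ m) ≫
          eqToHom (by rw [← q, Strict.assoc]) := by
      rintro _ rfl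
      simp [Strict.associator_eqToIso]
    rw [aux h.comm.symm]
    simp [Strict.associator_eqToIso]
  rw [k] at e
  rw [← cancel_epi (eqToHom (show (f.top ≫ Y.arr) ≫ h.bot = (f.top ≫ h.top) ≫ Z.arr by
    rw [Strict.assoc, ← h.comm, Strict.assoc]))]
  rw [← cancel_mono (eqToHom (show X.arr ≫ g.bot ≫ h.bot = (X.arr ≫ g.bot) ≫ h.bot by
    rw [Strict.assoc]))]
  simp only [Category.assoc, eqToHom_trans] at e ⊢
  rw [e]
  simp [Strict.associator_eqToIso]

instance bicategory : Bicategory (ArrowTwo B) where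
  toCategoryStruct := categoryStruct
  homCategory := homCategory
  whiskerLeft h _ _ η := Hom₂.mk (h.top ◁ η.top) (h.bot ◁ η.bot) (whiskerLeft_comm h η)
  whiskerRight η h := Hom₂.mk (η.top ▷ h.top) (η.bot ▷ h.bot) (whiskerRight_comm η h)
  associator f g h := isoMk (α_ f.top g.top h.top) (α_ f.bot g.bot h.bot)
    (by simp [Strict.associator_eqToIso])
  leftUnitor f := isoMk (λ_ f.top) (λ_ f.bot) (by simp [Strict.leftUnitor_eqToIso])
  rightUnitor f := isoMk (ρ_ f.top) (ρ_ f.bot) (by simp [Strict.rightUnitor_eqToIso])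
  whiskerLeft_id _ _ := hom₂_ext (by simp) (by simp)
  whiskerLeft_comp _ _ _ _ _ _ := hom₂_ext (by simp) (by simp)
  id_whiskerLeft _ := hom₂_ext (id_whiskerLeft _) (id_whiskerLeft _)
  comp_whiskerLeft _ _ _ _ _ := hom₂_ext (comp_whiskerLeft _ _ _) (comp_whiskerLeft _ _ _)
  id_whiskerRight _ _ := hom₂_ext (by simp) (by simp)
  comp_whiskerRight _ _ _ := hom₂_ext (by simp) (by simp)
  whiskerRight_id _ := hom₂_ext (whiskerRight_id _) (whiskerRight_id _)
  whiskerRight_comp _ _ _ := hom₂_ext (whiskerRight_comp _ _ _) (whiskerRight_comp _ _ _)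
  whisker_assoc _ _ _ _ _ := hom₂_ext (whisker_assoc _ _ _) (whisker_assoc _ _ _)
  whisker_exchange _ _ := hom₂_ext (whisker_exchange _ _) (whisker_exchange _ _)
  pentagon _ _ _ _ := hom₂_ext (pentagon _ _ _ _) (pentagon _ _ _ _)
  triangle _ _ := hom₂_ext (triangle _ _) (triangle _ _)

lemma iso_eq {X Y : ArrowTwo B} {f g : X ⟶ Y} (e : f ≅ g) (h : f = g)
    (ht : e.hom.top = eqToHom (congrArg Hom.top h))
    (hb : e.hom.bot = eqToHom (congrArg Hom.bot h)) : e = eqToIso h :=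
  Iso.ext (hom₂_ext (ht.trans (eqToHom_top h).symm) (hb.trans (eqToHom_bot h).symm))

instance strict : Strict (ArrowTwo B) where
  id_comp f := Hom.ext (Strict.id_comp f.top) (Strict.id_comp f.bot)
  comp_id f := Hom.ext (Strict.comp_id f.top) (Strict.comp_id f.bot)
  assoc f g h := Hom.ext (Strict.assoc f.top g.top h.top) (Strict.assoc f.bot g.bot h.bot)
  leftUnitor_eqToIso f := iso_eq _ _ (congrArg Iso.hom (Strict.leftUnitor_eqToIso f.top))
    (congrArg Iso.hom (Strict.leftUnitor_eqToIso f.bot))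
  rightUnitor_eqToIso f := iso_eq _ _ (congrArg Iso.hom (Strict.rightUnitor_eqToIso f.top))
    (congrArg Iso.hom (Strict.rightUnitor_eqToIso f.bot))
  associator_eqToIso f g h :=
    iso_eq _ _ (congrArg Iso.hom (Strict.associator_eqToIso f.top g.top h.top))
      (congrArg Iso.hom (Strict.associator_eqToIso f.bot g.bot h.bot))

/-- The strict 2-functor sending a 1-cell of `B` to its source. -/
def source (B : Type u₁) [Bicategory.{w₁, v₁} B] [Strict B] :
    StrictPseudofunctor (ArrowTwo B) B :=
  StrictPseudofunctor.mk''
    { obj := fun X => X.src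
      map := fun f => f.top
      map₂ := fun η => η.top
      map₂_id := fun _ => rfl
      map₂_comp := fun _ _ => rfl
      map_id := fun _ => rfl
      map_comp := fun _ _ => rfl
      map₂_whisker_left := fun f _ _ η => by
        rw [eqToHom_refl, eqToHom_refl]; exact ((Category.id_comp _).trans (Category.comp_id _)).symm
      map₂_whisker_right := fun η g => by
        rw [eqToHom_refl, eqToHom_refl]; exact ((Category.id_comp _).trans (Category.comp_id _)).symm }

end ArrowTwo
end ArrowTwo
/-! ### Double categories -/

/-- A (strict) double category: an internal category in categories, with category of objects
and horizontal arrows `A₀ = Obj` and category of vertical arrows and squares `A₁`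
(see `DoubleCat.One`).  `Vert X Y` is the type of vertical arrows with domain `X` and codomain
`Y`; a square `α : Sq u u'` has left side `u`, right side `u'`, top side `top α` and bottom side
`bot α`.  Squares are composed horizontally by `hcomp` and vertically by `vcompSq`.  The laws
that relate squares between vertical arrows which are only propositionally equal are stated as
heterogeneous equalities. -/
structure DoubleCat where
  Obj : Type u
  [cat : Category.{v} Obj]
  Vert : Obj → Obj → Type w
  vid (X : Obj) : Vert X X
  vcomp {X Y Z : Obj} : Vert X Y → Vert Y Z → Vert X Z
  vid_vcomp {X Y : Obj} (a : Vert X Y) : vcomp (vid X) a = a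
  vcomp_vid {X Y : Obj} (a : Vert X Y) : vcomp a (vid Y) = a
  vassoc {X Y Z T : Obj} (a : Vert X Y) (b : Vert Y Z) (c : Vert Z T) :
    vcomp (vcomp a b) c = vcomp a (vcomp b c)
  Sq {X Y X' Y' : Obj} : Vert X Y → Vert X' Y' → Type v
  top {X Y X' Y' : Obj} {a : Vert X Y} {a' : Vert X' Y'} : Sq a a' → (X ⟶ X')
  bot {X Y X' Y' : Obj} {a : Vert X Y} {a' : Vert X' Y'} : Sq a a' → (Y ⟶ Y')
  hid {X Y : Obj} (a : Vert X Y) : Sq a a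
  hcomp {X Y X' Y' X'' Y'' : Obj} {a : Vert X Y} {a' : Vert X' Y'} {a'' : Vert X'' Y''} :
    Sq a a' → Sq a' a'' → Sq a a''
  hid_hcomp {X Y X' Y' : Obj} {a : Vert X Y} {a' : Vert X' Y'} (α : Sq a a') :
    hcomp (hid a) α = α
  hcomp_hid {X Y X' Y' : Obj} {a : Vert X Y} {a' : Vert X' Y'} (α : Sq a a') :
    hcomp α (hid a') = α
  hassoc {X Y X' Y' X'' Y'' X₃ Y₃ : Obj} {a : Vert X Y} {a' : Vert X' Y'} {a'' : Vert X'' Y''}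
    {a₃ : Vert X₃ Y₃} (α : Sq a a') (β : Sq a' a'') (γ : Sq a'' a₃) :
    hcomp (hcomp α β) γ = hcomp α (hcomp β γ)
  top_hid {X Y : Obj} (a : Vert X Y) : top (hid a) = 𝟙 X
  bot_hid {X Y : Obj} (a : Vert X Y) : bot (hid a) = 𝟙 Y
  top_hcomp {X Y X' Y' X'' Y'' : Obj} {a : Vert X Y} {a' : Vert X' Y'} {a'' : Vert X'' Y''}
    (α : Sq a a') (β : Sq a' a'') : top (hcomp α β) = top α ≫ top β
  bot_hcomp {X Y X' Y' X'' Y'' : Obj} {a : Vert X Y} {a' : Vert X' Y'} {a'' : Vert X'' Y''}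
    (α : Sq a a') (β : Sq a' a'') : bot (hcomp α β) = bot α ≫ bot β
  vidSq {X X' : Obj} (f : X ⟶ X') : Sq (vid X) (vid X')
  top_vidSq {X X' : Obj} (f : X ⟶ X') : top (vidSq f) = f
  bot_vidSq {X X' : Obj} (f : X ⟶ X') : bot (vidSq f) = f
  vidSq_id (X : Obj) : vidSq (𝟙 X) = hid (vid X)
  vidSq_comp {X X' X'' : Obj} (f : X ⟶ X') (g : X' ⟶ X'') :
    vidSq (f ≫ g) = hcomp (vidSq f) (vidSq g)
  vcompSq {X Y Z X' Y' Z' : Obj} {a : Vert X Y} {b : Vert Y Z} {a' : Vert X' Y'}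
    {b' : Vert Y' Z'} (α : Sq a a') (β : Sq b b') (h : bot α = top β) :
    Sq (vcomp a b) (vcomp a' b')
  top_vcompSq {X Y Z X' Y' Z' : Obj} {a : Vert X Y} {b : Vert Y Z} {a' : Vert X' Y'}
    {b' : Vert Y' Z'} (α : Sq a a') (β : Sq b b') (h : bot α = top β) :
    top (vcompSq α β h) = top α
  bot_vcompSq {X Y Z X' Y' Z' : Obj} {a : Vert X Y} {b : Vert Y Z} {a' : Vert X' Y'}
    {b' : Vert Y' Z'} (α : Sq a a') (β : Sq b b') (h : bot α = top β) :
    bot (vcompSq α β h) = bot β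
  vcompSq_hid {X Y Z : Obj} (a : Vert X Y) (b : Vert Y Z) :
    vcompSq (hid a) (hid b) ((bot_hid a).trans (top_hid b).symm) = hid (vcomp a b)
  interchange {X Y Z X' Y' Z' X'' Y'' Z'' : Obj} {a : Vert X Y} {b : Vert Y Z} {a' : Vert X' Y'}
    {b' : Vert Y' Z'} {a'' : Vert X'' Y''} {b'' : Vert Y'' Z''}
    (α : Sq a a') (β : Sq b b') (α' : Sq a' a'') (β' : Sq b' b'')
    (h : bot α = top β) (h' : bot α' = top β') :
    vcompSq (hcomp α α') (hcomp β β') (by rw [bot_hcomp, top_hcomp, h, h']) =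
      hcomp (vcompSq α β h) (vcompSq α' β' h')
  vidSq_vcompSq {X Y X' Y' : Obj} {a : Vert X Y} {a' : Vert X' Y'} (α : Sq a a') :
    vcompSq (vidSq (top α)) α (bot_vidSq _) ≍ α
  vcompSq_vidSq {X Y X' Y' : Obj} {a : Vert X Y} {a' : Vert X' Y'} (α : Sq a a') :
    vcompSq α (vidSq (bot α)) (top_vidSq _).symm ≍ α
  vassocSq {X Y Z T X' Y' Z' T' : Obj} {a : Vert X Y} {b : Vert Y Z} {c : Vert Z T}
    {a' : Vert X' Y'} {b' : Vert Y' Z'} {c' : Vert Z' T'}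
    (α : Sq a a') (β : Sq b b') (γ : Sq c c') (h : bot α = top β) (h' : bot β = top γ) :
    vcompSq (vcompSq α β h) γ ((bot_vcompSq α β h).trans h') ≍
      vcompSq α (vcompSq β γ h') (h.trans (top_vcompSq β γ h').symm)

attribute [instance] DoubleCat.cat

namespace DoubleCat

/-- The objects of the category `A₁` of vertical arrows and squares of a double category. -/
structure One (A : DoubleCat.{v, u, w}) where
  {dom : A.Obj}
  {cod : A.Obj}
  vert : A.Vert dom cod

/-- The category `A₁` of vertical arrows and squares, under horizontal composition. -/
instance (A : DoubleCat.{v, u, w}) : Category.{v} A.One where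
  Hom a b := A.Sq a.vert b.vert
  id a := A.hid a.vert
  comp α β := A.hcomp α β
  id_comp α := A.hid_hcomp α
  comp_id α := A.hcomp_hid α
  assoc α β γ := A.hassoc α β γ

end DoubleCat

/-- A double functor: an internal functor between internal categories in categories. -/
structure DoubleFunctor (A B : DoubleCat.{v, u, w}) where
  /-- the action on objects and horizontal arrows -/
  H : A.Obj ⥤ B.Obj
  /-- the action on vertical arrows -/
  V {X Y : A.Obj} : A.Vert X Y → B.Vert (H.obj X) (H.obj Y)
  /-- the action on squares -/
  S {X Y X' Y' : A.Obj} {a : A.Vert X Y} {a' : A.Vert X' Y'} : A.Sq a a' → B.Sq (V a) (V a')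
  V_vid (X : A.Obj) : V (A.vid X) = B.vid (H.obj X)
  V_vcomp {X Y Z : A.Obj} (a : A.Vert X Y) (b : A.Vert Y Z) :
    V (A.vcomp a b) = B.vcomp (V a) (V b)
  top_S {X Y X' Y' : A.Obj} {a : A.Vert X Y} {a' : A.Vert X' Y'} (α : A.Sq a a') :
    B.top (S α) = H.map (A.top α)
  bot_S {X Y X' Y' : A.Obj} {a : A.Vert X Y} {a' : A.Vert X' Y'} (α : A.Sq a a') :
    B.bot (S α) = H.map (A.bot α)
  S_hid {X Y : A.Obj} (a : A.Vert X Y) : S (A.hid a) = B.hid (V a)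
  S_hcomp {X Y X' Y' X'' Y'' : A.Obj} {a : A.Vert X Y} {a' : A.Vert X' Y'}
    {a'' : A.Vert X'' Y''} (α : A.Sq a a') (β : A.Sq a' a'') :
    S (A.hcomp α β) = B.hcomp (S α) (S β)
  S_vidSq {X X' : A.Obj} (f : X ⟶ X') : S (A.vidSq f) ≍ B.vidSq (H.map f)
  S_vcompSq {X Y Z X' Y' Z' : A.Obj} {a : A.Vert X Y} {b : A.Vert Y Z} {a' : A.Vert X' Y'}
    {b' : A.Vert Y' Z'} (α : A.Sq a a') (β : A.Sq b b') (h : A.bot α = A.top β) :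
    S (A.vcompSq α β h) ≍ B.vcompSq (S α) (S β) (by rw [bot_S, top_S, h])

namespace DoubleFunctor

variable {A B C D : DoubleCat.{v, u, w}}

lemma S_heq (F : DoubleFunctor A B) {X Y X' Y' : A.Obj} {a b : A.Vert X Y} {a' b' : A.Vert X' Y'}
    (h : a = b) (h' : a' = b') {α : A.Sq a a'} {β : A.Sq b b'} (e : α ≍ β) : F.S α ≍ F.S β := by
  subst h; subst h'; rw [eq_of_heq e]

/-- The identity double functor. -/
def id (A : DoubleCat.{v, u, w}) : DoubleFunctor A A where
  H := 𝟭 A.Obj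
  V a := a
  S α := α
  V_vid _ := rfl
  V_vcomp _ _ := rfl
  top_S _ := rfl
  bot_S _ := rfl
  S_hid _ := rfl
  S_hcomp _ _ := rfl
  S_vidSq _ := HEq.rfl
  S_vcompSq _ _ _ := HEq.rfl

/-- Composition of double functors, in diagrammatic order. -/
def comp (F : DoubleFunctor A B) (G : DoubleFunctor B C) : DoubleFunctor A C where
  H := F.H ⋙ G.H
  V a := G.V (F.V a)
  S α := G.S (F.S α)
  V_vid X := by rw [F.V_vid, G.V_vid]; rfl
  V_vcomp a b := by rw [F.V_vcomp, G.V_vcomp]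
  top_S α := by rw [G.top_S, F.top_S]; rfl
  bot_S α := by rw [G.bot_S, F.bot_S]; rfl
  S_hid a := by rw [F.S_hid, G.S_hid]
  S_hcomp α β := by rw [F.S_hcomp, G.S_hcomp]
  S_vidSq f := (G.S_heq (F.V_vid _) (F.V_vid _) (F.S_vidSq f)).trans (G.S_vidSq (F.H.map f))
  S_vcompSq α β h :=
    (G.S_heq (F.V_vcomp _ _) (F.V_vcomp _ _) (F.S_vcompSq α β h)).trans (G.S_vcompSq _ _ _)

/-- The functor `F₁ : A₁ ⥤ B₁` on vertical arrows and squares induced by a double functor. -/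
def one (F : DoubleFunctor A B) : A.One ⥤ B.One where
  obj a := ⟨F.V a.vert⟩
  map α := F.S α
  map_id a := F.S_hid a.vert
  map_comp α β := F.S_hcomp α β

end DoubleFunctor

/-- A horizontal natural transformation between double functors: a natural transformation
between the functors on horizontal arrows and one between the functors on vertical arrows and
squares, compatible with domains, codomains, vertical identities and vertical composition. -/
structure HorTrans {A B : DoubleCat.{v, u, w}} (F G : DoubleFunctor A B) where
  app : F.H ⟶ G.H
  sq {X Y : A.Obj} (a : A.Vert X Y) : B.Sq (F.V a) (G.V a)
  top_sq {X Y : A.Obj} (a : A.Vert X Y) : B.top (sq a) = app.app X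
  bot_sq {X Y : A.Obj} (a : A.Vert X Y) : B.bot (sq a) = app.app Y
  naturality {X Y X' Y' : A.Obj} {a : A.Vert X Y} {a' : A.Vert X' Y'} (α : A.Sq a a') :
    B.hcomp (F.S α) (sq a') = B.hcomp (sq a) (G.S α)
  sq_vid (X : A.Obj) : sq (A.vid X) ≍ B.vidSq (app.app X)
  sq_vcomp {X Y Z : A.Obj} (a : A.Vert X Y) (b : A.Vert Y Z) :
    sq (A.vcomp a b) ≍ B.vcompSq (sq a) (sq b) ((bot_sq a).trans (top_sq b).symm)

lemma DoubleCat.hcomp_heq (B : DoubleCat.{v, u, w}) {X Y X' Y' X'' Y'' : B.Obj}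
    {a b : B.Vert X Y} {a' b' : B.Vert X' Y'} {a'' b'' : B.Vert X'' Y''}
    {α : B.Sq a a'} {α' : B.Sq a' a''} {β : B.Sq b b'} {β' : B.Sq b' b''}
    (h : a = b) (h' : a' = b') (h'' : a'' = b'') (e : α ≍ β) (e' : α' ≍ β') :
    B.hcomp α α' ≍ B.hcomp β β' := by
  subst h; subst h'; subst h''; rw [eq_of_heq e, eq_of_heq e']

namespace HorTrans

variable {A B C D : DoubleCat.{v, u, w}}

lemma ext' {F G : DoubleFunctor A B} {σ τ : HorTrans F G} (h : σ.app = τ.app)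
    (h' : ∀ {X Y : A.Obj} (a : A.Vert X Y), σ.sq a = τ.sq a) : σ = τ := by
  cases σ with | mk s q _ _ _ _ _ => cases τ with | mk s' q' _ _ _ _ _ =>
  have e : @q = @q' := by
    funext X Y a; exact h' a
  cases h; cases e; rfl

lemma sq_heq {F G : DoubleFunctor A B} (τ : HorTrans F G) {X Y : A.Obj} {a b : A.Vert X Y}
    (h : a = b) : τ.sq a ≍ τ.sq b := by subst h; rfl

/-- The identity horizontal transformation. -/
def id (F : DoubleFunctor A B) : HorTrans F F where
  app := 𝟙 F.H
  sq a := B.hid (F.V a)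
  top_sq _ := B.top_hid _
  bot_sq _ := B.bot_hid _
  naturality α := by rw [B.hid_hcomp, B.hcomp_hid]
  sq_vid X := by
    rw [F.V_vid, ← B.vidSq_id]; rfl
  sq_vcomp a b := by
    rw [F.V_vcomp, B.vcompSq_hid]

/-- Vertical composition in the 2-category of double categories (that is, horizontal composition
of components). -/
def comp {F G K : DoubleFunctor A B} (σ : HorTrans F G) (τ : HorTrans G K) : HorTrans F K where
  app := σ.app ≫ τ.app
  sq a := B.hcomp (σ.sq a) (τ.sq a)
  top_sq a := by rw [B.top_hcomp, σ.top_sq, τ.top_sq]; rfl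
  bot_sq a := by rw [B.bot_hcomp, σ.bot_sq, τ.bot_sq]; rfl
  naturality α := by
    rw [← B.hassoc, σ.naturality, B.hassoc, τ.naturality, B.hassoc]
  sq_vid X := by
    refine (B.hcomp_heq (F.V_vid X) (G.V_vid X) (K.V_vid X) (σ.sq_vid X) (τ.sq_vid X)).trans ?_
    rw [← B.vidSq_comp]; rfl
  sq_vcomp a b := by
    refine (B.hcomp_heq (F.V_vcomp a b) (G.V_vcomp a b) (K.V_vcomp a b)
      (σ.sq_vcomp a b) (τ.sq_vcomp a b)).trans ?_
    rw [← B.interchange]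

/-- Whiskering on the left. -/
def whiskerLeft (F : DoubleFunctor A B) {G K : DoubleFunctor B C} (τ : HorTrans G K) :
    HorTrans (F.comp G) (F.comp K) where
  app := Functor.whiskerLeft F.H τ.app
  sq a := τ.sq (F.V a)
  top_sq _ := τ.top_sq _
  bot_sq _ := τ.bot_sq _
  naturality α := τ.naturality (F.S α)
  sq_vid X := (τ.sq_heq (F.V_vid X)).trans (τ.sq_vid _)
  sq_vcomp a b := (τ.sq_heq (F.V_vcomp a b)).trans (τ.sq_vcomp _ _)

/-- Whiskering on the right. -/
def whiskerRight {F G : DoubleFunctor A B} (τ : HorTrans F G) (K : DoubleFunctor B C) :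
    HorTrans (F.comp K) (G.comp K) where
  app := Functor.whiskerRight τ.app K.H
  sq a := K.S (τ.sq a)
  top_sq a := (K.top_S _).trans (congrArg K.H.map (τ.top_sq a))
  bot_sq a := (K.bot_S _).trans (congrArg K.H.map (τ.bot_sq a))
  naturality α := by
    change C.hcomp (K.S (F.S α)) _ = C.hcomp _ (K.S (G.S α))
    rw [← K.S_hcomp, τ.naturality, K.S_hcomp]
  sq_vid X := (K.S_heq (F.V_vid X) (G.V_vid X) (τ.sq_vid X)).trans (K.S_vidSq _)
  sq_vcomp a b :=
    (K.S_heq (F.V_vcomp a b) (G.V_vcomp a b) (τ.sq_vcomp a b)).trans (K.S_vcompSq _ _ _)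

end HorTrans

namespace DoubleCat

/-- The 2-category `DBL` of double categories, double functors and horizontal natural
transformations. -/
instance categoryStruct : CategoryStruct DoubleCat.{v, u, w} where
  Hom A B := DoubleFunctor A B
  id A := DoubleFunctor.id A
  comp F G := F.comp G

instance homCategory (A B : DoubleCat.{v, u, w}) : Category (A ⟶ B) where
  Hom F G := HorTrans F G
  id F := HorTrans.id F
  comp σ τ := σ.comp τ
  id_comp σ := HorTrans.ext' (Category.id_comp σ.app) fun _ => B.hid_hcomp _
  comp_id σ := HorTrans.ext' (Category.comp_id σ.app) fun _ => B.hcomp_hid _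
  assoc σ τ ρ := HorTrans.ext' (Category.assoc σ.app τ.app ρ.app) fun _ => B.hassoc _ _ _

section
variable {A B C : DoubleCat.{v, u, w}}

lemma hom₂_ext {F G : A ⟶ B} {σ τ : F ⟶ G} (h : ∀ X, σ.app.app X = τ.app.app X)
    (h' : ∀ {X Y : A.Obj} (a : A.Vert X Y), σ.sq a = τ.sq a) : σ = τ :=
  HorTrans.ext' (NatTrans.ext (funext h)) h'

end

instance bicategory : Bicategory DoubleCat.{v, u, w} where
  toCategoryStruct := categoryStruct
  homCategory := homCategory
  whiskerLeft F _ _ τ := HorTrans.whiskerLeft F τ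
  whiskerRight τ K := HorTrans.whiskerRight τ K
  associator {_ _ _ D} F G K := ⟨HorTrans.id (DoubleFunctor.comp F (DoubleFunctor.comp G K)),
    HorTrans.id (DoubleFunctor.comp F (DoubleFunctor.comp G K)),
    hom₂_ext (fun _ => Category.id_comp _) (fun _ => D.hid_hcomp _),
    hom₂_ext (fun _ => Category.id_comp _) (fun _ => D.hid_hcomp _)⟩
  leftUnitor F := ⟨HorTrans.id F, HorTrans.id F, Category.id_comp (𝟙 F), Category.id_comp (𝟙 F)⟩
  rightUnitor F := ⟨HorTrans.id F, HorTrans.id F, Category.id_comp (𝟙 F), Category.id_comp (𝟙 F)⟩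
  whiskerLeft_id _ _ := rfl
  whiskerLeft_comp _ _ _ _ _ _ := rfl
  id_whiskerLeft {_ B _ _} τ := by
    refine hom₂_ext (fun X => ?_) (fun a => ?_)
    · exact ((Category.id_comp _).trans (Category.comp_id _)).symm
    · exact ((B.hid_hcomp _).trans (B.hcomp_hid _)).symm
  comp_whiskerLeft {_ _ _ D} _ _ _ _ _ := by
    refine hom₂_ext (fun X => ?_) (fun a => ?_)
    · exact ((Category.id_comp _).trans (Category.comp_id _)).symm
    · exact ((D.hid_hcomp _).trans (D.hcomp_hid _)).symm
  id_whiskerRight _ K := hom₂_ext (fun _ => K.H.map_id _) (fun _ => K.S_hid _)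
  comp_whiskerRight _ _ K := hom₂_ext (fun _ => K.H.map_comp _ _) (fun _ => K.S_hcomp _ _)
  whiskerRight_id {_ B _ _} _ := by
    refine hom₂_ext (fun X => ?_) (fun a => ?_)
    · exact ((Category.id_comp _).trans (Category.comp_id _)).symm
    · exact ((B.hid_hcomp _).trans (B.hcomp_hid _)).symm
  whiskerRight_comp {_ _ _ D _ _} _ _ _ := by
    refine hom₂_ext (fun X => ?_) (fun a => ?_)
    · exact ((Category.id_comp _).trans (Category.comp_id _)).symm
    · exact ((D.hid_hcomp _).trans (D.hcomp_hid _)).symm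
  whisker_assoc {_ _ _ D} _ _ _ _ _ := by
    refine hom₂_ext (fun X => ?_) (fun a => ?_)
    · exact ((Category.id_comp _).trans (Category.comp_id _)).symm
    · exact ((D.hid_hcomp _).trans (D.hcomp_hid _)).symm
  whisker_exchange σ τ := hom₂_ext (fun _ => (τ.app.naturality (σ.app.app _)).symm)
    (fun a => (τ.naturality (σ.sq a)).symm)
  pentagon {_ _ _ _ E} _ _ _ K := by
    refine hom₂_ext (fun X => ?_) (fun a => ?_)
    · change K.H.map (𝟙 _) ≫ 𝟙 _ ≫ 𝟙 _ = 𝟙 _ ≫ 𝟙 _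
      rw [K.H.map_id]; simp
    · change E.hcomp (K.S (DoubleCat.hid _ _)) (E.hcomp (E.hid _) (E.hid _)) =
        E.hcomp (E.hid _) (E.hid _)
      rw [K.S_hid, E.hid_hcomp]
  triangle {_ _ C} _ K := by
    refine hom₂_ext (fun X => ?_) (fun a => ?_)
    · change 𝟙 _ ≫ 𝟙 _ = K.H.map (𝟙 _)
      rw [K.H.map_id]; simp
    · change C.hcomp (C.hid _) (C.hid _) = K.S (DoubleCat.hid _ _)
      rw [K.S_hid, C.hid_hcomp]

instance strict : Bicategory.Strict DoubleCat.{v, u, w} where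
  id_comp _ := rfl
  comp_id _ := rfl
  assoc _ _ _ := rfl
  leftUnitor_eqToIso _ := rfl
  rightUnitor_eqToIso _ := rfl
  associator_eqToIso _ _ _ := rfl

end DoubleCat

/-! ### The double category of commutative squares -/

section Squares

variable (C : Type u) [Category.{v} C]

/-- A vertical arrow of the double category of squares in `C`: an arrow of `C`. -/
@[ext]
structure SqArrow (X Y : C) : Type (max v w) where
  hom : X ⟶ Y

lemma SqArrow.heq {C : Type u} [Category.{v} C] {X Y X' Y' : C} {a b : SqArrow.{v, u, w} C X Y} {a' b' : SqArrow.{v, u, w} C X' Y'}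
    (h : a = b) (h' : a' = b') {α : Arrow.mk a.hom ⟶ Arrow.mk a'.hom}
    {β : Arrow.mk b.hom ⟶ Arrow.mk b'.hom} (hl : α.left = β.left) (hr : α.right = β.right) :
    α ≍ β := by
  subst h; subst h'; exact heq_of_eq (Arrow.hom_ext _ _ hl hr)

/-- The double category of commutative squares in `C`. -/
def SqD : DoubleCat.{v, u, max v w} where
  Obj := C
  Vert X Y := SqArrow.{v, u, w} C X Y
  vid X := ⟨𝟙 X⟩
  vcomp a b := ⟨a.hom ≫ b.hom⟩
  vid_vcomp _ := SqArrow.ext (Category.id_comp _)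
  vcomp_vid _ := SqArrow.ext (Category.comp_id _)
  vassoc _ _ _ := SqArrow.ext (Category.assoc _ _ _)
  Sq a b := Arrow.mk a.hom ⟶ Arrow.mk b.hom
  top α := α.left
  bot α := α.right
  hid _ := 𝟙 _
  hcomp α β := α ≫ β
  hid_hcomp α := Category.id_comp α
  hcomp_hid α := Category.comp_id α
  hassoc α β γ := Category.assoc α β γ
  top_hid _ := rfl
  bot_hid _ := rfl
  top_hcomp _ _ := rfl
  bot_hcomp _ _ := rfl
  vidSq f := Arrow.homMk f f (by simp)
  top_vidSq _ := rfl
  bot_vidSq _ := rfl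
  vidSq_id _ := by ext <;> rfl
  vidSq_comp _ _ := by ext <;> rfl
  vcompSq {_ _ _ _ _ _ a b a' b'} α β h := Arrow.homMk α.left β.right (by
    have h1 : α.left ≫ a'.hom = a.hom ≫ α.right := Arrow.w α
    have h2 : β.left ≫ b'.hom = b.hom ≫ β.right := Arrow.w β
    change α.left ≫ a'.hom ≫ b'.hom = (a.hom ≫ b.hom) ≫ β.right
    rw [← Category.assoc, h1, Category.assoc, h, h2, Category.assoc])
  top_vcompSq _ _ _ := rfl
  bot_vcompSq _ _ _ := rfl
  vcompSq_hid _ _ := by ext <;> rfl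
  interchange _ _ _ _ _ _ := by ext <;> rfl
  vidSq_vcompSq _ := SqArrow.heq (SqArrow.ext (Category.id_comp _))
    (SqArrow.ext (Category.id_comp _)) rfl rfl
  vcompSq_vidSq _ := SqArrow.heq (SqArrow.ext (Category.comp_id _))
    (SqArrow.ext (Category.comp_id _)) rfl rfl
  vassocSq _ _ _ _ _ := SqArrow.heq (SqArrow.ext (Category.assoc _ _ _))
    (SqArrow.ext (Category.assoc _ _ _)) rfl rfl

/-- The vertical arrows and squares of `SqD C`, as objects and arrows of the arrow category. -/
def sqOne : (SqD.{v, u, w} C).One ⥤ Arrow C where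
  obj a := Arrow.mk a.vert.hom
  map α := α

variable {C}

/-- The functor `V₁ : A₁ ⥤ C²` underlying a double functor `V` to the double category of squares
in `C`. -/
def DoubleFunctor.toArrow {A : DoubleCat.{v, u, max v w}} (V : DoubleFunctor A (SqD.{v, u, w} C)) :
    A.One ⥤ Arrow C :=
  V.one ⋙ sqOne.{v, u, w} C

variable {D : Type u} [Category.{v} D]

/-- The double functor between double categories of squares induced by a functor. -/
def sqMap (F : C ⥤ D) : DoubleFunctor (SqD.{v, u, w} C) (SqD.{v, u, w} D) where
  H := F
  V a := ⟨F.map a.hom⟩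
  S α := F.mapArrow.map α
  V_vid X := SqArrow.ext (F.map_id X)
  V_vcomp a b := SqArrow.ext (F.map_comp a.hom b.hom)
  top_S _ := rfl
  bot_S _ := rfl
  S_hid _ := F.mapArrow.map_id _
  S_hcomp α β := F.mapArrow.map_comp α β
  S_vidSq _ := SqArrow.heq.{v, u, w} (SqArrow.ext (F.map_id _)) (SqArrow.ext (F.map_id _)) rfl rfl
  S_vcompSq _ _ _ := SqArrow.heq.{v, u, w} (SqArrow.ext (F.map_comp _ _)) (SqArrow.ext (F.map_comp _ _))
    rfl rfl

/-- The horizontal transformation induced by a natural transformation. -/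
def sqMap₂ {F G : C ⥤ D} (τ : F ⟶ G) :
    HorTrans (sqMap.{v, u, w} F) (sqMap.{v, u, w} G) where
  app := τ
  sq a := Arrow.homMk (τ.app _) (τ.app _) (τ.naturality a.hom).symm
  top_sq _ := rfl
  bot_sq _ := rfl
  naturality α := Arrow.hom_ext _ _ (τ.naturality α.left) (τ.naturality α.right)
  sq_vid _ := SqArrow.heq.{v, u, w} (SqArrow.ext (F.map_id _)) (SqArrow.ext (G.map_id _)) rfl rfl
  sq_vcomp _ _ := SqArrow.heq.{v, u, w} (SqArrow.ext (F.map_comp _ _)) (SqArrow.ext (G.map_comp _ _))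
    rfl rfl

end Squares

/-! ### Algebraic weak factorisation systems -/

/-- A functorial factorisation `f = r f ∘ l f` through `E f`, that is, a section of the
composition functor from composable pairs to arrows. -/
structure FunctorialFactorisation (C : Type u) [Category.{v} C] where
  E : Arrow C ⥤ C
  l : Arrow.leftFunc ⟶ E
  r : E ⟶ Arrow.rightFunc
  fac (f : Arrow C) : l.app f ≫ r.app f = f.hom

namespace FunctorialFactorisation

variable {C : Type u} [Category.{v} C] (F : FunctorialFactorisation C)

/-- The endofunctor `f ↦ l f` of the arrow category. -/
def L : Arrow C ⥤ Arrow C where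
  obj f := Arrow.mk (F.l.app f)
  map φ := Arrow.homMk φ.left (F.E.map φ) (F.l.naturality φ)
  map_id f := Arrow.hom_ext _ _ rfl (F.E.map_id f)
  map_comp φ ψ := Arrow.hom_ext _ _ rfl (F.E.map_comp φ ψ)

/-- The endofunctor `f ↦ r f` of the arrow category. -/
def R : Arrow C ⥤ Arrow C where
  obj f := Arrow.mk (F.r.app f)
  map φ := Arrow.homMk (F.E.map φ) φ.right (F.r.naturality φ)
  map_id f := Arrow.hom_ext _ _ (F.E.map_id f) rfl
  map_comp φ ψ := Arrow.hom_ext _ _ (F.E.map_comp φ ψ) rfl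

/-- The counit `(1, r f) : l f ⟶ f`. -/
def ε : F.L ⟶ 𝟭 (Arrow C) where
  app f := Arrow.homMk (𝟙 f.left) (F.r.app f) ((Category.id_comp _).trans (F.fac f).symm)
  naturality _ _ φ := Arrow.hom_ext _ _ ((Category.comp_id φ.left).trans (Category.id_comp _).symm)
    (F.r.naturality φ)

/-- The unit `(l f, 1) : f ⟶ r f`. -/
def η : 𝟭 (Arrow C) ⟶ F.R where
  app f := Arrow.homMk (F.l.app f) (𝟙 f.right) ((F.fac f).trans (Category.comp_id _).symm)
  naturality _ _ φ := Arrow.hom_ext _ _ (F.l.naturality φ)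
    ((Category.comp_id φ.right).trans (Category.id_comp _).symm)

variable {X Y X' Y' X'' Y'' : C}

/-- The object `E f` through which `f` factors. -/
def mid (f : X ⟶ Y) : C := F.E.obj (Arrow.mk f)

/-- The left part `l f` of the factorisation of `f`. -/
def left (f : X ⟶ Y) : X ⟶ F.mid f := F.l.app (Arrow.mk f)

/-- The right part `r f` of the factorisation of `f`. -/
def right (f : X ⟶ Y) : F.mid f ⟶ Y := F.r.app (Arrow.mk f)

/-- The arrow `E (a, b) : E f ⟶ E g` induced by a commutative square `(a, b) : f ⟶ g`. -/
def midMap {f : X ⟶ Y} {g : X' ⟶ Y'} (a : X ⟶ X') (b : Y ⟶ Y') (h : a ≫ g = f ≫ b) :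
    F.mid f ⟶ F.mid g :=
  F.E.map (Arrow.homMk (f := Arrow.mk f) (g := Arrow.mk g) a b h)

lemma left_right (f : X ⟶ Y) : F.left f ≫ F.right f = f := F.fac (Arrow.mk f)

lemma left_midMap {f : X ⟶ Y} {g : X' ⟶ Y'} (a : X ⟶ X') (b : Y ⟶ Y') (h : a ≫ g = f ≫ b) :
    F.left f ≫ F.midMap a b h = a ≫ F.left g :=
  (F.l.naturality (Arrow.homMk (f := Arrow.mk f) (g := Arrow.mk g) a b h)).symm

lemma midMap_right {f : X ⟶ Y} {g : X' ⟶ Y'} (a : X ⟶ X') (b : Y ⟶ Y') (h : a ≫ g = f ≫ b) :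
    F.midMap a b h ≫ F.right g = F.right f ≫ b :=
  F.r.naturality (Arrow.homMk (f := Arrow.mk f) (g := Arrow.mk g) a b h)

lemma midMap_id (f : X ⟶ Y) : F.midMap (𝟙 X) (𝟙 Y) (by simp : 𝟙 X ≫ f = f ≫ 𝟙 Y) = 𝟙 _ :=
  F.E.map_id (Arrow.mk f)

lemma midMap_comp {f : X ⟶ Y} {g : X' ⟶ Y'} {k : X'' ⟶ Y''} (a : X ⟶ X') (b : Y ⟶ Y')
    (h : a ≫ g = f ≫ b) (a' : X' ⟶ X'') (b' : Y' ⟶ Y'') (h' : a' ≫ k = g ≫ b') :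
    F.midMap a b h ≫ F.midMap a' b' h' =
      F.midMap (a ≫ a') (b ≫ b')
        (by rw [Category.assoc, h', ← Category.assoc, h, Category.assoc]) :=
  (F.E.map_comp (Arrow.homMk (f := Arrow.mk f) (g := Arrow.mk g) a b h)
    (Arrow.homMk (f := Arrow.mk g) (g := Arrow.mk k) a' b' h')).symm

lemma midMap_comp_assoc {f : X ⟶ Y} {g : X' ⟶ Y'} {k : X'' ⟶ Y''} (a : X ⟶ X') (b : Y ⟶ Y')
    (h : a ≫ g = f ≫ b) (a' : X' ⟶ X'') (b' : Y' ⟶ Y'') (h' : a' ≫ k = g ≫ b') {Z : C}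
    (t : F.mid k ⟶ Z) : F.midMap a b h ≫ F.midMap a' b' h' ≫ t =
      F.midMap (a ≫ a') (b ≫ b')
        (by rw [Category.assoc, h', ← Category.assoc, h, Category.assoc]) ≫ t := by
  rw [← Category.assoc, midMap_comp]

lemma midMap_congr {f : X ⟶ Y} {g : X' ⟶ Y'} {a a' : X ⟶ X'} {b b' : Y ⟶ Y'}
    {h : a ≫ g = f ≫ b} {h' : a' ≫ g = f ≫ b'} (ea : a = a') (eb : b = b') :
    F.midMap a b h = F.midMap a' b' h' := by
  subst ea; subst eb; rfl

end FunctorialFactorisation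

/-- An algebraic weak factorisation system on `C`: a functorial factorisation, an extension of
`(L, ε)` to a comonad `(L, ε, Δ)`, an extension of `(R, η)` to a monad `(R, η, μ)`, and a
distributive law `δ : LR ⟶ RL` of the comonad over the monad such that `dom δ = cod Δ` and
`cod δ = dom μ`. (Mathlib composes functors in diagrammatic order, so `LR` is `R ⋙ L`.) -/
structure AWFS (C : Type u) [Category.{v} C] where
  F : FunctorialFactorisation C
  Δ : F.L ⟶ F.L ⋙ F.L
  left_counit (f : Arrow C) : Δ.app f ≫ F.ε.app (F.L.obj f) = 𝟙 (F.L.obj f)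
  right_counit (f : Arrow C) : Δ.app f ≫ F.L.map (F.ε.app f) = 𝟙 (F.L.obj f)
  coassoc (f : Arrow C) : Δ.app f ≫ F.L.map (Δ.app f) = Δ.app f ≫ Δ.app (F.L.obj f)
  μ : F.R ⋙ F.R ⟶ F.R
  left_unit (f : Arrow C) : F.η.app (F.R.obj f) ≫ μ.app f = 𝟙 (F.R.obj f)
  right_unit (f : Arrow C) : F.R.map (F.η.app f) ≫ μ.app f = 𝟙 (F.R.obj f)
  assoc (f : Arrow C) : F.R.map (μ.app f) ≫ μ.app f = μ.app (F.R.obj f) ≫ μ.app f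
  δ : F.R ⋙ F.L ⟶ F.L ⋙ F.R
  δ_unit (f : Arrow C) : F.L.map (F.η.app f) ≫ δ.app f = F.η.app (F.L.obj f)
  δ_mul (f : Arrow C) : F.L.map (μ.app f) ≫ δ.app f =
    δ.app (F.R.obj f) ≫ F.R.map (δ.app f) ≫ μ.app (F.L.obj f)
  δ_counit (f : Arrow C) : δ.app f ≫ F.R.map (F.ε.app f) = F.ε.app (F.R.obj f)
  δ_comul (f : Arrow C) : δ.app f ≫ F.R.map (Δ.app f) =
    Δ.app (F.R.obj f) ≫ F.L.map (δ.app f) ≫ δ.app (F.L.obj f)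
  dom_δ (f : Arrow C) : (δ.app f).left = (Δ.app f).right
  cod_δ (f : Arrow C) : (δ.app f).right = (μ.app f).left

namespace AWFS

variable {C : Type u} [Category.{v} C] (W : AWFS C)

/-- The comonad `𝖫 = (L, ε, Δ)`. -/
def comonad : Comonad (Arrow C) where
  toFunctor := W.F.L
  ε := W.F.ε
  δ := W.Δ
  coassoc := W.coassoc
  left_counit := W.left_counit
  right_counit := W.right_counit

/-- The monad `𝖱 = (R, η, μ)`. -/
def monad : Monad (Arrow C) where
  toFunctor := W.F.R
  η := W.F.η
  μ := W.μ
  assoc := W.assoc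
  left_unit := W.left_unit
  right_unit := W.right_unit

variable {X Y X' Y' : C}

/-- The codomain component `E f ⟶ E (l f)` of the comultiplication `Δ` at `f`. -/
def c (f : X ⟶ Y) : W.F.mid f ⟶ W.F.mid (W.F.left f) := (W.Δ.app (Arrow.mk f)).right

/-- The domain component `E (r f) ⟶ E f` of the multiplication `μ` at `f`. -/
def m (f : X ⟶ Y) : W.F.mid (W.F.right f) ⟶ W.F.mid f := (W.μ.app (Arrow.mk f)).left

lemma Δ_left (f : Arrow C) : (W.Δ.app f).left = 𝟙 f.left :=
  (Category.comp_id _).symm.trans (congrArg (fun t => t.left) (W.left_counit f))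

lemma μ_right (f : Arrow C) : (W.μ.app f).right = 𝟙 f.right :=
  (Category.id_comp _).symm.trans (congrArg (fun t => t.right) (W.left_unit f))

lemma c_right (f : X ⟶ Y) : W.c f ≫ W.F.right (W.F.left f) = 𝟙 _ :=
  congrArg (fun t => t.right) (W.left_counit (Arrow.mk f))

lemma c_midMap (f : X ⟶ Y) : W.c f ≫ W.F.midMap (𝟙 X) (W.F.right f)
    ((Category.id_comp _).trans (W.F.left_right f).symm) = 𝟙 _ :=
  congrArg (fun t => t.right) (W.right_counit (Arrow.mk f))

lemma left_c (f : X ⟶ Y) : W.F.left f ≫ W.c f = W.F.left (W.F.left f) := by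
  refine (Arrow.w (W.Δ.app (Arrow.mk f))).symm.trans ?_
  rw [Δ_left]; exact Category.id_comp _

lemma midMap_c {f : X ⟶ Y} {g : X' ⟶ Y'} (a : X ⟶ X') (b : Y ⟶ Y') (h : a ≫ g = f ≫ b) :
    W.F.midMap a b h ≫ W.c g =
      W.c f ≫ W.F.midMap a (W.F.midMap a b h) (W.F.left_midMap a b h).symm :=
  congrArg (fun t => t.right)
    (W.Δ.naturality (Arrow.homMk (f := Arrow.mk f) (g := Arrow.mk g) a b h))

lemma c_c (f : X ⟶ Y) : W.c f ≫ W.c (W.F.left f) = W.c f ≫ W.F.midMap (𝟙 X) (W.c f)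
    ((Category.id_comp _).trans (W.left_c f).symm) := by
  have h : W.c f ≫ W.F.E.map (W.Δ.app (Arrow.mk f)) = W.c f ≫ W.c (W.F.left f) :=
    congrArg (fun t => t.right) (W.coassoc (Arrow.mk f))
  rw [← h]
  exact congrArg (fun t => W.c f ≫ W.F.E.map t) (Arrow.hom_ext _ _ (W.Δ_left _) rfl)

lemma m_right (f : X ⟶ Y) : W.m f ≫ W.F.right f = W.F.right (W.F.right f) := by
  refine (Arrow.w (W.μ.app (Arrow.mk f))).trans ?_
  rw [μ_right]; exact Category.comp_id _

lemma left_m (f : X ⟶ Y) : W.F.left (W.F.right f) ≫ W.m f = 𝟙 _ :=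
  congrArg (fun t => t.left) (W.left_unit (Arrow.mk f))

lemma midMap_m {f : X ⟶ Y} {g : X' ⟶ Y'} (a : X ⟶ X') (b : Y ⟶ Y') (h : a ≫ g = f ≫ b) :
    W.F.midMap (W.F.midMap a b h) b (W.F.midMap_right a b h) ≫ W.m g = W.m f ≫ W.F.midMap a b h :=
  congrArg (fun t => t.left)
    (W.μ.naturality (Arrow.homMk (f := Arrow.mk f) (g := Arrow.mk g) a b h))

lemma m_c (f : X ⟶ Y) : W.m f ≫ W.c f = W.c (W.F.right f) ≫
    W.F.midMap (W.c f) (W.m f) ((W.c_right f).trans (W.left_m f).symm) ≫ W.m (W.F.left f) := by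
  have h : W.m f ≫ (W.δ.app (Arrow.mk f)).left = (W.δ.app (Arrow.mk (W.F.right f))).left ≫
    W.F.E.map (W.δ.app (Arrow.mk f)) ≫ W.m (W.F.left f) :=
      congrArg (fun t => t.left) (W.δ_mul (Arrow.mk f))
  have h1 : (W.δ.app (Arrow.mk f)).left = W.c f := W.dom_δ (Arrow.mk f)
  have h2 : (W.δ.app (Arrow.mk (W.F.right f))).left = W.c (W.F.right f) :=
    W.dom_δ (Arrow.mk (W.F.right f))
  rw [h1, h2] at h
  refine h.trans ?_
  exact congrArg (fun t => W.c (W.F.right f) ≫ W.F.E.map t ≫ W.m (W.F.left f))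
    (Arrow.hom_ext _ _ (W.dom_δ (Arrow.mk f)) (W.cod_δ (Arrow.mk f)))

/-- An `𝖱`-algebra `(g, p)` with underlying arrow `g : X ⟶ Y`, where `p : E g ⟶ X`.
Since `𝖱` is over the codomain functor, `(p, 1) : r g ⟶ g` is the general form of an algebra
structure for the monad `𝖱` on the object `g` of the arrow category. -/
structure RAlg (X Y : C) : Type (max v w) where
  hom : X ⟶ Y
  str : W.F.mid hom ⟶ X
  str_hom : str ≫ hom = W.F.right hom
  unit : W.F.left hom ≫ str = 𝟙 X
  assoc : W.m hom ≫ str =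
    W.F.midMap str (𝟙 Y) (str_hom.trans (Category.comp_id _).symm) ≫ str

namespace RAlg

variable {W} {Z T : C}

/-- The algebra for the monad `𝖱` given by `(g, p)`. -/
def toAlgebra (g : RAlg.{v, u, w} W X Y) : W.monad.Algebra where
  A := Arrow.mk g.hom
  a := Arrow.homMk g.str (𝟙 Y) (g.str_hom.trans (Category.comp_id _).symm)
  unit := Arrow.hom_ext _ _ g.unit (Category.id_comp _)
  assoc := Arrow.hom_ext _ _ g.assoc (congrArg (· ≫ 𝟙 Y) (W.μ_right (Arrow.mk g.hom)))

lemma ext' {g h : RAlg.{v, u, w} W X Y} (e : g.hom = h.hom)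
    (e' : g.str = W.F.midMap (f := g.hom) (g := h.hom) (𝟙 X) (𝟙 Y) (by simp [e]) ≫ h.str) :
    g = h := by
  cases g with | mk g p _ _ _ => cases h with | mk h q _ _ _ =>
  dsimp at e; subst e
  have : p = q := by
    refine e'.trans ?_
    dsimp
    rw [W.F.midMap_id, Category.id_comp]
  subst this; rfl

/-- The conditions for `s : B ⟶ E f` to be the structure map of an `𝖫`-coalgebra on
`f : A ⟶ B`. -/
structure IsCoalg (W : AWFS C) {A B : C} (f : A ⟶ B) (s : B ⟶ W.F.mid f) : Prop where
  hom_s : f ≫ s = W.F.left f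
  s_right : s ≫ W.F.right f = 𝟙 B
  s_c : s ≫ W.c f = s ≫ W.F.midMap (𝟙 A) s ((Category.id_comp _).trans hom_s.symm)

lemma isCoalg_cofree {A B : C} (f : A ⟶ B) : IsCoalg W (W.F.left f) (W.c f) :=
  ⟨W.left_c f, W.c_right f, W.c_c f⟩

/-- The canonical filler `E f ⟶ E g` of a square `(a, b) : f ⟶ g` against an algebra `g`, where
`s` is the structure map of a coalgebra on `f`. -/
def lift {A B : C} {f : A ⟶ B} (s : B ⟶ W.F.mid f) (g : RAlg.{v, u, w} W X Y)
    (a : A ⟶ X) (b : B ⟶ Y) (h : a ≫ g.hom = f ≫ b) : B ⟶ X :=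
  s ≫ W.F.midMap a b h ≫ g.str

section lift

variable {A B : C} {f : A ⟶ B} {s : B ⟶ W.F.mid f}

lemma lift_hom (hs : s ≫ W.F.right f = 𝟙 B) (g : RAlg.{v, u, w} W X Y)
    (a : A ⟶ X) (b : B ⟶ Y) (h : a ≫ g.hom = f ≫ b) : lift s g a b h ≫ g.hom = b := by
  rw [lift, Category.assoc, Category.assoc, g.str_hom, W.F.midMap_right, ← Category.assoc, hs,
    Category.id_comp]

lemma hom_lift (hs : f ≫ s = W.F.left f) (g : RAlg.{v, u, w} W X Y)
    (a : A ⟶ X) (b : B ⟶ Y) (h : a ≫ g.hom = f ≫ b) : f ≫ lift s g a b h = a := by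
  rw [lift, ← Category.assoc, hs, ← Category.assoc, W.F.left_midMap, Category.assoc, g.unit,
    Category.comp_id]

lemma lift_congr {g : RAlg.{v, u, w} W X Y} {a a' : A ⟶ X} {b b' : B ⟶ Y}
    {h : a ≫ g.hom = f ≫ b} {h' : a' ≫ g.hom = f ≫ b'} (ea : a = a') (eb : b = b') :
    lift s g a b h = lift s g a' b' h' := by
  subst ea; subst eb; rfl

/-- Reduction of the lifting against a cofree coalgebra followed by a coalgebra structure map. -/
lemma midMap_lift_c (hs : IsCoalg W f s) {k : X' ⟶ Y'} (a : A ⟶ X') (b : B ⟶ Y')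
    (h : a ≫ k = f ≫ b) (g : RAlg.{v, u, w} W X Y) (a' : X' ⟶ X) (b' : W.F.mid k ⟶ Y)
    (h' : a' ≫ g.hom = W.F.left k ≫ b') :
    s ≫ W.F.midMap a b h ≫ lift (W.c k) g a' b' h' =
      lift s g (a ≫ a') (s ≫ W.F.midMap a b h ≫ b') (by
        rw [Category.assoc, h', ← Category.assoc f, hs.hom_s, ← Category.assoc, ← Category.assoc,
          W.F.left_midMap]) := by
  have e1 : W.F.midMap a b h ≫ W.c k ≫ W.F.midMap a' b' h' ≫ g.str =
      W.c f ≫ W.F.midMap a (W.F.midMap a b h) (W.F.left_midMap a b h).symm ≫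
        W.F.midMap a' b' h' ≫ g.str := by
    rw [← Category.assoc, W.midMap_c, Category.assoc]
  rw [lift, e1, ← Category.assoc, hs.s_c, Category.assoc, W.F.midMap_comp_assoc,
    W.F.midMap_comp_assoc, lift]
  congr 2
  exact W.F.midMap_congr (by rw [Category.id_comp]) (Category.assoc _ _ _)

end lift

/-- The algebra structure on an identity arrow. -/
def id (W : AWFS C) (X : C) : RAlg.{v, u, w} W X X where
  hom := 𝟙 X
  str := W.F.right (𝟙 X)
  str_hom := Category.comp_id _
  unit := W.F.left_right _
  assoc := by rw [m_right, W.F.midMap_right, Category.comp_id]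

/-- The first step in composing the algebras `g` and `h`: the filler against `h`. -/
def compMid (g : RAlg.{v, u, w} W X Y) (h : RAlg.{v, u, w} W Y Z) :
    W.F.mid (g.hom ≫ h.hom) ⟶ Y :=
  lift (W.c (g.hom ≫ h.hom)) h g.hom (W.F.right (g.hom ≫ h.hom)) (W.F.left_right _).symm

lemma left_compMid (g : RAlg.{v, u, w} W X Y) (h : RAlg.{v, u, w} W Y Z) :
    W.F.left (g.hom ≫ h.hom) ≫ compMid g h = g.hom :=
  hom_lift (isCoalg_cofree _).hom_s h _ _ _

lemma compMid_hom (g : RAlg.{v, u, w} W X Y) (h : RAlg.{v, u, w} W Y Z) :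
    compMid g h ≫ h.hom = W.F.right (g.hom ≫ h.hom) :=
  lift_hom (isCoalg_cofree _).s_right h _ _ _

lemma compMid_eq (g : RAlg.{v, u, w} W X Y) (h : RAlg.{v, u, w} W Y Z) :
    compMid g h = W.F.midMap (f := g.hom ≫ h.hom) (g := h.hom)
      g.hom (𝟙 Z) (Category.comp_id _).symm ≫ h.str := by
  refine Eq.trans ?_ (Category.id_comp _)
  rw [← W.c_midMap, Category.assoc, W.F.midMap_comp_assoc, compMid, lift]
  congr 2
  exact W.F.midMap_congr (Category.id_comp _).symm (Category.comp_id _).symm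

/-- The structure map of the composite of the algebras `g` and `h`: in the square from `l (h g)`
to `h g`, fill first against `h` and then against `g`. -/
def compStr (g : RAlg.{v, u, w} W X Y) (h : RAlg.{v, u, w} W Y Z) :
    W.F.mid (g.hom ≫ h.hom) ⟶ X :=
  lift (W.c (g.hom ≫ h.hom)) g (𝟙 X) (compMid g h)
    ((Category.id_comp _).trans (left_compMid g h).symm)

lemma compStr_hom (g : RAlg.{v, u, w} W X Y) (h : RAlg.{v, u, w} W Y Z) :
    compStr g h ≫ g.hom = compMid g h :=
  lift_hom (isCoalg_cofree _).s_right g _ _ _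

/-- Composition of algebras. -/
def comp (g : RAlg.{v, u, w} W X Y) (h : RAlg.{v, u, w} W Y Z) : RAlg.{v, u, w} W X Z where
  hom := g.hom ≫ h.hom
  str := compStr g h
  str_hom := by rw [← Category.assoc, compStr_hom, compMid_hom]
  unit := hom_lift (isCoalg_cofree _).hom_s g _ _ _
  assoc := by
    have h0 : compStr g h ≫ g.hom ≫ h.hom = W.F.right (g.hom ≫ h.hom) ≫ 𝟙 Z := by
      rw [← Category.assoc, compStr_hom, compMid_hom, Category.comp_id]
    have h1 : W.m (g.hom ≫ h.hom) ≫ compMid g h =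
        W.F.midMap (compStr g h) (𝟙 Z) h0 ≫ compMid g h := by
      rw [compMid_eq, ← Category.assoc, ← W.midMap_m, Category.assoc, h.assoc,
        W.F.midMap_comp_assoc, W.F.midMap_comp_assoc]
      congr 1
      refine W.F.midMap_congr ?_ rfl
      rw [compStr_hom, compMid_eq]
    have h2 : W.F.midMap (compStr g h) (𝟙 Z) h0 ≫ compStr g h =
        W.c (W.F.right (g.hom ≫ h.hom)) ≫ W.F.midMap (compStr g h)
          (W.F.midMap (compStr g h) (𝟙 Z) h0 ≫ compMid g h) (by
            rw [← Category.assoc, W.F.left_midMap, Category.assoc, left_compMid]) ≫ g.str := by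
      have e : compStr g h = W.c (g.hom ≫ h.hom) ≫ W.F.midMap (𝟙 X) (compMid g h)
          ((Category.id_comp _).trans (left_compMid g h).symm) ≫ g.str := rfl
      refine (congrArg (fun t => W.F.midMap (compStr g h) (𝟙 Z) h0 ≫ t) e).trans ?_
      rw [← Category.assoc, W.midMap_c, Category.assoc, W.F.midMap_comp_assoc]
      congr 2
      exact W.F.midMap_congr (Category.comp_id _) rfl
    rw [h2]
    conv_lhs => rw [compStr, lift]
    rw [← Category.assoc, W.m_c, Category.assoc, Category.assoc, ← Category.assoc (W.m _),
      ← W.midMap_m, Category.assoc, g.assoc, W.F.midMap_comp_assoc, W.F.midMap_comp_assoc]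
    congr 2
    refine W.F.midMap_congr (Category.assoc _ _ _) ?_
    rw [Category.comp_id, h1]
section lift

variable {A B : C} {f : A ⟶ B} {s : B ⟶ W.F.mid f}

lemma midMap_lift {k : X' ⟶ Y'} (a : A ⟶ X') (b : B ⟶ Y')
    (h : a ≫ k = f ≫ b) (g : RAlg.{v, u, w} W X Y) (a' : X' ⟶ X) (b' : W.F.mid k ⟶ Y)
    (h' : a' ≫ g.hom = W.F.left k ≫ b') :
    W.F.midMap a b h ≫ lift (W.c k) g a' b' h' =
      lift (W.c f) g (a ≫ a') (W.F.midMap a b h ≫ b') (by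
        rw [Category.assoc, h', ← Category.assoc, ← Category.assoc, W.F.left_midMap]) := by
  rw [lift, ← Category.assoc, W.midMap_c, Category.assoc, W.F.midMap_comp_assoc, lift]

lemma lift_comp (hs : IsCoalg W f s) (g : RAlg.{v, u, w} W X Y) (h : RAlg.{v, u, w} W Y Z)
    (a : A ⟶ X) (b : B ⟶ Z) (e : a ≫ (comp g h).hom = f ≫ b) :
    lift s (comp g h) a b e = lift s g a
      (lift s h (a ≫ g.hom) b ((Category.assoc _ _ _).trans e))
        (hom_lift hs.hom_s h _ _ _).symm := by
  refine (midMap_lift_c hs a b e g _ _ _).trans ?_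
  refine lift_congr (Category.comp_id _) ?_
  refine (midMap_lift_c hs a b e h _ _ _).trans ?_
  refine lift_congr rfl ?_
  have e' : W.F.midMap a b e ≫ W.F.right (g.hom ≫ h.hom) = W.F.right f ≫ b :=
    W.F.midMap_right a b e
  rw [e', ← Category.assoc, hs.s_right, Category.id_comp]

lemma lift_id (hs : s ≫ W.F.right f = 𝟙 B) (a : A ⟶ X) (b : B ⟶ X)
    (e : a ≫ (id.{v, u, w} W X).hom = f ≫ b) : lift s (id.{v, u, w} W X) a b e = b := by
  have e' : W.F.midMap a b e ≫ W.F.right (𝟙 X) = W.F.right f ≫ b := W.F.midMap_right a b e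
  change s ≫ W.F.midMap a b e ≫ W.F.right (𝟙 X) = b
  rw [e', ← Category.assoc, hs, Category.id_comp]

end lift

/-- Algebras with the same underlying arrow and the same liftings are equal. -/
lemma ext_lift {g h : RAlg.{v, u, w} W X Y} (e : g.hom = h.hom)
    (e' : ∀ {A B : C} {f : A ⟶ B} {s : B ⟶ W.F.mid f}, IsCoalg W f s →
      ∀ (a : A ⟶ X) (b : B ⟶ Y) (q : a ≫ g.hom = f ≫ b) (q' : a ≫ h.hom = f ≫ b),
        lift s g a b q = lift s h a b q') : g = h := by
  refine ext' e ?_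
  have q : 𝟙 X ≫ g.hom = W.F.left g.hom ≫ W.F.right g.hom :=
    (Category.id_comp _).trans (W.F.left_right _).symm
  have k := e' (isCoalg_cofree g.hom) (𝟙 X) (W.F.right g.hom) q (e ▸ q)
  have k1 : lift (W.c g.hom) g (𝟙 X) (W.F.right g.hom) q = g.str := by
    rw [lift, ← Category.assoc, W.c_midMap, Category.id_comp]
  rw [← k1, k, lift]
  refine Eq.trans ?_ (Category.id_comp _)
  rw [← W.c_midMap, Category.assoc, W.F.midMap_comp_assoc]
  congr 2
  exact W.F.midMap_congr (Category.comp_id _).symm (Category.comp_id _).symm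

lemma id_comp (g : RAlg.{v, u, w} W X Y) : comp (id.{v, u, w} W X) g = g :=
  ext_lift (Category.id_comp _) fun hs a b q q' => by
    rw [lift_comp hs, lift_id hs.s_right]
    exact lift_congr (Category.comp_id _) rfl

lemma comp_id (g : RAlg.{v, u, w} W X Y) : comp g (id.{v, u, w} W Y) = g :=
  ext_lift (Category.comp_id _) fun hs a b q q' => by
    rw [lift_comp hs]
    exact lift_congr rfl (lift_id hs.s_right _ _ _)

lemma comp_assoc (g : RAlg.{v, u, w} W X Y) (h : RAlg.{v, u, w} W Y Z)
    (k : RAlg.{v, u, w} W Z T) : comp (comp g h) k = comp g (comp h k) :=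
  ext_lift (Category.assoc _ _ _) fun hs a b q q' => by
    rw [lift_comp hs, lift_comp hs, lift_comp hs]
    refine lift_congr rfl ?_
    rw [lift_comp hs]
    exact lift_congr rfl (lift_congr (Category.assoc _ _ _).symm rfl)

/-- Maps of algebras: commutative squares between the underlying arrows which commute with the
structure maps. -/
@[ext]
structure Sq (g : RAlg.{v, u, w} W X Y) (g' : RAlg.{v, u, w} W X' Y') : Type v where
  top : X ⟶ X'
  bot : Y ⟶ Y'
  comm : top ≫ g'.hom = g.hom ≫ bot
  str : g.str ≫ top = W.F.midMap top bot comm ≫ g'.str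

namespace Sq

variable {X'' Y'' Z' : C}

/-- The identity map of algebras. -/
def hid (g : RAlg.{v, u, w} W X Y) : Sq g g where
  top := 𝟙 X
  bot := 𝟙 Y
  comm := by simp
  str := by rw [W.F.midMap_id, Category.comp_id, Category.id_comp]

/-- Composition of maps of algebras. -/
def hcomp {g : RAlg.{v, u, w} W X Y} {g' : RAlg.{v, u, w} W X' Y'}
    {g'' : RAlg.{v, u, w} W X'' Y''} (α : Sq g g') (β : Sq g' g'') : Sq g g'' where
  top := α.top ≫ β.top
  bot := α.bot ≫ β.bot
  comm := by rw [Category.assoc, β.comm, ← Category.assoc, α.comm, Category.assoc]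
  str := by
    rw [← Category.assoc, α.str, Category.assoc, β.str, W.F.midMap_comp_assoc]

/-- The map of algebras between identity arrows given by an arrow. -/
def vid (f : X ⟶ X') : Sq (RAlg.id.{v, u, w} W X) (RAlg.id.{v, u, w} W X') where
  top := f
  bot := f
  comm := (Category.comp_id _).trans (Category.id_comp _).symm
  str := (W.F.midMap_right f f _).symm

lemma lift_top {g : RAlg.{v, u, w} W X Y} {g' : RAlg.{v, u, w} W X' Y'} (α : Sq g g')
    {A B : C} {f : A ⟶ B} (s : B ⟶ W.F.mid f) (a : A ⟶ X) (b : B ⟶ Y)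
    (h : a ≫ g.hom = f ≫ b) : lift s g a b h ≫ α.top = lift s g' (a ≫ α.top) (b ≫ α.bot)
      (by rw [Category.assoc, α.comm, ← Category.assoc, h, Category.assoc]) := by
  rw [lift, Category.assoc, Category.assoc, α.str, W.F.midMap_comp_assoc, lift]

/-- Vertical composition of maps of algebras. -/
def vcomp {g : RAlg.{v, u, w} W X Y} {h : RAlg.{v, u, w} W Y Z} {g' : RAlg.{v, u, w} W X' Y'}
    {h' : RAlg.{v, u, w} W Y' Z'} (α : Sq g g') (β : Sq h h') (e : α.bot = β.top) :
    Sq (RAlg.comp g h) (RAlg.comp g' h') where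
  top := α.top
  bot := β.bot
  comm := by
    change α.top ≫ g'.hom ≫ h'.hom = (g.hom ≫ h.hom) ≫ β.bot
    rw [← Category.assoc, α.comm, Category.assoc, e, β.comm, Category.assoc]
  str := by
    have q : α.top ≫ g'.hom ≫ h'.hom = (g.hom ≫ h.hom) ≫ β.bot := by
      rw [← Category.assoc, α.comm, Category.assoc, e, β.comm, Category.assoc]
    change compStr g h ≫ α.top = W.F.midMap α.top β.bot q ≫ compStr g' h'
    rw [compStr, lift_top, compStr, midMap_lift]
    refine lift_congr ((Category.id_comp _).trans (Category.comp_id _).symm) ?_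
    rw [compMid, e, lift_top, compMid, midMap_lift]
    refine lift_congr ?_ (W.F.midMap_right _ _ _).symm
    rw [α.comm, e]

lemma heq {g h : RAlg.{v, u, w} W X Y} {g' h' : RAlg.{v, u, w} W X' Y'} (e : g = h)
    (e' : g' = h') {α : Sq g g'} {β : Sq h h'} (ht : α.top = β.top) (hb : α.bot = β.bot) :
    α ≍ β := by
  subst e; subst e'; exact heq_of_eq (Sq.ext ht hb)

end Sq

end RAlg

/-- The double category of algebras of an algebraic weak factorisation system on `C`: objects and
horizontal arrows are those of `C`, vertical arrows are the algebras for the monad and squares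
are the maps of algebras. -/
def DAlg : DoubleCat.{v, u, max v w} where
  Obj := C
  Vert X Y := RAlg.{v, u, w} W X Y
  vid X := RAlg.id.{v, u, w} W X
  vcomp g h := g.comp h
  vid_vcomp g := g.id_comp
  vcomp_vid g := g.comp_id
  vassoc g h k := g.comp_assoc h k
  Sq g h := RAlg.Sq g h
  top α := α.top
  bot α := α.bot
  hid g := RAlg.Sq.hid g
  hcomp α β := α.hcomp β
  hid_hcomp _ := RAlg.Sq.ext (Category.id_comp _) (Category.id_comp _)
  hcomp_hid _ := RAlg.Sq.ext (Category.comp_id _) (Category.comp_id _)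
  hassoc _ _ _ := RAlg.Sq.ext (Category.assoc _ _ _) (Category.assoc _ _ _)
  top_hid _ := rfl
  bot_hid _ := rfl
  top_hcomp _ _ := rfl
  bot_hcomp _ _ := rfl
  vidSq f := RAlg.Sq.vid.{v, u, w} f
  top_vidSq _ := rfl
  bot_vidSq _ := rfl
  vidSq_id _ := rfl
  vidSq_comp _ _ := rfl
  vcompSq α β h := α.vcomp β h
  top_vcompSq _ _ _ := rfl
  bot_vcompSq _ _ _ := rfl
  vcompSq_hid _ _ := rfl
  interchange _ _ _ _ _ _ := rfl
  vidSq_vcompSq _ := RAlg.Sq.heq (RAlg.id_comp _) (RAlg.id_comp _) rfl rfl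
  vcompSq_vidSq _ := RAlg.Sq.heq (RAlg.comp_id _) (RAlg.comp_id _) rfl rfl
  vassocSq _ _ _ _ _ := RAlg.Sq.heq (RAlg.comp_assoc _ _ _) (RAlg.comp_assoc _ _ _) rfl rfl

/-- The forgetful double functor from the double category of algebras to the double category of
squares. -/
def forget : DoubleFunctor (DAlg.{v, u, w} W) (SqD.{v, u, w} C) where
  H := 𝟭 C
  V g := ⟨g.hom⟩
  S α := Arrow.homMk α.top α.bot α.comm
  V_vid _ := rfl
  V_vcomp _ _ := rfl
  top_S _ := rfl
  bot_S _ := rfl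
  S_hid _ := rfl
  S_hcomp _ _ := rfl
  S_vidSq _ := HEq.rfl
  S_vcompSq _ _ _ := HEq.rfl

end AWFS

/-! ### The 2-category of algebraic weak factorisation systems and lax morphisms -/

/-- A lax morphism of algebraic weak factorisation systems: a functor `F` with a natural family
`α f : E' (F f) ⟶ F (E f)`, compatible with both parts of the factorisations, such that
`(α, 1)` and `(1, α)` are compatible with multiplications and comultiplications, and so are a
lax monad morphism and a lax comonad morphism. -/
structure LaxMor {C D : Type u} [Category.{v} C] [Category.{v} D] (W : AWFS C) (W' : AWFS D) where
  functor : C ⥤ D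
  α {X Y : C} (f : X ⟶ Y) : W'.F.mid (functor.map f) ⟶ functor.obj (W.F.mid f)
  α_naturality {X Y X' Y' : C} {f : X ⟶ Y} {g : X' ⟶ Y'} (a : X ⟶ X') (b : Y ⟶ Y')
    (h : a ≫ g = f ≫ b) :
    W'.F.midMap (functor.map a) (functor.map b)
        (by rw [← functor.map_comp, h, functor.map_comp]) ≫ α g =
      α f ≫ functor.map (W.F.midMap a b h)
  left_α {X Y : C} (f : X ⟶ Y) : W'.F.left (functor.map f) ≫ α f = functor.map (W.F.left f)
  α_right {X Y : C} (f : X ⟶ Y) : α f ≫ functor.map (W.F.right f) = W'.F.right (functor.map f)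
  m_α {X Y : C} (f : X ⟶ Y) : W'.m (functor.map f) ≫ α f =
    W'.F.midMap (α f) (𝟙 (functor.obj Y)) ((α_right f).trans (Category.comp_id _).symm) ≫
      α (W.F.right f) ≫ functor.map (W.m f)
  α_c {X Y : C} (f : X ⟶ Y) : α f ≫ functor.map (W.c f) =
    W'.c (functor.map f) ≫
      W'.F.midMap (𝟙 (functor.obj X)) (α f) ((Category.id_comp _).trans (left_α f).symm) ≫
        α (W.F.left f)

namespace LaxMor

variable {C D C' C'' : Type u} [Category.{v} C] [Category.{v} D] [Category.{v} C']
  [Category.{v} C''] {W : AWFS C} {W' : AWFS D} {W'' : AWFS C'} {W₃ : AWFS C''}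

lemma ext' {F G : LaxMor W W'} (h : F.functor = G.functor)
    (h' : ∀ {X Y : C} (f : X ⟶ Y), F.α f ≍ G.α f) : F = G := by
  cases F with | mk F a _ _ _ _ _ => cases G with | mk G b _ _ _ _ _ =>
  dsimp at h; subst h
  have : @a = @b := by
    funext X Y f; exact eq_of_heq (h' f)
  subst this; rfl

/-- The identity lax morphism. -/
def id (W : AWFS C) : LaxMor W W where
  functor := 𝟭 C
  α f := 𝟙 (W.F.mid f)
  α_naturality _ _ _ := (Category.comp_id _).trans (Category.id_comp _).symm
  left_α _ := Category.comp_id _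
  α_right _ := Category.id_comp _
  m_α f := by
    refine (Category.comp_id _).trans ?_
    refine Eq.trans ?_ (congrArg (· ≫ 𝟙 _ ≫ W.m f) (W.F.midMap_id (W.F.right f))).symm
    exact ((Category.id_comp _).trans (Category.id_comp _)).symm
  α_c f := by
    refine (Category.id_comp _).trans ?_
    refine Eq.trans ?_ (congrArg (fun t => W.c f ≫ t ≫ 𝟙 _) (W.F.midMap_id (W.F.left f))).symm
    rw [Category.comp_id]
    exact (Category.comp_id _).symm

lemma comp_m (F : LaxMor W W') (G : LaxMor W' W'') {X Y : C} (f : X ⟶ Y)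
    (q : (G.α (F.functor.map f) ≫ G.functor.map (F.α f)) ≫
      G.functor.map (F.functor.map (W.F.right f)) =
        W''.F.right (G.functor.map (F.functor.map f)) ≫ 𝟙 _) :
    W''.m (G.functor.map (F.functor.map f)) ≫ G.α (F.functor.map f) ≫ G.functor.map (F.α f) =
      W''.F.midMap (G.α (F.functor.map f) ≫ G.functor.map (F.α f))
        (𝟙 (G.functor.obj (F.functor.obj Y))) q ≫
        (G.α (F.functor.map (W.F.right f)) ≫ G.functor.map (F.α (W.F.right f))) ≫
          G.functor.map (F.functor.map (W.m f)) := by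
  have h := G.α_naturality (F.α f) (𝟙 (F.functor.obj Y))
    ((F.α_right f).trans (Category.comp_id _).symm)
  have e : G.functor.map (F.α (W.F.right f) ≫ F.functor.map (W.m f)) =
    G.functor.map (F.α (W.F.right f)) ≫ G.functor.map (F.functor.map (W.m f)) :=
      G.functor.map_comp _ _
  rw [← Category.assoc, G.m_α, Category.assoc, Category.assoc, ← G.functor.map_comp, F.m_α,
    G.functor.map_comp, ← Category.assoc (G.α _), ← h, Category.assoc, W''.F.midMap_comp_assoc,
    e, Category.assoc (G.α (F.functor.map (W.F.right f)))]
  congr 1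
  exact W''.F.midMap_congr rfl (by rw [G.functor.map_id, Category.comp_id])

lemma comp_c (F : LaxMor W W') (G : LaxMor W' W'') {X Y : C} (f : X ⟶ Y)
    (q : 𝟙 _ ≫ G.functor.map (F.functor.map (W.F.left f)) =
      W''.F.left (G.functor.map (F.functor.map f)) ≫
        G.α (F.functor.map f) ≫ G.functor.map (F.α f)) :
    (G.α (F.functor.map f) ≫ G.functor.map (F.α f)) ≫ G.functor.map (F.functor.map (W.c f)) =
      W''.c (G.functor.map (F.functor.map f)) ≫
        W''.F.midMap (𝟙 (G.functor.obj (F.functor.obj X)))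
          (G.α (F.functor.map f) ≫ G.functor.map (F.α f)) q ≫
          G.α (F.functor.map (W.F.left f)) ≫ G.functor.map (F.α (W.F.left f)) := by
  have h := G.α_naturality (𝟙 (F.functor.obj X)) (F.α f)
    ((Category.id_comp _).trans (F.left_α f).symm)
  rw [Category.assoc, ← G.functor.map_comp, F.α_c, G.functor.map_comp, ← Category.assoc, G.α_c,
    G.functor.map_comp, Category.assoc, Category.assoc, ← Category.assoc (G.α _), ← h,
    Category.assoc, W''.F.midMap_comp_assoc]
  congr 2
  exact W''.F.midMap_congr (by rw [G.functor.map_id, Category.comp_id]) rfl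

/-- Composition of lax morphisms. -/
def comp (F : LaxMor W W') (G : LaxMor W' W'') : LaxMor W W'' where
  functor := F.functor ⋙ G.functor
  α f := G.α (F.functor.map f) ≫ G.functor.map (F.α f)
  α_naturality a b h := by
    refine (Category.assoc _ _ _).symm.trans ?_
    refine (congrArg (· ≫ _) (G.α_naturality _ _
      (by rw [← F.functor.map_comp, h, F.functor.map_comp]))).trans ?_
    rw [Category.assoc, ← G.functor.map_comp, F.α_naturality _ _ h, G.functor.map_comp,
      ← Category.assoc]
    rfl
  left_α f := by
    refine (Category.assoc _ _ _).symm.trans ?_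
    refine (congrArg (· ≫ _) (G.left_α (F.functor.map f))).trans ?_
    rw [← G.functor.map_comp, F.left_α]; rfl
  α_right f := by
    refine (Category.assoc _ _ _).trans ?_
    refine (congrArg (_ ≫ ·) ((G.functor.map_comp _ _).symm.trans
      (congrArg G.functor.map (F.α_right f)))).trans ?_
    exact G.α_right _
  m_α f := comp_m F G f _
  α_c f := comp_c F G f _

end LaxMor

/-- A transformation between lax morphisms of algebraic weak factorisation systems: a natural
transformation compatible with the structure maps `α`. -/
@[ext]
structure LaxTrans {C D : Type u} [Category.{v} C] [Category.{v} D] {W : AWFS C} {W' : AWFS D}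
    (F G : LaxMor W W') where
  τ : F.functor ⟶ G.functor
  comm {X Y : C} (f : X ⟶ Y) : F.α f ≫ τ.app (W.F.mid f) =
    W'.F.midMap (τ.app X) (τ.app Y) (τ.naturality f).symm ≫ G.α f

/-- Objects of the 2-category `AWFS_lax`: categories with an algebraic weak factorisation
system. -/
structure AWFSLax where
  carrier : Type u
  [cat : Category.{v} carrier]
  awfs : AWFS carrier

attribute [instance] AWFSLax.cat

namespace AWFSLax

instance categoryStruct : CategoryStruct AWFSLax.{v, u} where
  Hom W W' := LaxMor W.awfs W'.awfs
  id W := LaxMor.id W.awfs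
  comp F G := F.comp G

instance homCategory (W W' : AWFSLax.{v, u}) : Category (W ⟶ W') where
  Hom F G := LaxTrans F G
  id F := ⟨𝟙 F.functor, fun f => by
    refine (Category.comp_id _).trans ?_
    refine Eq.trans ?_ (congrArg (· ≫ F.α f) (W'.awfs.F.midMap_id (F.functor.map f))).symm
    exact (Category.id_comp _).symm⟩
  comp {F G K} σ τ := ⟨σ.τ ≫ τ.τ, fun f => by
    refine (Category.assoc _ _ _).symm.trans ?_
    rw [σ.comm, Category.assoc, τ.comm, W'.awfs.F.midMap_comp_assoc]; rfl⟩
  id_comp σ := LaxTrans.ext (Category.id_comp σ.τ)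
  comp_id σ := LaxTrans.ext (Category.comp_id σ.τ)
  assoc σ τ ρ := LaxTrans.ext (Category.assoc σ.τ τ.τ ρ.τ)

section
variable {W W' : AWFSLax.{v, u}}

lemma hom₂_ext {F G : W ⟶ W'} {σ τ : F ⟶ G} (h : ∀ X, σ.τ.app X = τ.τ.app X) : σ = τ :=
  LaxTrans.ext (NatTrans.ext (funext h))

lemma eqToHom_τ {F G : W ⟶ W'} (h : F = G) :
    (eqToHom h).τ = eqToHom (congrArg LaxMor.functor h) := by subst h; rfl

lemma comp_id' (F : W ⟶ W') : F ≫ 𝟙 W' = F :=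
  LaxMor.ext' rfl fun _ => heq_of_eq (Category.id_comp _)

lemma id_comp' (F : W ⟶ W') : 𝟙 W ≫ F = F :=
  LaxMor.ext' rfl fun f => heq_of_eq
    ((congrArg (F.α f ≫ ·) (F.functor.map_id _)).trans (Category.comp_id _))

lemma assoc' {W'' W₃ : AWFSLax.{v, u}} (F : W ⟶ W') (G : W' ⟶ W'') (H : W'' ⟶ W₃) :
    (F ≫ G) ≫ H = F ≫ G ≫ H :=
  LaxMor.ext' rfl fun _ => heq_of_eq
    ((congrArg (H.α _ ≫ ·) (H.functor.map_comp _ _)).trans (Category.assoc _ _ _).symm)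

lemma id_comm {C : Type u} [Category.{v} C] (W : AWFS C) {X Y Z : C} {f : X ⟶ Y}
    {t t' : W.F.mid f ⟶ Z} (h : t = t') (q : 𝟙 X ≫ f = f ≫ 𝟙 Y) :
    t ≫ 𝟙 Z = W.F.midMap (𝟙 X) (𝟙 Y) q ≫ t' := by
  rw [W.F.midMap_id, h, Category.comp_id, Category.id_comp]

/-- Left unitors have identity components. -/
def leftUnitor' (F : W ⟶ W') : 𝟙 W ≫ F ≅ F where
  hom := LaxTrans.mk (𝟙 F.functor) fun f => id_comm W'.awfs
    ((congrArg (F.α f ≫ ·) (F.functor.map_id _)).trans (Category.comp_id _)) _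
  inv := LaxTrans.mk (𝟙 F.functor) fun f => id_comm W'.awfs
    ((congrArg (F.α f ≫ ·) (F.functor.map_id _)).trans (Category.comp_id _)).symm _
  hom_inv_id := hom₂_ext fun _ => Category.id_comp _
  inv_hom_id := hom₂_ext fun _ => Category.id_comp _

/-- Right unitors have identity components. -/
def rightUnitor' (F : W ⟶ W') : F ≫ 𝟙 W' ≅ F where
  hom := LaxTrans.mk (𝟙 F.functor) fun _ => id_comm W'.awfs (Category.id_comp _) _
  inv := LaxTrans.mk (𝟙 F.functor) fun _ => id_comm W'.awfs (Category.id_comp _).symm _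
  hom_inv_id := hom₂_ext fun _ => Category.id_comp _
  inv_hom_id := hom₂_ext fun _ => Category.id_comp _

/-- Associators have identity components. -/
def associator' {W'' W₃ : AWFSLax.{v, u}} (F : W ⟶ W') (G : W' ⟶ W'') (H : W'' ⟶ W₃) :
    (F ≫ G) ≫ H ≅ F ≫ G ≫ H where
  hom := LaxTrans.mk (𝟙 (F.functor ⋙ G.functor ⋙ H.functor)) fun _ => id_comm W₃.awfs
    ((congrArg (H.α _ ≫ ·) (H.functor.map_comp _ _)).trans (Category.assoc _ _ _).symm) _
  inv := LaxTrans.mk (𝟙 (F.functor ⋙ G.functor ⋙ H.functor)) fun _ => id_comm W₃.awfs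
    ((congrArg (H.α _ ≫ ·) (H.functor.map_comp _ _)).trans (Category.assoc _ _ _).symm).symm _
  hom_inv_id := hom₂_ext fun _ => Category.id_comp _
  inv_hom_id := hom₂_ext fun _ => Category.id_comp _

end

instance bicategory : Bicategory AWFSLax.{v, u} where
  toCategoryStruct := categoryStruct
  homCategory := homCategory
  whiskerLeft {_ _ W''} F G K τ := LaxTrans.mk (Functor.whiskerLeft F.functor τ.τ) (by
    intro X Y f
    change (G.α _ ≫ G.functor.map (F.α f)) ≫ τ.τ.app (F.functor.obj _) =
      W''.awfs.F.midMap (τ.τ.app (F.functor.obj X)) (τ.τ.app (F.functor.obj Y)) _ ≫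
        K.α _ ≫ K.functor.map (F.α f)
    rw [Category.assoc, τ.τ.naturality, ← Category.assoc, τ.comm, Category.assoc])
  whiskerRight {_ _ W''} {F G} τ K := LaxTrans.mk (Functor.whiskerRight τ.τ K.functor) (by
    intro X Y f
    change (K.α _ ≫ K.functor.map (F.α f)) ≫ K.functor.map (τ.τ.app _) =
      W''.awfs.F.midMap (K.functor.map (τ.τ.app X)) (K.functor.map (τ.τ.app Y)) _ ≫
        K.α _ ≫ K.functor.map (G.α f)
    rw [Category.assoc, ← K.functor.map_comp, τ.comm, K.functor.map_comp, ← Category.assoc,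
      ← K.α_naturality, Category.assoc])
  associator F G H := associator' F G H
  leftUnitor F := leftUnitor' F
  rightUnitor F := rightUnitor' F
  whiskerLeft_id _ _ := rfl
  whiskerLeft_comp _ _ _ _ _ _ := rfl
  id_whiskerLeft _ := hom₂_ext fun _ => ((Category.id_comp _).trans (Category.comp_id _)).symm
  comp_whiskerLeft _ _ _ _ _ :=
    hom₂_ext fun _ => ((Category.id_comp _).trans (Category.comp_id _)).symm
  id_whiskerRight _ K := hom₂_ext fun _ => K.functor.map_id _
  comp_whiskerRight _ _ K := hom₂_ext fun _ => K.functor.map_comp _ _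
  whiskerRight_id _ := hom₂_ext fun _ => ((Category.id_comp _).trans (Category.comp_id _)).symm
  whiskerRight_comp _ _ _ :=
    hom₂_ext fun _ => ((Category.id_comp _).trans (Category.comp_id _)).symm
  whisker_assoc _ _ _ _ _ :=
    hom₂_ext fun _ => ((Category.id_comp _).trans (Category.comp_id _)).symm
  whisker_exchange σ τ := hom₂_ext fun _ => (τ.τ.naturality (σ.τ.app _)).symm
  pentagon _ _ _ K := hom₂_ext fun _ => by
    change K.functor.map (𝟙 _) ≫ 𝟙 _ ≫ 𝟙 _ = 𝟙 _ ≫ 𝟙 _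
    rw [K.functor.map_id]; simp
  triangle _ K := hom₂_ext fun _ => by
    change 𝟙 _ ≫ 𝟙 _ = K.functor.map (𝟙 _)
    rw [K.functor.map_id]; simp

instance strict : Bicategory.Strict AWFSLax.{v, u} where
  id_comp F := id_comp' F
  comp_id F := comp_id' F
  assoc F G H := assoc' F G H
  leftUnitor_eqToIso F := Iso.ext (LaxTrans.ext (eqToHom_τ (id_comp' F)).symm)
  rightUnitor_eqToIso F := Iso.ext (LaxTrans.ext (eqToHom_τ (comp_id' F)).symm)
  associator_eqToIso F G H := Iso.ext (LaxTrans.ext (eqToHom_τ (assoc' F G H)).symm)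

end AWFSLax
/-! ### The semantics 2-functor -/

namespace LaxMor

open AWFS

variable {C D : Type u} [Category.{v} C] [Category.{v} D] {W : AWFS C} {W' : AWFS D}

/-- The action of a lax morphism on algebras. -/
def mapAlg (F : LaxMor W W') {X Y : C} (g : RAlg.{v, u, w} W X Y) :
    RAlg.{v, u, w} W' (F.functor.obj X) (F.functor.obj Y) where
  hom := F.functor.map g.hom
  str := F.α g.hom ≫ F.functor.map g.str
  str_hom := by rw [Category.assoc, ← F.functor.map_comp, g.str_hom, F.α_right]
  unit := by rw [← Category.assoc, F.left_α, ← F.functor.map_comp, g.unit, F.functor.map_id]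
  assoc := by
    have h := F.α_naturality g.str (𝟙 Y) (g.str_hom.trans (Category.comp_id _).symm)
    rw [← Category.assoc, F.m_α, Category.assoc, Category.assoc, ← F.functor.map_comp, g.assoc,
      F.functor.map_comp, ← Category.assoc (F.α _), ← h, Category.assoc, W'.F.midMap_comp_assoc]
    congr 1
    exact W'.F.midMap_congr rfl (by rw [F.functor.map_id, Category.comp_id])

/-- The action of a lax morphism on maps of algebras. -/
def mapSq (F : LaxMor W W') {X Y X' Y' : C} {g : RAlg.{v, u, w} W X Y}
    {g' : RAlg.{v, u, w} W X' Y'} (β : RAlg.Sq g g') : RAlg.Sq (F.mapAlg g) (F.mapAlg g') where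
  top := F.functor.map β.top
  bot := F.functor.map β.bot
  comm := by
    change _ ≫ F.functor.map g'.hom = F.functor.map g.hom ≫ _
    rw [← F.functor.map_comp, β.comm, F.functor.map_comp]
  str := by
    change (F.α _ ≫ F.functor.map g.str) ≫ _ =
      W'.F.midMap (f := F.functor.map g.hom) (g := F.functor.map g'.hom) (F.functor.map β.top)
        (F.functor.map β.bot) _ ≫ F.α _ ≫ F.functor.map g'.str
    rw [Category.assoc, ← F.functor.map_comp, β.str, F.functor.map_comp, ← Category.assoc,
      ← F.α_naturality, Category.assoc]

lemma α_lift (F : LaxMor W W') {A B X Y : C} (f : A ⟶ B) (g : RAlg.{v, u, w} W X Y)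
    (a : A ⟶ X) (b : W.F.mid f ⟶ Y) (h : a ≫ g.hom = W.F.left f ≫ b) :
    F.α f ≫ F.functor.map (RAlg.lift (W.c f) g a b h) =
      RAlg.lift (W'.c (F.functor.map f)) (F.mapAlg g) (F.functor.map a) (F.α f ≫ F.functor.map b)
        (by
          change F.functor.map a ≫ F.functor.map g.hom = _
          rw [← F.functor.map_comp, h, F.functor.map_comp, ← Category.assoc, F.left_α]) := by
  have k := F.α_naturality a b h
  have q : F.functor.map a ≫ F.functor.map g.hom =
      W'.F.left (F.functor.map f) ≫ F.α f ≫ F.functor.map b := by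
    rw [← F.functor.map_comp, h, F.functor.map_comp, ← Category.assoc, F.left_α]
  change _ = W'.c (F.functor.map f) ≫ W'.F.midMap (g := F.functor.map g.hom) (F.functor.map a)
    (F.α f ≫ F.functor.map b) q ≫ F.α g.hom ≫ F.functor.map g.str
  rw [RAlg.lift, F.functor.map_comp, F.functor.map_comp, ← Category.assoc, F.α_c, Category.assoc,
    Category.assoc, ← Category.assoc (F.α _), ← k, Category.assoc, W'.F.midMap_comp_assoc]
  congr 2
  exact W'.F.midMap_congr (Category.id_comp _) rfl

lemma mapAlg_id (F : LaxMor W W') (X : C) :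
    F.mapAlg (RAlg.id.{v, u, w} W X) = RAlg.id.{v, u, w} W' (F.functor.obj X) := by
  refine RAlg.ext' (F.functor.map_id X) ?_
  refine (F.α_right (𝟙 X)).trans ?_
  refine Eq.trans ?_ (W'.F.midMap_right (𝟙 _) (𝟙 _) _).symm
  exact (Category.comp_id _).symm

lemma mapAlg_comp (F : LaxMor W W') {X Y Z : C} (g : RAlg.{v, u, w} W X Y)
    (h : RAlg.{v, u, w} W Y Z) : F.mapAlg (g.comp h) = (F.mapAlg g).comp (F.mapAlg h) := by
  refine RAlg.ext' (F.functor.map_comp g.hom h.hom) ?_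
  change F.α (g.hom ≫ h.hom) ≫ F.functor.map (RAlg.compStr g h) = _ ≫ RAlg.compStr _ _
  rw [RAlg.compStr, α_lift]
  refine Eq.trans ?_ (RAlg.midMap_lift _ _ _ _ _ _ _).symm
  refine RAlg.lift_congr ((F.functor.map_id X).trans (Category.comp_id _).symm) ?_
  rw [RAlg.compMid, α_lift]
  refine Eq.trans ?_ (RAlg.midMap_lift _ _ _ _ _ _ _).symm
  refine RAlg.lift_congr (Category.id_comp _).symm ?_
  rw [F.α_right]
  refine Eq.trans ?_ (W'.F.midMap_right (𝟙 _) (𝟙 _) _).symm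
  exact (Category.comp_id _).symm

/-- The double functor between double categories of algebras induced by a lax morphism. -/
def dAlg (F : LaxMor W W') : DoubleFunctor (DAlg.{v, u, w} W) (DAlg.{v, u, w} W') where
  H := F.functor
  V g := F.mapAlg g
  S β := F.mapSq β
  V_vid X := F.mapAlg_id X
  V_vcomp g h := F.mapAlg_comp g h
  top_S _ := rfl
  bot_S _ := rfl
  S_hid _ := RAlg.Sq.ext (F.functor.map_id _) (F.functor.map_id _)
  S_hcomp _ _ := RAlg.Sq.ext (F.functor.map_comp _ _) (F.functor.map_comp _ _)
  S_vidSq _ := RAlg.Sq.heq (F.mapAlg_id _) (F.mapAlg_id _) rfl rfl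
  S_vcompSq _ _ _ := RAlg.Sq.heq (F.mapAlg_comp _ _) (F.mapAlg_comp _ _) rfl rfl

end LaxMor

namespace LaxTrans

open AWFS

variable {C D : Type u} [Category.{v} C] [Category.{v} D] {W : AWFS C} {W' : AWFS D}

/-- The map of algebras given by the components of a transformation of lax morphisms. -/
def algSq {F G : LaxMor W W'} (σ : LaxTrans F G) {X Y : C} (g : RAlg.{v, u, w} W X Y) :
    RAlg.Sq (F.mapAlg g) (G.mapAlg g) where
  top := σ.τ.app X
  bot := σ.τ.app Y
  comm := (σ.τ.naturality g.hom).symm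
  str := by
    change (F.α g.hom ≫ F.functor.map g.str) ≫ σ.τ.app X =
      W'.F.midMap (f := F.functor.map g.hom) (g := G.functor.map g.hom)
        (σ.τ.app X) (σ.τ.app Y) (σ.τ.naturality g.hom).symm ≫ G.α g.hom ≫ G.functor.map g.str
    rw [Category.assoc, σ.τ.naturality, ← Category.assoc, σ.comm, Category.assoc]

/-- The horizontal transformation induced by a transformation of lax morphisms. -/
def dAlg {F G : LaxMor W W'} (σ : LaxTrans F G) :
    HorTrans (LaxMor.dAlg.{v, u, w} F) (LaxMor.dAlg.{v, u, w} G) where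
  app := σ.τ
  sq g := σ.algSq g
  top_sq _ := rfl
  bot_sq _ := rfl
  naturality β := RAlg.Sq.ext (σ.τ.naturality β.top) (σ.τ.naturality β.bot)
  sq_vid X := RAlg.Sq.heq (F.mapAlg_id X) (G.mapAlg_id X) rfl rfl
  sq_vcomp _ _ := RAlg.Sq.heq (F.mapAlg_comp _ _) (G.mapAlg_comp _ _) rfl rfl

end LaxTrans

lemma DoubleFunctor.ext' {A B : DoubleCat.{v, u, w}} {F G : DoubleFunctor A B} (hH : F.H = G.H)
    (hV : ∀ {X Y : A.Obj} (a : A.Vert X Y), F.V a ≍ G.V a)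
    (hS : ∀ {X Y X' Y' : A.Obj} {a : A.Vert X Y} {a' : A.Vert X' Y'} (α : A.Sq a a'),
      F.S α ≍ G.S α) : F = G := by
  cases F with | mk H V S _ _ _ _ _ _ _ _ => cases G with | mk H' V' S' _ _ _ _ _ _ _ _ =>
  dsimp at hH; subst hH
  have e : @V = @V' := by
    funext X Y a; exact eq_of_heq (hV a)
  subst e
  have e' : @S = @S' := by
    funext X Y X' Y' a a' α; exact eq_of_heq (hS α)
  subst e'; rfl

namespace DoubleCat

/-- Two-cells whose components are determined by those at objects. -/
lemma hom₂_ext_of_flat {A B : DoubleCat.{v, u, w}}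
    (hB : ∀ {X Y X' Y' : B.Obj} {a : B.Vert X Y} {a' : B.Vert X' Y'} (α β : B.Sq a a'),
      B.top α = B.top β → B.bot α = B.bot β → α = β)
    {F G : A ⟶ B} {σ τ : F ⟶ G} (h : ∀ X, σ.app.app X = τ.app.app X) : σ = τ :=
  hom₂_ext h fun {X Y} a => hB _ _
    ((σ.top_sq a).trans ((h X).trans (τ.top_sq a).symm))
    ((σ.bot_sq a).trans ((h Y).trans (τ.bot_sq a).symm))

lemma eqToHom_app {A B : DoubleCat.{v, u, w}} {F G : A ⟶ B} (h : F = G) :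
    (eqToHom h).app = eqToHom (congrArg DoubleFunctor.H h) := by subst h; rfl

lemma flat_dAlg {C : Type u} [Category.{v} C] (W : AWFS C) {X Y X' Y' : C}
    {a : (AWFS.DAlg.{v, u, w} W).Vert X Y} {a' : (AWFS.DAlg.{v, u, w} W).Vert X' Y'}
    (α β : (AWFS.DAlg.{v, u, w} W).Sq a a')
    (h : (AWFS.DAlg.{v, u, w} W).top α = (AWFS.DAlg.{v, u, w} W).top β)
    (h' : (AWFS.DAlg.{v, u, w} W).bot α = (AWFS.DAlg.{v, u, w} W).bot β) : α = β :=
  AWFS.RAlg.Sq.ext h h'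

lemma flat_sqD (C : Type u) [Category.{v} C] {X Y X' Y' : C}
    {a : (SqD.{v, u, w} C).Vert X Y} {a' : (SqD.{v, u, w} C).Vert X' Y'}
    (α β : (SqD.{v, u, w} C).Sq a a') (h : (SqD.{v, u, w} C).top α = (SqD.{v, u, w} C).top β)
    (h' : (SqD.{v, u, w} C).bot α = (SqD.{v, u, w} C).bot β) : α = β :=
  Arrow.hom_ext _ _ h h'

end DoubleCat

/-- The double functor `DAlg W ⟶ Sq C` as an object of the arrow 2-category. -/
def semObj (W : AWFSLax.{v, u}) : ArrowTwo DoubleCat.{v, u, max v w} where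
  src := AWFS.DAlg.{v, u, w} W.awfs
  tgt := SqD.{v, u, w} W.carrier
  arr := AWFS.forget.{v, u, w} W.awfs

/-- The action of the semantics 2-functor on lax morphisms. -/
def semMap {W W' : AWFSLax.{v, u}} (F : W ⟶ W') : semObj.{v, u, w} W ⟶ semObj.{v, u, w} W' where
  top := LaxMor.dAlg.{v, u, w} F
  bot := sqMap.{v, u, w} F.functor
  comm := rfl

/-- The action of the semantics 2-functor on transformations. -/
def semMap₂ {W W' : AWFSLax.{v, u}} {F G : W ⟶ W'} (σ : F ⟶ G) :
    semMap.{v, u, w} F ⟶ semMap.{v, u, w} G where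
  top := LaxTrans.dAlg.{v, u, w} σ
  bot := sqMap₂.{v, u, w} σ.τ
  comm := by
    refine DoubleCat.hom₂_ext_of_flat (DoubleCat.flat_sqD _) fun X => ?_
    exact (Category.comp_id (σ.τ.app X)).trans (Category.id_comp (σ.τ.app X)).symm

lemma semMap_id (W : AWFSLax.{v, u}) : semMap.{v, u, w} (𝟙 W) = 𝟙 (semObj.{v, u, w} W) := by
  have h : ∀ {X Y : W.carrier} (g : AWFS.RAlg.{v, u, w} W.awfs X Y),
      LaxMor.mapAlg (LaxMor.id W.awfs) g = g := fun g =>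
    AWFS.RAlg.ext' rfl (congrArg (· ≫ g.str) (W.awfs.F.midMap_id g.hom).symm)
  refine ArrowTwo.Hom.ext ?_ ?_
  · exact DoubleFunctor.ext' rfl (fun g => heq_of_eq (h g))
      (fun β => AWFS.RAlg.Sq.heq (h _) (h _) rfl rfl)
  · exact DoubleFunctor.ext' rfl (fun _ => HEq.rfl) (fun _ => HEq.rfl)

lemma semMap_comp {W W' W'' : AWFSLax.{v, u}} (F : W ⟶ W') (G : W' ⟶ W'') :
    semMap.{v, u, w} (F ≫ G) = semMap.{v, u, w} F ≫ semMap.{v, u, w} G := by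
  have h : ∀ {X Y : W.carrier} (g : AWFS.RAlg.{v, u, w} W.awfs X Y),
      LaxMor.mapAlg (LaxMor.comp F G) g = LaxMor.mapAlg G (LaxMor.mapAlg F g) := by
    intro X Y g
    refine AWFS.RAlg.ext' rfl ?_
    refine Eq.trans ?_ (congrArg (· ≫ (LaxMor.mapAlg G (LaxMor.mapAlg F g)).str)
      (W''.awfs.F.midMap_id _).symm)
    refine Eq.trans ?_ (Category.id_comp _).symm
    change (G.α _ ≫ G.functor.map (F.α g.hom)) ≫ G.functor.map (F.functor.map g.str) =
      G.α _ ≫ G.functor.map (F.α g.hom ≫ F.functor.map g.str)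
    rw [G.functor.map_comp, Category.assoc]
  refine ArrowTwo.Hom.ext ?_ ?_
  · exact DoubleFunctor.ext' rfl (fun g => heq_of_eq (h g))
      (fun β => AWFS.RAlg.Sq.heq (h _) (h _) rfl rfl)
  · exact DoubleFunctor.ext' rfl (fun _ => HEq.rfl) (fun _ => HEq.rfl)

lemma sem_ext {W W' : AWFSLax.{v, u}} {F G : semObj.{v, u, w} W ⟶ semObj.{v, u, w} W'}
    {σ τ : F ⟶ G} (h : ∀ X, σ.top.app.app X = τ.top.app.app X)
    (h' : ∀ X, σ.bot.app.app X = τ.bot.app.app X) : σ = τ :=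
  ArrowTwo.hom₂_ext (DoubleCat.hom₂_ext_of_flat (DoubleCat.flat_dAlg W'.awfs) h)
    (DoubleCat.hom₂_ext_of_flat (DoubleCat.flat_sqD W'.carrier) h')

lemma eqToHom_top_app {X Y : ArrowTwo DoubleCat.{v, u, w}} {F G : X ⟶ Y} (h : F = G) :
    (eqToHom h).top.app = eqToHom (congrArg (fun K => K.top.H) h) := by subst h; rfl

lemma eqToHom_bot_app {X Y : ArrowTwo DoubleCat.{v, u, w}} {F G : X ⟶ Y} (h : F = G) :
    (eqToHom h).bot.app = eqToHom (congrArg (fun K => K.bot.H) h) := by subst h; rfl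

/-- The semantics 2-functor from `AWFS_lax` to the arrow 2-category of `DBL`, sending an
algebraic weak factorisation system on `C` to the forgetful double functor from its double
category of algebras to the double category of squares in `C`. -/
def semantics : StrictPseudofunctor AWFSLax.{v, u} (ArrowTwo DoubleCat.{v, u, max v w}) :=
  StrictPseudofunctor.mk''
    { obj := fun W => semObj.{v, u, w} W
      map := fun F => semMap.{v, u, w} F
      map₂ := fun σ => semMap₂.{v, u, w} σ
      map₂_id := fun _ => sem_ext (fun _ => rfl) (fun _ => rfl)
      map₂_comp := fun _ _ => sem_ext (fun _ => rfl) (fun _ => rfl)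
      map_id := fun W => semMap_id.{v, u, w} W
      map_comp := fun F G => semMap_comp.{v, u, w} F G
      map₂_whisker_left := fun F G G' σ => by
        refine sem_ext (fun X => ?_) (fun X => ?_)
        · change σ.τ.app (F.functor.obj X) = (eqToHom (semMap_comp F G)).top.app.app X ≫
            σ.τ.app (F.functor.obj X) ≫ (eqToHom (semMap_comp F G').symm).top.app.app X
          rw [eqToHom_top_app, eqToHom_top_app]
          exact ((Category.id_comp _).trans (Category.comp_id _)).symm
        · change σ.τ.app (F.functor.obj X) = (eqToHom (semMap_comp F G)).bot.app.app X ≫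
            σ.τ.app (F.functor.obj X) ≫ (eqToHom (semMap_comp F G').symm).bot.app.app X
          rw [eqToHom_bot_app, eqToHom_bot_app]
          exact ((Category.id_comp _).trans (Category.comp_id _)).symm
      map₂_whisker_right := fun {_ _ _ F F'} σ G => by
        refine sem_ext (fun X => ?_) (fun X => ?_)
        · change G.functor.map (σ.τ.app X) = (eqToHom (semMap_comp F G)).top.app.app X ≫
            G.functor.map (σ.τ.app X) ≫ (eqToHom (semMap_comp F' G).symm).top.app.app X
          rw [eqToHom_top_app, eqToHom_top_app]
          exact ((Category.id_comp _).trans (Category.comp_id _)).symm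
        · change G.functor.map (σ.τ.app X) = (eqToHom (semMap_comp F G)).bot.app.app X ≫
            G.functor.map (σ.τ.app X) ≫ (eqToHom (semMap_comp F' G).symm).bot.app.app X
          rw [eqToHom_bot_app, eqToHom_bot_app]
          exact ((Category.id_comp _).trans (Category.comp_id _)).symm }

/-! ### Monadic right-connected double categories -/

/-- A functor is strictly monadic if it has a left adjoint for which the comparison functor to
the category of algebras of the induced monad is an isomorphism of categories. -/
def IsStrictlyMonadic {A : Type*} [Category* A] {B : Type*} [Category* B] (U : A ⥤ B) : Prop :=
  ∃ (L : B ⥤ A) (adj : L ⊣ U) (K : adj.toMonad.Algebra ⥤ A),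
    Monad.comparison adj ⋙ K = 𝟭 A ∧ K ⋙ Monad.comparison adj = 𝟭 adj.toMonad.Algebra

/-- A concrete double category: a double functor `V : A ⟶ Sq C`, where `C` is the category
`A₀` of objects and horizontal arrows of `A`, whose component `V₀` is the identity functor and
whose component `V₁` is faithful. -/
structure ConcreteDouble where
  dbl : DoubleCat.{v, u, max v w}
  V : DoubleFunctor dbl (SqD.{v, u, w} dbl.Obj)
  V_zero : V.H = 𝟭 dbl.Obj
  V_one : (DoubleFunctor.toArrow.{v, u, w} V).Faithful

namespace ConcreteDouble

/-- A concrete double category as an object of the arrow 2-category of `DBL`. -/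
def toArrowTwo (A : ConcreteDouble.{v, u, w}) : ArrowTwo DoubleCat.{v, u, max v w} where
  src := A.dbl
  tgt := SqD.{v, u, w} A.dbl.Obj
  arr := A.V

/-- A concrete double category is right-connected if for each vertical arrow `a : X ⟶ Y`, with
underlying arrow `f`, there is a square with left side `a`, top side `f`, right side the vertical
identity of `Y` and bottom side the identity. (As `V₀` is the identity, `V.H.map (top α)` is the
top side of `α`.) -/
def RightConnected (A : ConcreteDouble.{v, u, w}) : Prop :=
  ∀ {X Y : A.dbl.Obj} (a : A.dbl.Vert X Y), ∃ α : A.dbl.Sq a (A.dbl.vid Y),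
    A.V.H.map (A.dbl.top α) = (A.V.V a).hom ∧ A.dbl.bot α = 𝟙 Y

/-- A concrete double category is monadic right-connected if it is right-connected and `V₁` is
strictly monadic. -/
def MonadicRightConnected (A : ConcreteDouble.{v, u, w}) : Prop :=
  IsStrictlyMonadic (DoubleFunctor.toArrow.{v, u, w} A.V) ∧ A.RightConnected

end ConcreteDouble

/-- The full sub-2-category of the arrow 2-category of `DBL` on the monadic right-connected
concrete double categories. -/
abbrev MRCConcrete : Type _ :=
  Bicategory.InducedBicategory (ArrowTwo DoubleCat.{v, u, max v w})
    fun A : { A : ConcreteDouble.{v, u, w} // A.MonadicRightConnected } => A.1.toArrowTwo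

namespace DoubleCat

/-- A double category is right-connected if for every vertical arrow `a : X ⟶ Y` and every
object `Z`, sending a square to its bottom side is a bijection from the squares with left side `a`
and right side the vertical identity of `Z` to the horizontal arrows `Y ⟶ Z`. -/
def RightConnected (A : DoubleCat.{v, u, w}) : Prop :=
  ∀ {X Y : A.Obj} (a : A.Vert X Y) (Z : A.Obj),
    Function.Bijective (fun α : A.Sq a (A.vid Z) => A.bot α)

namespace RightConnected

variable {A : DoubleCat.{v, u, w}}

lemma exists_unit (hA : A.RightConnected) {X Y : A.Obj} (a : A.Vert X Y) : ∃ α : A.Sq a (A.vid Y), A.bot α = 𝟙 Y :=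
  (hA a Y).2 (𝟙 Y)

variable (hA : A.RightConnected)

/-- The unit square from a vertical arrow `a` to the vertical identity of its codomain. -/
noncomputable def unit {X Y : A.Obj} (a : A.Vert X Y) : A.Sq a (A.vid Y) :=
  (hA.exists_unit a).choose

lemma bot_unit {X Y : A.Obj} (a : A.Vert X Y) : A.bot (hA.unit a) = 𝟙 Y :=
  (hA.exists_unit a).choose_spec

/-- The functor `A₁ ⥤ A₀²` induced by a right-connected double category: it sends a vertical
arrow to the top side of its unit square, and a square to its top and bottom sides. -/
noncomputable def toArrow : A.One ⥤ Arrow A.Obj where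
  obj a := Arrow.mk (A.top (hA.unit a.vert))
  map {a b} α := Arrow.homMk (f := Arrow.mk (A.top (hA.unit a.vert)))
    (g := Arrow.mk (A.top (hA.unit b.vert))) (A.top α) (A.bot α) (by
      have h : A.hcomp α (hA.unit b.vert) = A.hcomp (hA.unit a.vert) (A.vidSq (A.bot α)) := by
        refine (hA a.vert b.cod).1 ?_
        change A.bot _ = A.bot _
        rw [A.bot_hcomp, A.bot_hcomp, bot_unit, bot_unit, A.bot_vidSq, Category.comp_id,
          Category.id_comp]
      have k := congrArg A.top h
      rw [A.top_hcomp, A.top_hcomp, A.top_vidSq] at k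
      exact k)
  map_id a := Arrow.hom_ext _ _ (A.top_hid _) (A.bot_hid _)
  map_comp α β := Arrow.hom_ext _ _ (A.top_hcomp _ _) (A.bot_hcomp _ _)

end RightConnected

/-- A double category is monadic right-connected if it is right-connected and the induced functor
`A₁ ⥤ A₀²` is strictly monadic. -/
def MonadicRightConnected (A : DoubleCat.{v, u, w}) : Prop :=
  ∃ hA : A.RightConnected, IsStrictlyMonadic hA.toArrow

end DoubleCat

/-- The full sub-2-category of `DBL` on the monadic right-connected double categories. -/
abbrev MRCDouble : Type _ :=
  Bicategory.InducedBicategory DoubleCat.{v, u, w}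
    fun A : { A : DoubleCat.{v, u, w} // A.MonadicRightConnected } => A.1

end DoubleBeck

open DoubleBeck

namespace DoubleBeck

/-! ### A criterion for equivalences of 2-categories -/

section TwoCategories

open Bicategory

universe w₁ w₂ v₁ v₂ u₁ u₂

variable {B : Type u₁} [Bicategory.{w₁, v₁} B] {C : Type u₂} [Bicategory.{w₂, v₂} C]

/-! A strict 2-functor that is bijective on 1-cells, bijective on 2-cells and surjective on objects
up to strict isomorphism is an equivalence (`isTwoEquivalence_of_bijective`). The work is to check
these three conditions, first for `algebras` with values in double categories and then for
`semantics` with values in the arrow 2-category.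

On 1-cells, the underlying arrow of an algebra is the top side of a square from it to a vertical
identity. A double functor `K` between double categories of algebras preserves such squares, hence
commutes with underlying arrows. The image under `K` of the free algebra on `f` then yields a filler
`α f : E' (F f) ⟶ F (E f)`. It is compatible with multiplications because that image is again an
algebra. It is compatible with comultiplications because the comultiplication is a map of algebras
from the free algebra on `f` to the vertical composite of the free algebras on `l f` and on `f`
(`freeComp`, which is the distributive law), and `K` preserves vertical composites. Conversely the
`α` of a lax morphism is recovered from its action on free algebras (`LaxMor.α_eq`), so lax
morphisms and double functors correspond bijectively. The same evaluation at free algebras handles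
2-cells.

On objects, let `A` be monadic right-connected. Strict monadicity gives free objects on arrows, and
right-connectedness allows the codomain of the free vertical arrow on `f` to be taken to be that of
`f` (`exists_freeVert`). These free vertical arrows form a functorial factorisation. Its
multiplication is induced by the universal property, and its comultiplication is the top side of the
square from the free vertical arrow on `f` to the vertical composite of the free ones on `l f` and
on `f`. Every axiom compares two squares out of a free vertical arrow, which agree as soon as they
agree after the unit and on the bottom side. A vertical arrow becomes an algebra through its counit
square; this respects vertical composition, and strict monadicity makes it bijective on vertical
arrows and on squares (`exists_inverse`).

Finally, a right-connected concrete double category is right-connected without reference to `V`, and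
`V` is then the canonical double functor `toSqD`. Every double functor between right-connected
double categories commutes with these, so passing from the arrow 2-category to top sides loses
nothing on 1-cells or 2-cells. This reduces the concrete case to the other one. -/

lemma whiskerLeft_heq {X Y Z : B} {f f' : X ⟶ Y} {g g' h h' : Y ⟶ Z} (hf : f = f') (hg : g = g')
    (hh : h = h') {η : g ⟶ h} {η' : g' ⟶ h'} (e : η ≍ η') : f ◁ η ≍ f' ◁ η' := by
  subst hf hg hh; rw [eq_of_heq e]

lemma whiskerRight_heq {X Y Z : B} {f f' g g' : X ⟶ Y} {h h' : Y ⟶ Z} (hf : f = f')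
    (hg : g = g') (hh : h = h') {η : f ⟶ g} {η' : f' ⟶ g'} (e : η ≍ η') : η ▷ h ≍ η' ▷ h' := by
  subst hf hg hh; rw [eq_of_heq e]

/-- In a strict 2-category the coherence 2-cells are `eqToHom`s. Heterogeneous equality absorbs such
conjugations, so whiskering calculations can be chained without carrying them along. -/
lemma eqToHom_conj_heq {A : Type*} [Category* A] {X X' Y Y' : A} (h : X' = X) (f : X ⟶ Y)
    (h' : Y = Y') : eqToHom h ≫ f ≫ eqToHom h' ≍ f := by
  subst h h'; simp

lemma eq_eqToHom_conj {A : Type*} [Category* A] {X X' Y Y' : A} (h : X' = X) (f : X ⟶ Y)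
    (h' : Y = Y') {g : X' ⟶ Y'} (e : g ≍ f) : g = eqToHom h ≫ f ≫ eqToHom h' :=
  eq_of_heq (e.trans (eqToHom_conj_heq h f h').symm)

section strict

variable [Strict B]

lemma id_whiskerLeft_heq {X Y : B} {f g : X ⟶ Y} (η : f ⟶ g) : 𝟙 X ◁ η ≍ η := by
  rw [id_whiskerLeft, Strict.leftUnitor_eqToIso, Strict.leftUnitor_eqToIso]
  simp only [eqToIso.hom, eqToIso.inv]
  exact eqToHom_conj_heq _ _ _

lemma whiskerRight_id_heq {X Y : B} {f g : X ⟶ Y} (η : f ⟶ g) : η ▷ 𝟙 Y ≍ η := by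
  rw [whiskerRight_id, Strict.rightUnitor_eqToIso, Strict.rightUnitor_eqToIso]
  simp only [eqToIso.hom, eqToIso.inv]
  exact eqToHom_conj_heq _ _ _

lemma comp_whiskerLeft_heq {X Y Z T : B} (f : X ⟶ Y) (g : Y ⟶ Z) {h k : Z ⟶ T} (η : h ⟶ k) :
    (f ≫ g) ◁ η ≍ f ◁ g ◁ η := by
  rw [comp_whiskerLeft, Strict.associator_eqToIso, Strict.associator_eqToIso]
  simp only [eqToIso.hom, eqToIso.inv]
  exact eqToHom_conj_heq _ _ _

lemma whiskerRight_comp_heq {X Y Z T : B} {f g : X ⟶ Y} (η : f ⟶ g) (h : Y ⟶ Z) (k : Z ⟶ T) :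
    η ▷ (h ≫ k) ≍ (η ▷ h) ▷ k := by
  rw [whiskerRight_comp, Strict.associator_eqToIso, Strict.associator_eqToIso]
  simp only [eqToIso.hom, eqToIso.inv]
  exact eqToHom_conj_heq _ _ _

lemma whisker_assoc_heq {X Y Z T : B} (f : X ⟶ Y) {g h : Y ⟶ Z} (η : g ⟶ h) (k : Z ⟶ T) :
    (f ◁ η) ▷ k ≍ f ◁ η ▷ k := by
  rw [whisker_assoc, Strict.associator_eqToIso, Strict.associator_eqToIso]
  simp only [eqToIso.hom, eqToIso.inv]
  exact eqToHom_conj_heq _ _ _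

end strict

lemma strict_map₂_whiskerLeft (F : StrictPseudofunctor B C) {X Y Z : B} (f : X ⟶ Y)
    {g h : Y ⟶ Z} (η : g ⟶ h) : F.map₂ (f ◁ η) = eqToHom (F.map_comp f g) ≫
      F.map f ◁ F.map₂ η ≫ eqToHom (F.map_comp f h).symm := by
  rw [F.map₂_whisker_left, F.mapComp_eq_eqToIso, F.mapComp_eq_eqToIso]; rfl

lemma strict_map₂_whiskerRight (F : StrictPseudofunctor B C) {X Y Z : B} {f g : X ⟶ Y}
    (η : f ⟶ g) (h : Y ⟶ Z) : F.map₂ (η ▷ h) = eqToHom (F.map_comp f h) ≫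
      F.map₂ η ▷ F.map h ≫ eqToHom (F.map_comp g h).symm := by
  rw [F.map₂_whisker_right, F.mapComp_eq_eqToIso, F.mapComp_eq_eqToIso]; rfl

lemma map₂_whiskerLeft_heq (F : StrictPseudofunctor B C) {X Y Z : B} (f : X ⟶ Y)
    {g h : Y ⟶ Z} (η : g ⟶ h) : F.map₂ (f ◁ η) ≍ F.map f ◁ F.map₂ η := by
  rw [strict_map₂_whiskerLeft]; exact eqToHom_conj_heq _ _ _

lemma map₂_whiskerRight_heq (F : StrictPseudofunctor B C) {X Y Z : B} {f g : X ⟶ Y}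
    (η : f ⟶ g) (h : Y ⟶ Z) : F.map₂ (η ▷ h) ≍ F.map₂ η ▷ F.map h := by
  rw [strict_map₂_whiskerRight]; exact eqToHom_conj_heq _ _ _

/-- Strict 2-functors are determined by their action on objects, 1-cells and 2-cells. -/
lemma strictPseudofunctor_ext {F G : StrictPseudofunctor B C}
    (h : F.toPrelaxFunctor = G.toPrelaxFunctor) : F = G := by
  obtain ⟨⟨⟨F, mi, mc, _, _, _, _, _⟩, hi, ei⟩, hc, ec⟩ := F
  obtain ⟨⟨⟨G, mi', mc', _, _, _, _, _⟩, hi', ei'⟩, hc', ec'⟩ := G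
  dsimp at h
  subst h
  have e₁ : mi = mi' := by
    funext X; exact (ei X).trans (ei' X).symm
  have e₂ : @mc = @mc' := by
    funext X Y Z f g; exact (ec f g).trans (ec' f g).symm
  subst e₁
  subst e₂
  rfl

variable [Strict B] [Strict C]

/-- A strict 2-functor that is bijective on 1-cells and on 2-cells, and surjective on objects up
to strict isomorphism, is an equivalence of 2-categories. -/
theorem isTwoEquivalence_of_bijective (F : StrictPseudofunctor B C)
    (h₁ : ∀ X Y : B, Function.Bijective (fun f : X ⟶ Y => F.map f))
    (h₂ : ∀ {X Y : B} (f g : X ⟶ Y), Function.Bijective (fun η : f ⟶ g => F.map₂ η))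
    (h₃ : ∀ Z : C, ∃ (X : B) (i : F.obj X ⟶ Z) (j : Z ⟶ F.obj X), i ≫ j = 𝟙 _ ∧ j ≫ i = 𝟙 _) :
    IsTwoEquivalence F := by
  choose ob i j hij hji using h₃
  have hij' : ∀ (Z : C) {T : C} (f : F.obj (ob Z) ⟶ T), i Z ≫ j Z ≫ f = f := fun Z T f => by
    rw [← Strict.assoc, hij, Strict.id_comp]
  have hji' : ∀ (Z : C) {T : C} (f : Z ⟶ T), j Z ≫ i Z ≫ f = f := fun Z T f => by
    rw [← Strict.assoc, hji, Strict.id_comp]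
  -- The inverse on 1-cells and 2-cells is conjugation by the chosen isomorphisms `i`, `j`, pulled
  -- back along the bijections given by `F`.
  have ex₁ : ∀ (Z T : C) (f : Z ⟶ T), ∃ g : ob Z ⟶ ob T, F.map g = i Z ≫ f ≫ j T :=
    fun Z T f => (h₁ _ _).2 _
  choose m' hm' using ex₁
  let m {Z T : C} (f : Z ⟶ T) : ob Z ⟶ ob T := m' Z T f
  have hm : ∀ {Z T : C} (f : Z ⟶ T), F.map (m f) = i Z ≫ f ≫ j T := fun f => hm' _ _ f
  have ex₂ : ∀ (Z T : C) (f g : Z ⟶ T) (η : f ⟶ g), ∃ θ : m f ⟶ m g,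
      F.map₂ θ = eqToHom (hm f) ≫ i Z ◁ (η ▷ j T) ≫ eqToHom (hm g).symm :=
    fun Z T f g η => (h₂ (m f) (m g)).2 _
  choose m₂' hm₂'' using ex₂
  let m₂ {Z T : C} {f g : Z ⟶ T} (η : f ⟶ g) : m f ⟶ m g := m₂' Z T f g η
  have hm₂ : ∀ {Z T : C} {f g : Z ⟶ T} (η : f ⟶ g),
      F.map₂ (m₂ η) = eqToHom (hm f) ≫ i Z ◁ (η ▷ j T) ≫ eqToHom (hm g).symm :=
    fun η => hm₂'' _ _ _ _ η
  have hm₂' : ∀ {Z T : C} {f g : Z ⟶ T} (η : f ⟶ g), F.map₂ (m₂ η) ≍ i Z ◁ (η ▷ j T) :=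
    fun η => by rw [hm₂]; exact eqToHom_conj_heq _ _ _
  -- All laws of the inverse are checked after applying `F`, which is injective on 1-cells and
  -- 2-cells; the inner `j ≫ i` then cancel.
  have mid : ∀ Z : C, m (𝟙 Z) = 𝟙 (ob Z) := fun Z => (h₁ _ _).1 (by
    change F.map _ = F.map _
    rw [hm, F.map_id, Strict.id_comp, hij])
  have mcomp : ∀ {X Y Z : C} (f : X ⟶ Y) (g : Y ⟶ Z), m (f ≫ g) = m f ≫ m g :=
    fun f g => (h₁ _ _).1 (by
      change F.map _ = F.map _
      rw [hm, F.map_comp, hm, hm]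
      simp only [Strict.assoc, hji'])
  -- Injectivity of `F` on 2-cells, for 2-cells whose boundaries are only propositionally equal.
  have cancel : ∀ {X Y : B} {f g f' g' : X ⟶ Y} (hf : f = f') (hg : g = g') {η : f ⟶ g}
      {θ : f' ⟶ g'}, F.map₂ η ≍ F.map₂ θ → η ≍ θ := by
    intro X Y f g f' g' hf hg η θ e
    subst hf hg
    exact heq_of_eq ((h₂ _ _).1 (eq_of_heq e))
  let G : StrictPseudofunctor C B := StrictPseudofunctor.mk''
    { obj := ob
      map := fun f => m f
      map₂ := fun η => m₂ η
      map₂_id := fun f => (h₂ _ _).1 (by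
        change F.map₂ _ = F.map₂ _
        rw [hm₂, F.map₂_id]
        simp)
      map₂_comp := fun η θ => (h₂ _ _).1 (by
        change F.map₂ _ = F.map₂ _
        rw [hm₂, F.map₂_comp, hm₂, hm₂]
        simp)
      map_id := mid
      map_comp := fun f g => mcomp f g
      map₂_whisker_left := fun {X Y Z} f g g' η => by
        refine eq_eqToHom_conj _ _ _ (cancel (mcomp _ _) (mcomp _ _) ?_)
        refine (hm₂' _).trans (HEq.symm ?_)
        refine (map₂_whiskerLeft_heq F _ _).trans ?_
        refine (whiskerLeft_heq (hm f) (hm g) (hm g') (hm₂' η)).trans ?_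
        refine (comp_whiskerLeft_heq _ _ _).trans ?_
        refine whiskerLeft_heq rfl ?_ ?_ ?_
        · simp only [Strict.assoc, hji']
        · simp only [Strict.assoc, hji']
        refine (comp_whiskerLeft_heq _ _ _).trans ?_
        refine HEq.trans ?_ (whisker_assoc_heq _ _ _).symm
        refine whiskerLeft_heq rfl (hji' _ _) (hji' _ _) ?_
        -- What remains is whiskering by `j Y` and `i Y` in succession, that is, by `j Y ≫ i Y`, an
        -- identity.
        refine (comp_whiskerLeft_heq _ _ _).symm.trans ?_
        refine (whiskerLeft_heq (hji Y) rfl rfl HEq.rfl).trans ?_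
        exact id_whiskerLeft_heq _
      map₂_whisker_right := fun {X Y Z f f'} η g => by
        refine eq_eqToHom_conj _ _ _ (cancel (mcomp _ _) (mcomp _ _) ?_)
        refine (hm₂' _).trans (HEq.symm ?_)
        refine (map₂_whiskerRight_heq F _ _).trans ?_
        refine (whiskerRight_heq (hm f) (hm f') (hm g) (hm₂' η)).trans ?_
        refine (whisker_assoc_heq _ _ _).trans ?_
        refine whiskerLeft_heq rfl ?_ ?_ ?_
        · simp only [Strict.assoc, hji']
        · simp only [Strict.assoc, hji']
        refine (whiskerRight_comp_heq _ _ _).symm.trans ?_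
        refine HEq.trans ?_ (whiskerRight_comp_heq _ _ _)
        exact whiskerRight_heq rfl rfl (hji' _ _) HEq.rfl }
  -- The components of the isomorphism from the identity to the composite of `F` with `G` are the
  -- preimages under `F` of `j` and `i` at `F.obj X`.
  have exu : ∀ X : B, ∃ u : X ⟶ ob (F.obj X), F.map u = j (F.obj X) := fun X => (h₁ _ _).2 _
  have exw : ∀ X : B, ∃ u : ob (F.obj X) ⟶ X, F.map u = i (F.obj X) := fun X => (h₁ _ _).2 _
  choose a ha using exu
  choose b hb using exw
  have hab : ∀ X : B, a X ≫ b X = 𝟙 X := fun X => (h₁ _ _).1 (by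
    change F.map _ = F.map _
    rw [F.map_comp, ha, hb, hji, F.map_id])
  have hba : ∀ X : B, b X ≫ a X = 𝟙 (ob (F.obj X)) := fun X => (h₁ _ _).1 (by
    change F.map _ = F.map _
    rw [F.map_comp, ha, hb, hij, F.map_id])
  refine ⟨G, ⟨?_⟩, ⟨?_⟩⟩
  · have nat : ∀ {X Y : B} (f : X ⟶ Y), f ≫ a Y = a X ≫ m (F.map f) := fun f => (h₁ _ _).1 (by
      change F.map _ = F.map _
      rw [F.map_comp, F.map_comp, hm, ha, ha, hji'])
    exact
      { hom := a
        inv := b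
        hom_inv := hab
        inv_hom := hba
        naturality := nat
        naturality₂ := fun {X Y f g} η => by
          change η ▷ a Y ≫ eqToHom (nat g) = eqToHom (nat f) ≫ a X ◁ m₂ (F.map₂ η)
          refine eq_of_heq ((comp_eqToHom_heq _ _).trans (HEq.trans ?_
            (eqToHom_comp_heq _ _).symm))
          refine cancel (nat f) (nat g) ?_
          refine (map₂_whiskerRight_heq F _ _).trans (HEq.symm ?_)
          refine (map₂_whiskerLeft_heq F _ _).trans ?_
          refine (whiskerLeft_heq (ha X) (hm _) (hm _) (hm₂' _)).trans ?_
          refine (comp_whiskerLeft_heq _ _ _).symm.trans ?_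
          refine (whiskerLeft_heq (hji _) rfl rfl HEq.rfl).trans ?_
          refine (id_whiskerLeft_heq _).trans ?_
          exact whiskerRight_heq rfl rfl (ha Y).symm HEq.rfl }
  · have nat : ∀ {X Y : C} (f : X ⟶ Y), F.map (m f) ≫ i Y = i X ≫ f := fun f => by
      rw [hm, Strict.assoc, Strict.assoc, hji, Strict.comp_id]
    exact
      { hom := i
        inv := j
        hom_inv := hij
        inv_hom := hji
        naturality := nat
        naturality₂ := fun {X Y f g} η => by
          change F.map₂ (m₂ η) ▷ i Y ≫ eqToHom (nat g) = eqToHom (nat f) ≫ i X ◁ η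
          refine eq_of_heq ((comp_eqToHom_heq _ _).trans (HEq.trans ?_
            (eqToHom_comp_heq _ _).symm))
          refine (whiskerRight_heq (hm f) (hm g) rfl (hm₂' η)).trans ?_
          refine (whisker_assoc_heq _ _ _).trans ?_
          refine whiskerLeft_heq rfl ?_ ?_ ?_
          · rw [Strict.assoc, hji, Strict.comp_id]
          · rw [Strict.assoc, hji, Strict.comp_id]
          refine (whiskerRight_comp_heq _ _ _).symm.trans ?_
          refine (whiskerRight_heq rfl rfl (hji _) HEq.rfl).trans ?_
          exact whiskerRight_id_heq _ }

end TwoCategories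

/-! ### Lax morphisms and double functors between double categories of algebras -/

namespace AWFS

variable {C : Type u} [Category.{v} C] (W : AWFS C) {X Y X' Y' : C}

lemma m_m (f : X ⟶ Y) : W.m (W.F.right f) ≫ W.m f =
    W.F.midMap (W.m f) (𝟙 Y) ((W.m_right f).trans (Category.comp_id _).symm) ≫ W.m f := by
  have h : W.F.E.map (W.μ.app (Arrow.mk f)) ≫ W.m f = W.m (W.F.right f) ≫ W.m f :=
    congrArg (fun t => t.left) (W.assoc (Arrow.mk f))
  rw [← h]
  exact congrArg (fun t => W.F.E.map t ≫ W.m f) (Arrow.hom_ext _ _ rfl (W.μ_right _))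

lemma midMap_left_m (f : X ⟶ Y) : W.F.midMap (W.F.left f) (𝟙 Y)
    ((W.F.left_right f).trans (Category.comp_id _).symm) ≫ W.m f = 𝟙 _ :=
  congrArg (fun t => t.left) (W.right_unit (Arrow.mk f))

/-- The free algebra on an arrow. -/
def free (f : X ⟶ Y) : RAlg.{v, u, w} W (W.F.mid f) Y where
  hom := W.F.right f
  str := W.m f
  str_hom := W.m_right f
  unit := W.left_m f
  assoc := W.m_m f

/-- The map of free algebras induced by a commutative square. -/
def freeMap {f : X ⟶ Y} {g : X' ⟶ Y'} (a : X ⟶ X') (b : Y ⟶ Y') (h : a ≫ g = f ≫ b) :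
    RAlg.Sq (free.{v, u, w} W f) (free.{v, u, w} W g) where
  top := W.F.midMap a b h
  bot := b
  comm := W.F.midMap_right a b h
  str := (W.midMap_m a b h).symm

/-- The comparison of a free algebra with the composite of two free algebras. -/
def freeComp (f : X ⟶ Y) : RAlg.Sq (free.{v, u, w} W f)
    ((free.{v, u, w} W (W.F.left f)).comp (free.{v, u, w} W f)) where
  top := W.c f
  bot := 𝟙 Y
  comm := by
    change W.c f ≫ W.F.right (W.F.left f) ≫ W.F.right f = W.F.right f ≫ 𝟙 Y
    rw [← Category.assoc, c_right, Category.id_comp, Category.comp_id]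
  str := by
    -- The distributive law enters here. Filling against the composite algebra means filling against
    -- the free algebra on `f` and then against the one on `l f`. The first filler is `W.m f`, by
    -- `c_right`, so what is left is exactly the right-hand side of `m_c`.
    refine (W.m_c f).trans (Eq.trans ?_ (RAlg.midMap_lift _ _ _ _ _ _ _).symm)
    refine congrArg (fun t => W.c (W.F.right f) ≫ t ≫ W.m (W.F.left f)) ?_
    refine W.F.midMap_congr (Category.comp_id _).symm ?_
    rw [RAlg.compMid_eq]
    refine Eq.trans ?_ (W.F.midMap_comp_assoc _ _ _ _ _ _ _).symm
    refine (Category.id_comp _).symm.trans ?_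
    rw [← W.F.midMap_id]
    refine congrArg (· ≫ W.m f) (W.F.midMap_congr (W.c_right f).symm (Category.comp_id _).symm)

namespace RAlg

variable {W}

/-- The counit map from the free algebra on the underlying arrow of an algebra. -/
def counit (g : RAlg.{v, u, w} W X Y) : Sq (free.{v, u, w} W g.hom) g where
  top := g.str
  bot := 𝟙 Y
  comm := g.str_hom.trans (Category.comp_id _).symm
  str := g.assoc

/-- The square from an algebra to the identity algebra on its codomain. -/
def toId (g : RAlg.{v, u, w} W X Y) : Sq g (RAlg.id.{v, u, w} W Y) where
  top := g.hom
  bot := 𝟙 Y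
  comm := rfl
  str := g.str_hom.trans ((Category.comp_id _).symm.trans (W.F.midMap_right _ _ _).symm)

lemma midMap_str_congr {g h : RAlg.{v, u, w} W X Y} (e : g = h) {A B : C} {f : A ⟶ B}
    {a a' : A ⟶ X} {b b' : B ⟶ Y} (ea : a = a') (eb : b = b') (q : a ≫ g.hom = f ≫ b)
    (q' : a' ≫ h.hom = f ≫ b') :
    W.F.midMap a b q ≫ g.str = W.F.midMap a' b' q' ≫ h.str := by
  subst e ea eb; rfl

end RAlg

end AWFS

/-! ### Recovering a lax morphism from a double functor -/

namespace DoubleFunctor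

open AWFS

variable {C D : Type u} [Category.{v} C] [Category.{v} D] {W : AWFS C} {W' : AWFS D}
  (K : DoubleFunctor (DAlg.{v, u, w} W) (DAlg.{v, u, w} W')) {X Y X' Y' Z : C}

/-- The functor on objects and horizontal arrows underlying a double functor between double
categories of algebras. -/
def base : C ⥤ D := K.H

/-- The action on algebras of a double functor between double categories of algebras. -/
def onAlg (g : RAlg.{v, u, w} W X Y) : RAlg.{v, u, w} W' (K.base.obj X) (K.base.obj Y) := K.V g

/-- The action on maps of algebras of a double functor between double categories of algebras. -/
def onSq {g : RAlg.{v, u, w} W X Y} {g' : RAlg.{v, u, w} W X' Y'} (β : RAlg.Sq g g') :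
    RAlg.Sq (K.onAlg g) (K.onAlg g') := K.S β

lemma onSq_top {g : RAlg.{v, u, w} W X Y} {g' : RAlg.{v, u, w} W X' Y'} (β : RAlg.Sq g g') :
    (K.onSq β).top = K.base.map β.top := K.top_S β

lemma onSq_bot {g : RAlg.{v, u, w} W X Y} {g' : RAlg.{v, u, w} W X' Y'} (β : RAlg.Sq g g') :
    (K.onSq β).bot = K.base.map β.bot := K.bot_S β

lemma onAlg_id (X : C) : K.onAlg (RAlg.id.{v, u, w} W X) = RAlg.id.{v, u, w} W' (K.base.obj X) :=
  K.V_vid X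

lemma onAlg_comp (g : RAlg.{v, u, w} W X Y) (h : RAlg.{v, u, w} W Y Z) :
    K.onAlg (g.comp h) = (K.onAlg g).comp (K.onAlg h) := K.V_vcomp g h

/-- Right-connectedness at work: the image of `g.toId` is a square into a vertical identity, since
`K` preserves these. Its bottom side is an identity, so its commutativity reads off the underlying
arrow of the image. -/
lemma onAlg_hom (g : RAlg.{v, u, w} W X Y) : (K.onAlg g).hom = K.base.map g.hom := by
  have h := (K.onSq g.toId).comm
  rw [onSq_top, onSq_bot, onAlg_id] at h
  change K.base.map g.hom ≫ 𝟙 _ = _ ≫ K.base.map (𝟙 Y) at h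
  rw [K.base.map_id, Category.comp_id, Category.comp_id] at h
  exact h.symm

lemma onSq_str {g : RAlg.{v, u, w} W X Y} {g' : RAlg.{v, u, w} W X' Y'} (β : RAlg.Sq g g') :
    (K.onAlg g).str ≫ K.base.map β.top = W'.F.midMap (K.base.map β.top) (K.base.map β.bot)
      (by rw [onAlg_hom, onAlg_hom, ← K.base.map_comp, β.comm, K.base.map_comp]) ≫
        (K.onAlg g').str := by
  have h := (K.onSq β).str
  simp only [onSq_top, onSq_bot] at h
  exact h

/-- The comparison maps `E' (F f) ⟶ F (E f)` of a double functor between double categories of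
algebras: the filler of `(F (l f), 1)` against the image of the free algebra on `f`. -/
def laxα (f : X ⟶ Y) : W'.F.mid (K.base.map f) ⟶ K.base.obj (W.F.mid f) :=
  W'.F.midMap (f := K.base.map f) (g := (K.onAlg (free.{v, u, w} W f)).hom)
    (K.base.map (W.F.left f)) (𝟙 _) (by
      rw [onAlg_hom, Category.comp_id, ← K.base.map_comp]
      exact congrArg K.base.map (W.F.left_right f)) ≫ (K.onAlg (free.{v, u, w} W f)).str

/-- The counit from the free algebra on `g.hom` to `g` is a map of algebras, so its image carries
the filler defining `laxα` into `K.onAlg g`, where the unit law of `g` turns the top side into an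
identity. This is what makes the lax morphism built from `laxα` act on algebras as `K` does. -/
lemma laxα_map_str (g : RAlg.{v, u, w} W X Y) : K.laxα g.hom ≫ K.base.map g.str =
    W'.F.midMap (f := K.base.map g.hom) (g := (K.onAlg g).hom) (𝟙 _) (𝟙 _)
      (by rw [onAlg_hom, Category.comp_id, Category.id_comp]) ≫ (K.onAlg g).str := by
  have h := K.onSq_str g.counit
  rw [laxα, Category.assoc]
  refine (congrArg (_ ≫ ·) h).trans ?_
  rw [W'.F.midMap_comp_assoc]
  congr 1
  refine W'.F.midMap_congr ?_ ?_
  · rw [← K.base.map_comp, ← K.base.map_id]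
    exact congrArg K.base.map g.unit
  · rw [Category.id_comp]
    exact K.base.map_id Y

/-- The image under `K` of the map of free algebras `freeMap` turns both sides into fillers of the
same square against the image of the free algebra on `g`. -/
lemma laxα_naturality {f : X ⟶ Y} {g : X' ⟶ Y'} (a : X ⟶ X') (b : Y ⟶ Y')
    (h : a ≫ g = f ≫ b) :
    W'.F.midMap (K.base.map a) (K.base.map b)
        (by rw [← K.base.map_comp, h, K.base.map_comp]) ≫ K.laxα g =
      K.laxα f ≫ K.base.map (W.F.midMap a b h) := by
  have k := K.onSq_str (freeMap.{v, u, w} W a b h)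
  conv_rhs => rw [laxα, Category.assoc]
  refine Eq.trans ?_ (congrArg (_ ≫ ·) k).symm
  rw [laxα, W'.F.midMap_comp_assoc, W'.F.midMap_comp_assoc]
  congr 1
  refine W'.F.midMap_congr ?_ ?_
  · rw [← K.base.map_comp, ← K.base.map_comp]
    exact congrArg K.base.map (W.F.left_midMap a b h).symm
  · exact (Category.comp_id _).trans (Category.id_comp _).symm

lemma left_laxα (f : X ⟶ Y) :
    W'.F.left (K.base.map f) ≫ K.laxα f = K.base.map (W.F.left f) := by
  rw [laxα, ← Category.assoc, W'.F.left_midMap, Category.assoc, (K.onAlg _).unit,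
    Category.comp_id]

lemma laxα_right (f : X ⟶ Y) :
    K.laxα f ≫ K.base.map (W.F.right f) = W'.F.right (K.base.map f) := by
  have h := (K.onAlg (free.{v, u, w} W f)).str_hom
  rw [show K.base.map (W.F.right f) = (K.onAlg (free.{v, u, w} W f)).hom from
    (K.onAlg_hom (free.{v, u, w} W f)).symm, laxα, Category.assoc, h, W'.F.midMap_right,
    Category.comp_id]

/-- By `laxα_map_str` at a free algebra, the right-hand side is expressed through the structure map
of `K.onAlg (free W f)`. The equation is then the associativity law of that algebra. -/
lemma m_laxα (f : X ⟶ Y) : W'.m (K.base.map f) ≫ K.laxα f =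
    W'.F.midMap (K.laxα f) (𝟙 (K.base.obj Y)) ((K.laxα_right f).trans (Category.comp_id _).symm) ≫
      K.laxα (W.F.right f) ≫ K.base.map (W.m f) := by
  have h := K.laxα_map_str (free.{v, u, w} W f)
  refine Eq.trans ?_ (congrArg (_ ≫ ·) h).symm
  refine Eq.trans ?_ (W'.F.midMap_comp_assoc _ _ _ _ _ _ _).symm
  conv_lhs => rw [laxα, ← Category.assoc, ← W'.midMap_m, Category.assoc, (K.onAlg _).assoc,
    W'.F.midMap_comp_assoc]
  congr 1
  exact W'.F.midMap_congr (Category.comp_id _).symm rfl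

/-- The image of `freeComp` is a map of algebras into the image of a vertical composite, which is
the vertical composite of the images. The structure map of that composite is a filler against the
image of the free algebra on `f` followed by one against the image of the free algebra on `l f`;
these produce the two occurrences of `laxα` on the right. -/
lemma laxα_c (f : X ⟶ Y) : K.laxα f ≫ K.base.map (W.c f) =
    W'.c (K.base.map f) ≫ W'.F.midMap (𝟙 (K.base.obj X)) (K.laxα f)
      ((Category.id_comp _).trans (K.left_laxα f).symm) ≫ K.laxα (W.F.left f) := by
  have h := K.onSq_str (freeComp.{v, u, w} W f)
  have q₁ : K.base.map (W.F.left (W.F.left f)) ≫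
      (K.onAlg (free.{v, u, w} W (W.F.left f))).hom = K.base.map (W.F.left f) := by
    rw [onAlg_hom, ← K.base.map_comp]
    exact congrArg K.base.map (W.F.left_right (W.F.left f))
  have q : K.base.map (W.F.left (W.F.left f)) ≫
      ((K.onAlg (free.{v, u, w} W (W.F.left f))).comp (K.onAlg (free.{v, u, w} W f))).hom =
        K.base.map f ≫ 𝟙 _ := by
    change _ ≫ (K.onAlg (free.{v, u, w} W (W.F.left f))).hom ≫
      (K.onAlg (free.{v, u, w} W f)).hom = _
    rw [← Category.assoc, q₁, onAlg_hom, Category.comp_id, ← K.base.map_comp]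
    exact congrArg K.base.map (W.F.left_right f)
  conv_lhs => rw [laxα, Category.assoc]
  refine (congrArg (_ ≫ ·) h).trans ?_
  rw [W'.F.midMap_comp_assoc]
  -- Preservation of vertical composition replaces the image of the composite by the composite of
  -- the images; `left_c` simplifies the top side.
  refine (RAlg.midMap_str_congr (K.onAlg_comp _ _) (a' := K.base.map (W.F.left (W.F.left f)))
    (b' := 𝟙 _) ?_ ?_ _ q).trans ?_
  · rw [← K.base.map_comp]
    exact congrArg K.base.map (W.left_c f)
  · rw [Category.id_comp]
    exact K.base.map_id Y
  refine (RAlg.midMap_lift _ _ _ _ _ _ _).trans ?_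
  refine Eq.trans ?_ (congrArg (W'.c (K.base.map f) ≫ ·)
    (W'.F.midMap_comp_assoc _ _ _ _ _ _ _).symm)
  refine congrArg (fun t => W'.c (K.base.map f) ≫ t ≫ _) ?_
  refine W'.F.midMap_congr ?_ ?_
  · exact (Category.comp_id _).trans (Category.id_comp _).symm
  -- The intermediate filler against the image of the free algebra on `f` is `laxα f` itself.
  · rw [RAlg.compMid_eq]
    refine (W'.F.midMap_comp_assoc _ _ _ _ _ _ _).trans (Eq.trans ?_ (Category.comp_id _).symm)
    exact congrArg (· ≫ (K.onAlg (free.{v, u, w} W f)).str)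
      (W'.F.midMap_congr q₁ (Category.comp_id _))

/-- The lax morphism determined by a double functor between double categories of algebras. -/
def toLaxMor : LaxMor W W' where
  functor := K.base
  α f := K.laxα f
  α_naturality a b h := K.laxα_naturality a b h
  left_α f := K.left_laxα f
  α_right f := K.laxα_right f
  m_α f := K.m_laxα f
  α_c f := K.laxα_c f

lemma dAlg_toLaxMor : LaxMor.dAlg.{v, u, w} K.toLaxMor = K := by
  have e : ∀ {X Y : C} (g : RAlg.{v, u, w} W X Y), K.toLaxMor.mapAlg g = K.onAlg g := fun g =>
    RAlg.ext' (K.onAlg_hom g).symm (K.laxα_map_str g)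
  refine DoubleFunctor.ext' rfl (fun g => heq_of_eq (e g)) fun β => ?_
  exact RAlg.Sq.heq (e _) (e _) (K.onSq_top β).symm (K.onSq_bot β).symm

lemma V_congr {A B : DoubleCat.{v, u, w}} {F G : DoubleFunctor A B} (h : F = G) {X Y : A.Obj}
    (a : A.Vert X Y) : F.V a ≍ G.V a := by subst h; rfl

end DoubleFunctor

/-! ### Bijectivity on 1-cells and 2-cells -/

namespace LaxMor

open AWFS

variable {C D : Type u} [Category.{v} C] [Category.{v} D] {W : AWFS C} {W' : AWFS D}

/-- Naturality of `α` at the unit `(l f, 1) : f ⟶ r f`, followed by the unit law of the monad. Hence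
a lax morphism is determined by its functor and its action on free algebras. -/
lemma α_eq (F : LaxMor W W') {X Y : C} (f : X ⟶ Y) : F.α f =
    W'.F.midMap (f := F.functor.map f) (g := (F.mapAlg (free.{v, u, w} W f)).hom)
      (F.functor.map (W.F.left f)) (𝟙 _) (by
        rw [Category.comp_id]
        exact (F.functor.map_comp _ _).symm.trans (congrArg F.functor.map (W.F.left_right f))) ≫
      (F.mapAlg (free.{v, u, w} W f)).str := by
  have h := F.α_naturality (W.F.left f) (𝟙 Y)
    ((W.F.left_right f).trans (Category.comp_id _).symm)
  change _ = _ ≫ F.α (W.F.right f) ≫ F.functor.map (W.m f)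
  refine Eq.trans ?_ (congrArg (· ≫ F.functor.map (W.m f)) h.symm) |>.trans ?_
  · rw [Category.assoc, ← F.functor.map_comp, W.midMap_left_m, F.functor.map_id,
      Category.comp_id]
  · rw [Category.assoc]
    congr 1
    exact W'.F.midMap_congr rfl (F.functor.map_id Y)

/-- Lax morphisms of algebraic weak factorisation systems are the same as double functors between
the double categories of algebras. -/
theorem dAlg_bijective :
    Function.Bijective (LaxMor.dAlg.{v, u, w} (W := W) (W' := W')) := by
  refine ⟨fun F G h => ?_, fun K => ⟨K.toLaxMor, K.dAlg_toLaxMor⟩⟩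
  have hH : F.functor = G.functor := congrArg DoubleFunctor.H h
  refine LaxMor.ext' hH fun {X Y} f => ?_
  have hV : F.mapAlg (free.{v, u, w} W f) ≍ G.mapAlg (free.{v, u, w} W f) :=
    DoubleFunctor.V_congr h (free.{v, u, w} W f)
  rw [F.α_eq.{v, u, w} f, G.α_eq.{v, u, w} f]
  -- Once the two functors are identified, the heterogeneous equality of algebras becomes an
  -- ordinary one.
  cases F with | mk F α _ _ _ _ _ => cases G with | mk G β _ _ _ _ _ =>
  dsimp at hH; subst hH
  exact heq_of_eq (RAlg.midMap_str_congr (eq_of_heq hV) rfl rfl _ _)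

end LaxMor

namespace LaxTrans

open AWFS

variable {C D : Type u} [Category.{v} C] [Category.{v} D] {W : AWFS C} {W' : AWFS D}

/-- Transformations of lax morphisms are the same as horizontal transformations between the
induced double functors. -/
theorem dAlg_bijective (F G : LaxMor W W') :
    Function.Bijective (LaxTrans.dAlg.{v, u, w} (F := F) (G := G)) := by
  refine ⟨fun σ τ h => LaxTrans.ext (congrArg HorTrans.app h), fun s => ?_⟩
  let τ : F.functor ⟶ G.functor := s.app
  -- The component of `s` at the free algebra on `f` is a map of algebras. Read through `α_eq` and
  -- precomposed with the unit, this is the compatibility of `τ` with the comparison maps.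
  have key : ∀ {X Y : C} (f : X ⟶ Y), F.α f ≫ τ.app (W.F.mid f) =
      W'.F.midMap (τ.app X) (τ.app Y) (τ.naturality f).symm ≫ G.α f := by
    intro X Y f
    let β : RAlg.Sq (F.mapAlg (free.{v, u, w} W f)) (G.mapAlg (free.{v, u, w} W f)) :=
      s.sq (free.{v, u, w} W f)
    have ht : β.top = τ.app (W.F.mid f) := s.top_sq (free.{v, u, w} W f)
    have hb : β.bot = τ.app Y := s.bot_sq (free.{v, u, w} W f)
    have h := β.str
    simp only [ht, hb] at h
    rw [F.α_eq.{v, u, w} f, G.α_eq.{v, u, w} f, Category.assoc, h, W'.F.midMap_comp_assoc,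
      W'.F.midMap_comp_assoc]
    congr 1
    exact W'.F.midMap_congr (τ.naturality _)
      ((Category.id_comp _).trans (Category.comp_id _).symm)
  refine ⟨⟨τ, key⟩, HorTrans.ext' rfl fun g => ?_⟩
  exact RAlg.Sq.ext (s.top_sq g).symm (s.bot_sq g).symm

end LaxTrans

/-! ### Right-connected double categories -/

namespace DoubleCat

/-- Moves a square along equalities of its vertical sides while keeping its horizontal sides.
Pastings whose sides agree only through unit or associativity laws can then be used without casts.
-/
lemma exists_sq_of_eq {A : DoubleCat.{v, u, w}} {X Y X' Y' : A.Obj} {a b : A.Vert X Y}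
    {a' b' : A.Vert X' Y'} (α : A.Sq a a') (h : a = b) (h' : a' = b') :
    ∃ β : A.Sq b b', A.top β = A.top α ∧ A.bot β = A.bot α := by
  subst h h'; exact ⟨α, rfl, rfl⟩

namespace RightConnected

section

variable {A : DoubleCat.{v, u, w}} (hA : A.RightConnected)

/-- The horizontal arrow underlying a vertical arrow of a right-connected double category. -/
noncomputable def und {X Y : A.Obj} (a : A.Vert X Y) : X ⟶ Y := A.top (hA.unit a)

variable {X Y Z X' Y' : A.Obj}

/-- By right-connectedness any square into the vertical identity with identity bottom side is the
unit square. -/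
lemma top_eq_und {a : A.Vert X Y} (α : A.Sq a (A.vid Y)) (h : A.bot α = 𝟙 Y) :
    A.top α = hA.und a :=
  congrArg A.top ((hA a Y).1 (h.trans (hA.bot_unit a).symm))

lemma sq_w {a : A.Vert X Y} {b : A.Vert X' Y'} (α : A.Sq a b) :
    A.top α ≫ hA.und b = hA.und a ≫ A.bot α :=
  Arrow.w (hA.toArrow.map (X := ⟨a⟩) (Y := ⟨b⟩) α)

lemma und_vid (X : A.Obj) : hA.und (A.vid X) = 𝟙 X :=
  (hA.top_eq_und (A.hid (A.vid X)) (A.bot_hid _)).symm.trans (A.top_hid _)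

/-- The unit square of `a` pasted on top of the identity square of `b`. It supplies functoriality of
`und` under vertical composition, and the counit law of the comultiplication later on. -/
lemma exists_comp_sq (a : A.Vert X Y) (b : A.Vert Y Z) :
    ∃ α : A.Sq (A.vcomp a b) b, A.top α = hA.und a ∧ A.bot α = 𝟙 Z := by
  obtain ⟨α, ht, hb⟩ := exists_sq_of_eq
    (A.vcompSq (hA.unit a) (A.hid b) ((hA.bot_unit a).trans (A.top_hid b).symm)) rfl
    (A.vid_vcomp b)
  exact ⟨α, ht.trans (A.top_vcompSq _ _ _), hb.trans ((A.bot_vcompSq _ _ _).trans (A.bot_hid b))⟩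

lemma und_vcomp (a : A.Vert X Y) (b : A.Vert Y Z) :
    hA.und (A.vcomp a b) = hA.und a ≫ hA.und b := by
  obtain ⟨α, ht, hb⟩ := hA.exists_comp_sq a b
  have h := hA.sq_w α
  rw [ht, hb, Category.comp_id] at h
  exact h.symm

end

section

variable {A B : DoubleCat.{v, u, max v w}} (hA : A.RightConnected) (hB : B.RightConnected)

/-- The double functor from a right-connected double category to the double category of squares
in its category of objects and horizontal arrows. -/
noncomputable def toSqD : DoubleFunctor A (SqD.{v, u, w} A.Obj) where
  H := 𝟭 A.Obj
  V a := ⟨hA.und a⟩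
  S {_ _ _ _ a b} α := Arrow.homMk (f := Arrow.mk (hA.und a)) (g := Arrow.mk (hA.und b))
    (A.top α) (A.bot α) (hA.sq_w α)
  V_vid X := SqArrow.ext (hA.und_vid X)
  V_vcomp a b := SqArrow.ext (hA.und_vcomp a b)
  top_S _ := rfl
  bot_S _ := rfl
  S_hid a := Arrow.hom_ext _ _ (A.top_hid a) (A.bot_hid a)
  S_hcomp α β := Arrow.hom_ext _ _ (A.top_hcomp α β) (A.bot_hcomp α β)
  S_vidSq f := SqArrow.heq.{v, u, w} (SqArrow.ext (hA.und_vid _)) (SqArrow.ext (hA.und_vid _))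
    (A.top_vidSq f) (A.bot_vidSq f)
  S_vcompSq α β h := SqArrow.heq.{v, u, w} (SqArrow.ext (hA.und_vcomp _ _))
    (SqArrow.ext (hA.und_vcomp _ _)) (A.top_vcompSq α β h) (A.bot_vcompSq α β h)

include hA in
-- A double functor preserves vertical identities and identity bottom sides, hence sends unit
-- squares to unit squares.
lemma und_map (F : DoubleFunctor A B) {X Y : A.Obj} (a : A.Vert X Y) :
    hB.und (F.V a) = F.H.map (hA.und a) := by
  obtain ⟨α, ht, hb⟩ := exists_sq_of_eq (F.S (hA.unit a)) rfl (F.V_vid Y)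
  have k : B.bot α = 𝟙 (F.H.obj Y) := by
    rw [hb, F.bot_S, hA.bot_unit, F.H.map_id]
  rw [← hB.top_eq_und α k, ht, F.top_S]
  rfl

/-- Compatibility with the canonical double functors to squares is automatic for double functors
between right-connected double categories. This is why a specified `V` adds no information. -/
lemma comp_toSqD (F : DoubleFunctor A B) :
    F.comp hB.toSqD = hA.toSqD.comp (sqMap.{v, u, w} F.H) := by
  have e : ∀ {X Y : A.Obj} (a : A.Vert X Y),
      (F.comp hB.toSqD).V a = (hA.toSqD.comp (sqMap.{v, u, w} F.H)).V a :=
    fun a => SqArrow.ext (hA.und_map hB F a)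
  exact DoubleFunctor.ext' rfl (fun a => heq_of_eq (e a))
    fun α => SqArrow.heq.{v, u, w} (e _) (e _) (F.top_S α) (F.bot_S α)

end

end RightConnected

lemma rightConnected_sqD (C : Type u) [Category.{v} C] : (SqD.{v, u, w} C).RightConnected := by
  intro X Y a Z
  refine ⟨fun α β h => ?_, fun f => ?_⟩
  · have h₁ := Arrow.w α
    have h₂ := Arrow.w β
    refine Arrow.hom_ext _ _ ?_ h
    have e : α.right = β.right := h
    rw [e] at h₁
    have k := h₁.trans h₂.symm
    exact (Category.comp_id _).symm.trans (k.trans (Category.comp_id _))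
  · exact ⟨Arrow.homMk (f := Arrow.mk a.hom) (g := Arrow.mk (𝟙 Z)) (a.hom ≫ f) f
      (Category.comp_id _), rfl⟩

lemma toSqD_sqD (C : Type u) [Category.{v} C] :
    RightConnected.toSqD (rightConnected_sqD.{v, u, w} C) = DoubleFunctor.id (SqD.{v, u, w} C) := by
  have e : ∀ {X Y : C} (a : SqArrow.{v, u, w} C X Y),
      (RightConnected.toSqD (rightConnected_sqD.{v, u, w} C)).V a = a := fun {X Y} a => by
    refine SqArrow.ext ?_
    have h := RightConnected.top_eq_und (rightConnected_sqD.{v, u, w} C) (a := a)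
      (Arrow.homMk (f := Arrow.mk a.hom) (g := Arrow.mk (𝟙 Y)) a.hom (𝟙 Y) rfl) rfl
    exact h.symm
  exact DoubleFunctor.ext' rfl (fun a => heq_of_eq (e a))
    fun α => SqArrow.heq.{v, u, w} (e _) (e _) rfl rfl

/-- A double functor between double categories of squares is induced by a functor. -/
lemma eq_sqMap {C D : Type u} [Category.{v} C] [Category.{v} D]
    (F : DoubleFunctor (SqD.{v, u, w} C) (SqD.{v, u, w} D)) : F = sqMap.{v, u, w} F.H := by
  -- The double category of squares is right-connected, and its canonical double functor to squares
  -- is the identity.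
  have h := RightConnected.comp_toSqD (rightConnected_sqD.{v, u, w} C) (rightConnected_sqD.{v, u, w} D) F
  rw [toSqD_sqD, toSqD_sqD] at h
  exact h

/-! ### Hom-categories over the double categories of squares -/

namespace RightConnected

variable {A B : DoubleCat.{v, u, max v w}} (hA : A.RightConnected) (hB : B.RightConnected)

/-- A right-connected double category over its double category of squares, as an object of the
arrow 2-category. -/
noncomputable def arrowTwo : ArrowTwo DoubleCat.{v, u, max v w} where
  src := A
  tgt := SqD.{v, u, w} A.Obj
  arr := hA.toSqD

/-- The vertical sides of the commuting square of double functors act as the identity on horizontal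
arrows, so top and bottom have the same functor there, and a double functor between double
categories of squares is determined by that functor. -/
lemma bot_eq_sqMap (f : hA.arrowTwo ⟶ hB.arrowTwo) : f.bot = sqMap.{v, u, w} f.top.H := by
  have h : f.top.H = f.bot.H := congrArg DoubleFunctor.H f.comm
  refine (eq_sqMap f.bot).trans ?_
  exact congrArg (fun t : A.Obj ⥤ B.Obj => sqMap.{v, u, w} t) h.symm

/-- Squares between right-connected double categories over their double categories of squares are
determined by double functors. -/
lemma top_bijective :
    Function.Bijective (fun f : hA.arrowTwo ⟶ hB.arrowTwo => f.top) := by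
  refine ⟨fun f g h => ArrowTwo.Hom.ext h ?_, fun F => ⟨⟨F, sqMap.{v, u, w} F.H,
    hA.comp_toSqD hB F⟩, rfl⟩⟩
  rw [hA.bot_eq_sqMap hB, hA.bot_eq_sqMap hB]
  exact congrArg (fun t : A ⟶ B => sqMap.{v, u, w} t.H) h

/-- The whiskering condition, read on objects, says that the bottom 2-cell has the same components
as the top one. Components on objects suffice below because the double category of squares is flat,
and any natural transformation induces a 2-cell there. -/
lemma top₂_bijective (f g : hA.arrowTwo ⟶ hB.arrowTwo) :
    Function.Bijective (fun η : f ⟶ g => η.top) := by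
  obtain ⟨F, F', hF⟩ := f
  obtain ⟨G, G', hG⟩ := g
  obtain rfl : F' = sqMap.{v, u, w} F.H := hA.bot_eq_sqMap hB ⟨F, F', hF⟩
  obtain rfl : G' = sqMap.{v, u, w} G.H := hA.bot_eq_sqMap hB ⟨G, G', hG⟩
  -- The two composites have the same underlying functor definitionally, so these `eqToHom`s have
  -- identity components.
  have e₁ : ∀ X, (eqToHom hF).app.app X = 𝟙 _ := fun X => by
    rw [eqToHom_app hF]; rfl
  have e₂ : ∀ X, (eqToHom hG).app.app X = 𝟙 _ := fun X => by
    rw [eqToHom_app hG]; rfl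
  constructor
  · have key : ∀ η : ArrowTwo.Hom₂ (X := hA.arrowTwo) (Y := hB.arrowTwo)
        ⟨F, sqMap.{v, u, w} F.H, hF⟩ ⟨G, sqMap.{v, u, w} G.H, hG⟩, ∀ X, η.bot.app.app X = η.top.app.app X := fun η X => by
      have h := congrArg (fun t => t.app.app X) η.comm
      change η.top.app.app X ≫ (eqToHom hG).app.app X =
        (eqToHom hF).app.app X ≫ η.bot.app.app X at h
      have h' := (congrArg (η.top.app.app X ≫ ·) (e₂ X)).symm.trans
        (h.trans (congrArg (· ≫ η.bot.app.app X) (e₁ X)))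
      exact ((Category.id_comp _).symm.trans h'.symm).trans (Category.comp_id _)
    intro η θ h
    refine ArrowTwo.hom₂_ext h (hom₂_ext_of_flat (flat_sqD B.Obj) fun X => ?_)
    refine (key η X).trans (Eq.trans ?_ (key θ X).symm)
    exact congrArg (fun t : F ⟶ G => t.app.app X) h
  · intro t
    refine ⟨⟨t, sqMap₂.{v, u, w} t.app, ?_⟩, rfl⟩
    refine hom₂_ext_of_flat (flat_sqD B.Obj) fun X => ?_
    change t.app.app X ≫ (eqToHom hG).app.app X = (eqToHom hF).app.app X ≫ t.app.app X
    refine (congrArg (t.app.app X ≫ ·) (e₂ X)).trans (Eq.trans ?_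
      (congrArg (· ≫ t.app.app X) (e₁ X)).symm)
    exact (Category.comp_id _).trans (Category.id_comp _).symm

end RightConnected

end DoubleCat

namespace ConcreteDouble

/-- The double category underlying a right-connected concrete double category is
right-connected, and its double functor to squares is the canonical one. -/
lemma exists_rightConnected (A : ConcreteDouble.{v, u, w}) (h : A.RightConnected) :
    ∃ hA : A.dbl.RightConnected, A.V = hA.toSqD := by
  -- Destructuring `V` makes its horizontal functor a variable, so that it can be replaced by the
  -- identity functor.
  obtain ⟨A, ⟨H, V, S, V_vid, V_vcomp, top_S, bot_S, S_hid, S_hcomp, S_vidSq, S_vcompSq⟩, h₀, h₁⟩ := A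
  dsimp only at h₀
  subst h₀
  have top_S' : ∀ {X Y X' Y' : A.Obj} {a : A.Vert X Y} {a' : A.Vert X' Y'} (α : A.Sq a a'),
    Arrow.Hom.left (S α) = A.top α := top_S
  have bot_S' : ∀ {X Y X' Y' : A.Obj} {a : A.Vert X Y} {a' : A.Vert X' Y'} (α : A.Sq a a'),
    Arrow.Hom.right (S α) = A.bot α := bot_S
  -- Faithfulness of `V₁`: a square is determined by its top and bottom sides.
  have flat : ∀ {X Y X' Y' : A.Obj} {a : A.Vert X Y} {a' : A.Vert X' Y'} (α β : A.Sq a a'),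
      A.top α = A.top β → A.bot α = A.bot β → α = β := by
    intro X Y X' Y' a a' α β ht hb
    refine h₁.map_injective (X := ⟨a⟩) (Y := ⟨a'⟩) (Arrow.hom_ext _ _ ?_ ?_)
    · exact (top_S' α).trans (ht.trans (top_S' β).symm)
    · exact (bot_S' α).trans (hb.trans (bot_S' β).symm)
  -- A square into a vertical identity has its top side determined by its bottom side; with flatness
  -- this is the injectivity half of right-connectedness.
  have key : ∀ {X Y Z : A.Obj} {a : A.Vert X Y} (α : A.Sq a (A.vid Z)),
      A.top α = (V a).hom ≫ A.bot α := by
    intro X Y Z a α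
    have k := Arrow.w (show Arrow.mk (V a).hom ⟶ Arrow.mk (V (A.vid Z)).hom from S α)
    change Arrow.Hom.left (S α) ≫ (V (A.vid Z)).hom = (V a).hom ≫ Arrow.Hom.right (S α) at k
    rw [top_S', bot_S', V_vid] at k
    exact (Category.comp_id _).symm.trans k
  have hA : A.RightConnected := by
    intro X Y a Z
    refine ⟨fun α β e => flat α β ?_ e, fun f => ?_⟩
    · rw [key α, key β]
      exact congrArg ((V a).hom ≫ ·) e
    -- Surjectivity: the square provided by the hypothesis, followed horizontally by the vertical
    -- identity square on `f`.
    · obtain ⟨α, -, hb⟩ := h a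
      refine ⟨A.hcomp α (A.vidSq f), ?_⟩
      change A.bot _ = f
      rw [A.bot_hcomp, A.bot_vidSq, hb]
      exact Category.id_comp f
  -- The square provided by the hypothesis has identity bottom side, so it is the unit square; its
  -- top side gives both underlying arrows.
  have e : ∀ {X Y : A.Obj} (a : A.Vert X Y), V a = hA.toSqD.V a := by
    intro X Y a
    obtain ⟨α, ht, hb⟩ := h a
    refine SqArrow.ext ?_
    exact ht.symm.trans (hA.top_eq_und α hb)
  exact ⟨hA, DoubleFunctor.ext' rfl (fun a => heq_of_eq (e a))
    fun α => SqArrow.heq.{v, u, w} (e _) (e _) (top_S' α) (bot_S' α)⟩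

end ConcreteDouble

/-! ### Strict monadicity of the category of algebras -/

namespace AWFS

variable {C : Type u} [Category.{v} C] (W : AWFS C)

lemma rightConnected_dAlg : (DAlg.{v, u, w} W).RightConnected := by
  intro X Y a Z
  refine ⟨fun α β h => ?_, fun f => ?_⟩
  · refine DoubleCat.flat_dAlg W α β ?_ h
    have h₁ : α.top ≫ 𝟙 Z = a.hom ≫ α.bot := α.comm
    have h₂ : β.top ≫ 𝟙 Z = a.hom ≫ β.bot := β.comm
    have e : α.bot = β.bot := h
    rw [e] at h₁
    exact (Category.comp_id _).symm.trans ((h₁.trans h₂.symm).trans (Category.comp_id _))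
  · exact ⟨(RAlg.toId a).hcomp (RAlg.Sq.vid.{v, u, w} f), Category.id_comp f⟩

/-- `RAlg.toId` is the unit square of an algebra, and its top side is the underlying arrow. So the
forgetful double functor is recovered from the double category alone. -/
lemma forget_eq_toSqD : forget.{v, u, w} W = DoubleCat.RightConnected.toSqD (rightConnected_dAlg.{v, u, w} W) := by
  have e : ∀ {X Y : C} (a : RAlg.{v, u, w} W X Y),
      (forget.{v, u, w} W).V a = (DoubleCat.RightConnected.toSqD (rightConnected_dAlg.{v, u, w} W)).V a := fun a =>
    SqArrow.ext (DoubleCat.RightConnected.top_eq_und (rightConnected_dAlg.{v, u, w} W) (a := a) (RAlg.toId a) rfl)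
  exact DoubleFunctor.ext' rfl (fun a => heq_of_eq (e a))
    fun α => SqArrow.heq.{v, u, w} (e _) (e _) rfl rfl

/-- The functor sending an algebra to its underlying arrow. -/
abbrev forgetOne : (DAlg.{v, u, w} W).One ⥤ Arrow C :=
  DoubleFunctor.toArrow.{v, u, w} (forget.{v, u, w} W)

/-- The free algebra functor. -/
def freeOne : Arrow C ⥤ (DAlg.{v, u, w} W).One where
  obj f := ⟨free.{v, u, w} W f.hom⟩
  map φ := freeMap.{v, u, w} W φ.left φ.right (Arrow.w φ)
  map_id f := RAlg.Sq.ext (W.F.midMap_id f.hom) rfl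
  map_comp φ ψ := RAlg.Sq.ext (W.F.midMap_comp φ.left φ.right (Arrow.w φ) ψ.left ψ.right
    (Arrow.w ψ)).symm rfl

/-- Free algebras are left adjoint to underlying arrows. -/
def freeAdj : freeOne.{v, u, w} W ⊣ forgetOne.{v, u, w} W :=
  Adjunction.mkOfUnitCounit
    { unit :=
        { app := fun f => W.F.η.app f
          naturality := fun _ _ φ => W.F.η.naturality φ }
      counit :=
        { app := fun a => RAlg.counit a.vert
          naturality := fun a b α => RAlg.Sq.ext (RAlg.Sq.str α).symm
            ((Category.comp_id _).trans (Category.id_comp _).symm) }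
      left_triangle := by
        ext f
        refine RAlg.Sq.ext ?_ ?_
        · refine Eq.trans ?_ (W.midMap_left_m f.hom)
          exact congrArg (_ ≫ ·) (Category.id_comp _)
        · exact (congrArg (_ ≫ ·) (Category.id_comp _)).trans (Category.id_comp _)
      right_triangle := by
        ext a
        · refine Eq.trans ?_ a.vert.unit
          exact congrArg (_ ≫ ·) (Category.id_comp _)
        · exact (congrArg (_ ≫ ·) (Category.id_comp _)).trans (Category.id_comp _) }

/-- The algebra given by an algebra for the monad of the free-forgetful adjunction. -/
def ofAlgebra (T : (freeAdj.{v, u, w} W).toMonad.Algebra) :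
    RAlg.{v, u, w} W T.A.left T.A.right :=
  -- The unit of the monad has identity codomain component, so the unit law forces the codomain
  -- component of any algebra structure to be an identity.
  have hr : T.a.right = 𝟙 T.A.right :=
    (Category.id_comp _).symm.trans (congrArg (fun t => t.right) T.unit)
  { hom := T.A.hom
    str := T.a.left
    str_hom := (Arrow.w T.a).trans ((congrArg (_ ≫ ·) hr).trans (Category.comp_id _))
    unit := congrArg (fun t => t.left) T.unit
    assoc := (congrArg (fun t => t.left) T.assoc).trans
      (congrArg (fun t => W.F.E.map t ≫ T.a.left)
        (Arrow.hom_ext _ _ rfl hr : T.a = Arrow.homMk (f := Arrow.mk (W.F.right T.A.hom))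
          (g := T.A) T.a.left (𝟙 _) _)) }

/-- The map of algebras given by a map of algebras for the monad of the free-forgetful
adjunction. -/
def ofAlgebraHom {S T : (freeAdj.{v, u, w} W).toMonad.Algebra} (φ : S ⟶ T) :
    RAlg.Sq (ofAlgebra.{v, u, w} W S) (ofAlgebra.{v, u, w} W T) where
  top := φ.f.left
  bot := φ.f.right
  comm := Arrow.w φ.f
  str := (congrArg (fun t => t.left) φ.h).symm

/-- The inverse of the comparison functor. -/
def comparisonInv : (freeAdj.{v, u, w} W).toMonad.Algebra ⥤ (DAlg.{v, u, w} W).One where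
  obj T := ⟨ofAlgebra.{v, u, w} W T⟩
  map φ := ofAlgebraHom.{v, u, w} W φ
  map_id _ := rfl
  map_comp _ _ := rfl

/-- The two structure maps share their domain component, and both have identity codomain component:
by construction on one side and by the unit law on the other. -/
lemma comparison_ofAlgebra (T : (freeAdj.{v, u, w} W).toMonad.Algebra) :
    (Monad.comparison (freeAdj.{v, u, w} W)).obj ⟨ofAlgebra.{v, u, w} W T⟩ = T := by
  have hr : T.a.right = 𝟙 T.A.right :=
    (Category.id_comp _).symm.trans (congrArg (fun t => t.right) T.unit)
  obtain ⟨A, a, h, h'⟩ := T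
  have key : ∀ (a' : (freeAdj.{v, u, w} W).toMonad.obj A ⟶ A) (e : a' = a) (q q'),
      (⟨A, a', q, q'⟩ : (freeAdj.{v, u, w} W).toMonad.Algebra) = ⟨A, a, h, h'⟩ := by
    rintro _ rfl q q'; rfl
  refine key ((forgetOne.{v, u, w} W).map (X := ⟨free.{v, u, w} W A.hom⟩)
    (Y := ⟨ofAlgebra.{v, u, w} W ⟨A, a, h, h'⟩⟩)
    (RAlg.counit (ofAlgebra.{v, u, w} W ⟨A, a, h, h'⟩))) ?_ _ _
  exact Arrow.hom_ext _ _ rfl hr.symm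

lemma algebra_hom_heq {A : Type*} [Category* A] {T : Monad A} {S S' R R' : T.Algebra}
    (h : S = S') (h' : R = R') {φ : S ⟶ R} {ψ : S' ⟶ R'} (e : φ.f ≍ ψ.f) : φ ≍ ψ := by
  subst h h'; exact heq_of_eq (Monad.Algebra.Hom.ext (eq_of_heq e))

/-- The functor sending an algebra to its underlying arrow is strictly monadic. -/
theorem isStrictlyMonadic_forgetOne : IsStrictlyMonadic (forgetOne.{v, u, w} W) :=
  ⟨freeOne.{v, u, w} W, freeAdj.{v, u, w} W, comparisonInv.{v, u, w} W, rfl,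
    CategoryTheory.Functor.hext (fun T => comparison_ofAlgebra.{v, u, w} W T) fun S T _ =>
      algebra_hom_heq (comparison_ofAlgebra.{v, u, w} W S) (comparison_ofAlgebra.{v, u, w} W T)
        HEq.rfl⟩

/-- The forgetful double functor of an algebraic weak factorisation system as a concrete double
category. -/
def concrete : ConcreteDouble.{v, u, w} where
  dbl := DAlg.{v, u, w} W
  V := forget.{v, u, w} W
  V_zero := rfl
  V_one := ⟨fun {_ _} _ _ h => RAlg.Sq.ext (congrArg (fun t => t.left) h)
    (congrArg (fun t => t.right) h)⟩

lemma concrete_monadicRightConnected : (concrete.{v, u, w} W).MonadicRightConnected :=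
  ⟨isStrictlyMonadic_forgetOne.{v, u, w} W, fun a => ⟨RAlg.toId a, rfl, rfl⟩⟩

end AWFS

namespace ConcreteDouble

/-- The double category underlying a monadic right-connected concrete double category is monadic
right-connected. -/
lemma MonadicRightConnected.dbl {A : ConcreteDouble.{v, u, w}} (h : A.MonadicRightConnected) :
    A.dbl.MonadicRightConnected := by
  obtain ⟨hA, hV⟩ := A.exists_rightConnected h.2
  refine ⟨hA, ?_⟩
  have := h.1
  rw [hV] at this
  exact this

end ConcreteDouble

/-! ### Strictly monadic functors -/

namespace IsStrictlyMonadic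

variable {A : Type*} [Category* A] {B : Type*} [Category* B] {U : A ⥤ B}

/-- An arrow `l : g ⟶ U F` exhibits `F` as free on `g`. -/
def IsFree (U : A ⥤ B) {g : B} {F : A} (l : g ⟶ U.obj F) : Prop :=
  ∀ {b : A} (x : g ⟶ U.obj b), ∃! y : F ⟶ b, l ≫ U.map y = x

/-- `U` is the comparison functor, an equivalence, followed by the forgetful functor from algebras,
which is faithful. -/
lemma faithful (hU : IsStrictlyMonadic U) : U.Faithful := by
  obtain ⟨L, adj, K, h₁, h₂⟩ := hU
  have : (Monad.comparison adj).IsEquivalence :=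
    .mk' K (eqToIso h₁.symm) (eqToIso h₂)
  exact inferInstanceAs (Monad.comparison adj ⋙ adj.toMonad.forget).Faithful

lemma exists_isFree (hU : IsStrictlyMonadic U) (g : B) :
    ∃ (F : A) (l : g ⟶ U.obj F), IsFree U l := by
  obtain ⟨L, adj, K, h₁, h₂⟩ := hU
  refine ⟨L.obj g, adj.unit.app g, fun {b} x => ⟨(adj.homEquiv _ _).symm x, ?_, fun y hy => ?_⟩⟩
  · exact (adj.homEquiv_unit _ _ _).symm.trans ((adj.homEquiv _ _).apply_symm_apply x)
  · rw [Equiv.eq_symm_apply, adj.homEquiv_unit, hy]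

/-- Strictly monadic functors lift isomorphisms. -/
lemma exists_lift_iso (hU : IsStrictlyMonadic U) {a : A} {g : B} (φ : U.obj a ≅ g) :
    ∃ (b : A) (hb : U.obj b = g) (ψ : a ≅ b), U.map ψ.hom ≫ eqToHom hb = φ.hom := by
  obtain ⟨L, adj, K, h₁, h₂⟩ := hU
  have : (Monad.comparison adj).IsEquivalence :=
    .mk' K (eqToIso h₁.symm) (eqToIso h₂)
  have surj : ∀ S : adj.toMonad.Algebra, ∃ b, (Monad.comparison adj).obj b = S := fun S =>
    ⟨K.obj S, congrArg (fun G => G.obj S) h₂⟩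
  -- The structure of `a` transported along `φ` is an algebra structure on `g`; `hu` is its unit
  -- law, and `ha` becomes its associativity law after applying `U` and composing with `φ.hom`.
  have hu : adj.unit.app g ≫ U.map (L.map φ.inv) ≫ U.map (adj.counit.app a) ≫ φ.hom = 𝟙 g := by
    have h : adj.unit.app g ≫ U.map (L.map φ.inv) = φ.inv ≫ adj.unit.app (U.obj a) :=
      (adj.unit.naturality φ.inv).symm
    rw [← Category.assoc, h, Category.assoc, ← Category.assoc (adj.unit.app _),
      adj.right_triangle_components]
    simp
  have ha : adj.counit.app (L.obj g) ≫ L.map φ.inv ≫ adj.counit.app a =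
      L.map (U.map (L.map φ.inv) ≫ U.map (adj.counit.app a) ≫ φ.hom) ≫ L.map φ.inv ≫
        adj.counit.app a := by
    have h : L.map (U.map (L.map φ.inv)) ≫ adj.counit.app (L.obj (U.obj a)) =
      adj.counit.app (L.obj g) ≫ L.map φ.inv := adj.counit.naturality (L.map φ.inv)
    have h' : L.map (U.map (adj.counit.app a)) ≫ adj.counit.app a =
      adj.counit.app (L.obj (U.obj a)) ≫ adj.counit.app a :=
        adj.counit.naturality (adj.counit.app a)
    rw [← Category.assoc, ← h, Category.assoc, ← h', ← Category.assoc (L.map _) (L.map φ.inv),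
      ← L.map_comp (_ ≫ _), Category.assoc, Category.assoc, φ.hom_inv_id]
    simp
  let S : adj.toMonad.Algebra :=
    { A := g
      a := U.map (L.map φ.inv) ≫ U.map (adj.counit.app a) ≫ φ.hom
      unit := hu
      assoc := by
        have k := congrArg (fun t => U.map t ≫ φ.hom) ha
        simp only [U.map_comp, Category.assoc] at k
        exact k }
  -- Since the comparison functor is surjective on objects, `S` may be taken to be a value of it.
  -- This makes the underlying equality reflexive, and full faithfulness lifts `θ`.
  have key : ∀ (S : adj.toMonad.Algebra) (θ : (Monad.comparison adj).obj a ≅ S),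
      ∃ (b : A) (hb : U.obj b = S.A) (ψ : a ≅ b), U.map ψ.hom ≫ eqToHom hb = θ.hom.f := by
    intro S θ
    obtain ⟨b, rfl⟩ := surj S
    refine ⟨b, rfl, (Monad.comparison adj).preimageIso θ, ?_⟩
    refine (Category.comp_id _).trans ?_
    exact congrArg (fun t => t.f) ((Monad.comparison adj).map_preimage θ.hom)
  exact key S (Monad.Algebra.isoMk φ (by
    change U.map (L.map φ.hom) ≫ U.map (L.map φ.inv) ≫ U.map (adj.counit.app a) ≫ φ.hom =
      U.map (adj.counit.app a) ≫ φ.hom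
    rw [← Category.assoc, ← U.map_comp, ← L.map_comp, φ.hom_inv_id]
    simp))

/-- Strictly monadic functors create algebras: a retraction `p` of the unit at `g` that
coequalises its image under the free algebra functor and the multiplication is the image of an
arrow out of the free algebra. -/
lemma exists_lift_algebra (hU : IsStrictlyMonadic U) {g : B} {F F' : A} {l : g ⟶ U.obj F}
    {l' : U.obj F ⟶ U.obj F'} (hl : IsFree U l) (p : U.obj F ⟶ g)
    (m r : F' ⟶ F) (hp : l ≫ p = 𝟙 g) (hm : l' ≫ U.map m = 𝟙 _) (hr : l' ≫ U.map r = p ≫ l)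
    (e : U.map m ≫ p = U.map r ≫ p) :
    ∃ (b : A) (hb : U.obj b = g) (q : F ⟶ b), U.map q ≫ eqToHom hb = p := by
  obtain ⟨L, adj, K, h₁, h₂⟩ := hU
  have surj : ∀ S : adj.toMonad.Algebra, ∃ b, (Monad.comparison adj).obj b = S := fun S =>
    ⟨K.obj S, congrArg (fun G => G.obj S) h₂⟩
  -- The arrows `l` and `l'` are transposed so that the data on `F` and `F'` can be compared with
  -- the left adjoint `L`. The identities `e₁` and `e₂` then turn the hypothesis `e` into the
  -- associativity law for the structure `U.map θ ≫ p` on `g`.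
  let θ : L.obj g ⟶ F := (adj.homEquiv _ _).symm l
  have hθ : adj.unit.app g ≫ U.map θ = l :=
    (adj.homEquiv_unit _ _ _).symm.trans ((adj.homEquiv _ _).apply_symm_apply l)
  let θ' : L.obj (U.obj F) ⟶ F' := (adj.homEquiv _ _).symm l'
  have hθ' : adj.unit.app (U.obj F) ≫ U.map θ' = l' :=
    (adj.homEquiv_unit _ _ _).symm.trans ((adj.homEquiv _ _).apply_symm_apply l')
  have ext : ∀ {x : B} {y : A} (s t : L.obj x ⟶ y),
      adj.unit.app x ≫ U.map s = adj.unit.app x ≫ U.map t → s = t := fun s t h => by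
    apply (adj.homEquiv _ _).injective
    rw [adj.homEquiv_unit, adj.homEquiv_unit, h]
  have nat : ∀ {x y : B} (s : x ⟶ y), adj.unit.app x ≫ U.map (L.map s) = s ≫ adj.unit.app y :=
    fun s => (adj.unit.naturality s).symm
  have e₁ : L.map p ≫ θ = θ' ≫ r := ext _ _ (by
    rw [U.map_comp, U.map_comp, ← Category.assoc, nat, Category.assoc, hθ, ← Category.assoc,
      hθ', hr])
  have e₂ : L.map (U.map θ) ≫ θ' ≫ m = adj.counit.app (L.obj g) ≫ θ := ext _ _ (by
    simp only [U.map_comp]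
    rw [← Category.assoc, nat, Category.assoc, ← Category.assoc (adj.unit.app _), hθ', hm,
      ← Category.assoc, adj.right_triangle_components]
    exact (Category.comp_id _).trans (Category.id_comp _).symm)
  let S : adj.toMonad.Algebra :=
    { A := g
      a := U.map θ ≫ p
      unit := by
        change adj.unit.app g ≫ U.map θ ≫ p = _
        rw [← Category.assoc, hθ, hp]
      assoc := by
        change U.map (adj.counit.app (L.obj g)) ≫ U.map θ ≫ p =
          U.map (L.map (U.map θ ≫ p)) ≫ U.map θ ≫ p
        rw [← Category.assoc, ← U.map_comp, ← e₂, ← Category.assoc (U.map (L.map _)),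
          ← U.map_comp, L.map_comp, Category.assoc, e₁]
        simp only [U.map_comp, Category.assoc, e] }
  -- Freeness of `F` extends the unit of the adjunction along `l`. The composite `θi ≫ θ` fixes `l`
  -- and so is the identity. Only this one-sided inverse is needed: composing `θi` with the counit
  -- at the lifted algebra gives an arrow over `p`.
  obtain ⟨θi, hθi, -⟩ := hl (adj.unit.app g)
  have hi : θi ≫ θ = 𝟙 F := (hl l).unique (by
    rw [U.map_comp, ← Category.assoc, hθi, hθ]) (by rw [U.map_id, Category.comp_id])
  have key : ∀ (S : adj.toMonad.Algebra) (t : L.obj S.A ⟶ F) (p : U.obj F ⟶ S.A)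
      (_ : S.a = U.map t ≫ p) (ti : F ⟶ L.obj S.A) (_ : ti ≫ t = 𝟙 F),
      ∃ (b : A) (hb : U.obj b = S.A) (q : F ⟶ b), U.map q ≫ eqToHom hb = p := by
    intro S t p hp ti hti
    obtain ⟨b, rfl⟩ := surj S
    refine ⟨b, rfl, ti ≫ adj.counit.app b, ?_⟩
    refine (Category.comp_id _).trans ?_
    have hp' : U.map (adj.counit.app b) = U.map t ≫ p := hp
    refine (U.map_comp _ _).trans ((congrArg (U.map ti ≫ ·) hp').trans ?_)
    refine (Category.assoc _ _ _).symm.trans ((congrArg (· ≫ p) ((U.map_comp _ _).symm.trans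
      ((congrArg U.map hti).trans (U.map_id F)))).trans (Category.id_comp _))
  exact key S θ p rfl θi hi

/-- A map between the underlying objects of two algebras that is compatible with the structure
maps is the image of a map of algebras. -/
lemma exists_lift_hom (hU : IsStrictlyMonadic U) {F b b' : A} {l : U.obj b ⟶ U.obj F}
    (q : F ⟶ b) (hq : l ≫ U.map q = 𝟙 _) (r : F ⟶ b')
    (h : U.obj b ⟶ U.obj b') (hr : U.map r = U.map q ≫ h) :
    ∃ α : b ⟶ b', U.map α = h := by
  obtain ⟨L, adj, K, h₁, h₂⟩ := hU
  have : (Monad.comparison adj).IsEquivalence :=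
    .mk' K (eqToIso h₁.symm) (eqToIso h₂)
  have ext : ∀ {x : B} {y : A} (s t : L.obj x ⟶ y),
      adj.unit.app x ≫ U.map s = adj.unit.app x ≫ U.map t → s = t := fun s t h => by
    apply (adj.homEquiv _ _).injective
    rw [adj.homEquiv_unit, adj.homEquiv_unit, h]
  -- Through the transpose of `l`, the counit at `b` factors as `θ ≫ q`. Hence compatibility of `h`
  -- with `q` and `r` becomes compatibility with the structure maps of the two algebras.
  let θ : L.obj (U.obj b) ⟶ F := (adj.homEquiv _ _).symm l
  have hθ : adj.unit.app (U.obj b) ≫ U.map θ = l :=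
    (adj.homEquiv_unit _ _ _).symm.trans ((adj.homEquiv _ _).apply_symm_apply l)
  have e₁ : θ ≫ q = adj.counit.app b := ext _ _ (by
    rw [U.map_comp, ← Category.assoc, hθ, hq, adj.right_triangle_components])
  have e₂ : L.map h ≫ adj.counit.app b' = θ ≫ r := ext _ _ (by
    rw [U.map_comp, U.map_comp, ← Category.assoc, ← Category.assoc, hθ, hr, ← Category.assoc, hq]
    have n : adj.unit.app (U.obj b) ≫ U.map (L.map h) = h ≫ adj.unit.app (U.obj b') :=
      (adj.unit.naturality h).symm
    rw [n, Category.assoc, adj.right_triangle_components]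
    exact (Category.comp_id _).trans (Category.id_comp _).symm)
  let φ : (Monad.comparison adj).obj b ⟶ (Monad.comparison adj).obj b' :=
    { f := h
      h := by
        change U.map (L.map h) ≫ U.map (adj.counit.app b') = U.map (adj.counit.app b) ≫ h
        rw [← U.map_comp, e₂, ← e₁, U.map_comp, U.map_comp, hr, Category.assoc] }
  exact ⟨(Monad.comparison adj).preimage φ,
    congrArg (fun t => t.f) ((Monad.comparison adj).map_preimage φ)⟩

/-- Objects with isomorphic images under an identity are equal. -/
lemma eq_of_hom (hU : IsStrictlyMonadic U) {b b' : A} (h : U.obj b = U.obj b') (α : b ⟶ b')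
    (hα : U.map α = eqToHom h) : b = b' := by
  obtain ⟨L, adj, K, h₁, h₂⟩ := hU
  -- The comparison functor has a strict inverse and so is injective on objects. It remains to see
  -- that the two algebras have the same structure, which is what an arrow lying over an identity
  -- says.
  have inj : ∀ {x y : A}, (Monad.comparison adj).obj x = (Monad.comparison adj).obj y → x = y :=
    fun {x y} e => by
      have := congrArg K.obj e
      rwa [← Functor.comp_obj, ← Functor.comp_obj, h₁] at this
  apply inj
  have nat : U.map (L.map (U.map α)) ≫ U.map (adj.counit.app b') =
      U.map (adj.counit.app b) ≫ U.map α := by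
    rw [← U.map_comp, ← U.map_comp]
    exact congrArg U.map (adj.counit.naturality α)
  have key : ∀ {S T : adj.toMonad.Algebra} (e : S.A = T.A)
      (_ : adj.toMonad.map (eqToHom e) ≫ T.a = S.a ≫ eqToHom e), S = T := by
    rintro ⟨S, s, _, _⟩ ⟨T, t, _, _⟩ e k
    dsimp only at e
    subst e
    have k' : t = s := by
      have k₁ : U.map (L.map (𝟙 S)) ≫ t = s ≫ 𝟙 S := k
      rw [L.map_id, U.map_id] at k₁
      exact (Category.id_comp _).symm.trans (k₁.trans (Category.comp_id _))
    subst k'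
    rfl
  refine key (S := (Monad.comparison adj).obj b) (T := (Monad.comparison adj).obj b') h ?_
  change U.map (L.map (eqToHom h)) ≫ U.map (adj.counit.app b') =
    U.map (adj.counit.app b) ≫ eqToHom h
  rw [← hα]
  exact nat

end IsStrictlyMonadic

/-! ### Free vertical arrows -/

namespace DoubleCat

open RightConnected

/-- A vertical arrow of a right-connected double category that is free on the arrow `f`, with
codomain the codomain of `f`. -/
structure FreeVert {A : DoubleCat.{v, u, w}} (hA : A.RightConnected) {X Y : A.Obj} (f : X ⟶ Y) where
  mid : A.Obj
  left : X ⟶ mid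
  vert : A.Vert mid Y
  fac : left ≫ hA.und vert = f
  exists_lift {X' Y' : A.Obj} (b : A.Vert X' Y') (s : X ⟶ X') (t : Y ⟶ Y')
    (h : s ≫ hA.und b = f ≫ t) : ∃ α : A.Sq vert b, left ≫ A.top α = s ∧ A.bot α = t
  ext {X' Y' : A.Obj} {b : A.Vert X' Y'} {α β : A.Sq vert b}
    (ht : left ≫ A.top α = left ≫ A.top β) (hb : A.bot α = A.bot β) : α = β

namespace FreeVert

variable {A : DoubleCat.{v, u, w}} {hA : A.RightConnected} {X Y : A.Obj} {f : X ⟶ Y}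

/-- The unit has an identity as its codomain component, so the lifting property stated with explicit
sides is freeness with respect to the functor to the arrow category. -/
lemma isFree (F : FreeVert hA f) :
    IsStrictlyMonadic.IsFree hA.toArrow (g := Arrow.mk f) (F := ⟨F.vert⟩)
      (Arrow.homMk (f := Arrow.mk f) (g := Arrow.mk (hA.und F.vert)) F.left (𝟙 Y)
        (F.fac.trans (Category.comp_id f).symm)) := by
  intro b x
  obtain ⟨α, ht, hb⟩ := F.exists_lift b.vert x.left x.right (Arrow.w x)
  refine ⟨α, Arrow.hom_ext _ _ ht ((Category.id_comp _).trans hb), fun β hβ => ?_⟩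
  refine F.ext ?_ ?_
  · exact (congrArg (fun t => t.left) hβ).trans ht.symm
  · exact ((Category.id_comp _).symm.trans (congrArg (fun t => t.right) hβ)).trans hb.symm

end FreeVert

/-- Strict monadicity produces objects of the category of vertical arrows whose underlying arrow
equals a given one. Eliminating that equality yields a vertical arrow with exactly the prescribed
endpoints, together with the mediating squares in both directions. -/
lemma exists_vert_of_obj_eq {A : DoubleCat.{v, u, w}} (hA : A.RightConnected) {a b : A.One}
    {g : Arrow A.Obj} (hb : hA.toArrow.obj b = g) (ψ : a ⟶ b) (ψ' : b ⟶ a) :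
    ∃ c : A.Vert g.left g.right, hA.und c = g.hom ∧ ∃ (α : A.Sq a.vert c) (β : A.Sq c a.vert),
      A.top α = (hA.toArrow.map ψ ≫ eqToHom hb).left ∧
      A.bot α = (hA.toArrow.map ψ ≫ eqToHom hb).right ∧
      A.top β = (eqToHom hb.symm ≫ hA.toArrow.map ψ').left ∧
      A.bot β = (eqToHom hb.symm ≫ hA.toArrow.map ψ').right := by
  subst hb
  refine ⟨b.vert, rfl, ψ, ψ', ?_, ?_, ?_, ?_⟩
  · exact (Category.comp_id _).symm
  · exact (Category.comp_id _).symm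
  · exact (Category.id_comp _).symm
  · exact (Category.id_comp _).symm

lemma map_inv_eq_inv {A : Type*} [Category* A] {B : Type*} [Category* B] {U : A ⥤ B} {a b : A}
    {g : B} (ψ : a ≅ b) (φ : U.obj a ≅ g) (h : U.obj b = g)
    (e : U.map ψ.hom ≫ eqToHom h = φ.hom) : eqToHom h.symm ≫ U.map ψ.inv = φ.inv := by
  subst h
  have e' : U.mapIso ψ = φ := Iso.ext ((Category.comp_id _).symm.trans e)
  subst e'
  exact Category.id_comp _

/-- In a monadic right-connected double category there are free vertical arrows. -/
lemma exists_freeVert {A : DoubleCat.{v, u, w}} (hA : A.RightConnected)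
    (hU : IsStrictlyMonadic hA.toArrow) {X Y : A.Obj} (f : X ⟶ Y) :
    Nonempty (FreeVert hA f) := by
  -- The free object supplied by the adjunction may have a codomain `Y'` different from `Y`. The
  -- rest of the proof shows that `t : Y ⟶ Y'` is invertible and moves `b` along its inverse.
  obtain ⟨⟨b⟩, l, hl⟩ := hU.exists_isFree (Arrow.mk f)
  rename_i X' Y'
  let s : X ⟶ X' := l.left
  let t : Y ⟶ Y' := l.right
  have hst : s ≫ hA.und b = f ≫ t := Arrow.w l
  have ex : ∀ {X'' Y'' : A.Obj} (b' : A.Vert X'' Y'') (s' : X ⟶ X'') (t' : Y ⟶ Y'')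
      (_ : s' ≫ hA.und b' = f ≫ t'), ∃ α : A.Sq b b', s ≫ A.top α = s' ∧ t ≫ A.bot α = t' := by
    intro X'' Y'' b' s' t' h
    obtain ⟨α, hα, -⟩ := hl (b := ⟨b'⟩)
      (Arrow.homMk (f := Arrow.mk f) (g := Arrow.mk (hA.und b')) s' t' h)
    exact ⟨α, congrArg (fun k => k.left) hα, congrArg (fun k => k.right) hα⟩
  have ext : ∀ {X'' Y'' : A.Obj} {b' : A.Vert X'' Y''} {α β : A.Sq b b'},
      s ≫ A.top α = s ≫ A.top β → t ≫ A.bot α = t ≫ A.bot β → α = β := by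
    intro X'' Y'' b' α β ht hb
    exact (hl (b := ⟨b'⟩) (l ≫ hA.toArrow.map (X := ⟨b⟩) (Y := ⟨b'⟩) β)).unique
      (Arrow.hom_ext _ _ ht hb) rfl
  -- The inverse of `t` comes from freeness, applied to the square `(f, 1)` into the vertical
  -- identity of `Y`.
  obtain ⟨κ, hκt, hκb⟩ := ex (A.vid Y) f (𝟙 Y) (by rw [hA.und_vid])
  have hκ : A.bot κ ≫ t = 𝟙 Y' := by
    -- Both squares run from `b` to the vertical identity of `Y'` and agree after the universal
    -- arrow `l`. Their bottom sides give the other inverse law.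
    have e : hA.unit b = A.hcomp κ (A.vidSq t) := by
      refine ext ?_ ?_
      · rw [A.top_hcomp, A.top_vidSq, ← Category.assoc, hκt]
        exact hst
      · rw [A.bot_hcomp, A.bot_vidSq, ← Category.assoc, hκb, hA.bot_unit, Category.comp_id,
          Category.id_comp]
    have e' := congrArg A.bot e
    rw [hA.bot_unit, A.bot_hcomp, A.bot_vidSq] at e'
    exact e'.symm
  -- The domain is kept and only the codomain is changed, along `A.bot κ`.
  let φ : hA.toArrow.obj ⟨b⟩ ≅ Arrow.mk (hA.und b ≫ A.bot κ) :=
    { hom := Arrow.homMk (f := Arrow.mk (hA.und b)) (g := Arrow.mk (hA.und b ≫ A.bot κ))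
        (𝟙 X') (A.bot κ) (Category.id_comp _)
      inv := Arrow.homMk (f := Arrow.mk (hA.und b ≫ A.bot κ)) (g := Arrow.mk (hA.und b))
        (𝟙 X') t (by
          change 𝟙 X' ≫ hA.und b = (hA.und b ≫ A.bot κ) ≫ t
          rw [Category.assoc, hκ, Category.comp_id, Category.id_comp])
      hom_inv_id := Arrow.hom_ext _ _ (Category.id_comp _) hκ
      inv_hom_id := Arrow.hom_ext _ _ (Category.id_comp _) hκb }
  obtain ⟨b', hb', ψ, hψ⟩ := hU.exists_lift_iso φ
  obtain ⟨c, hc, α, β, h₁, h₂, h₃, h₄⟩ := exists_vert_of_obj_eq hA hb' ψ.hom ψ.inv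
  have hψ' : eqToHom hb'.symm ≫ hA.toArrow.map ψ.inv = φ.inv := map_inv_eq_inv ψ φ hb' hψ
  rw [hψ] at h₁ h₂
  rw [hψ'] at h₃ h₄
  have h₁' : A.top α = 𝟙 X' := h₁
  have h₂' : A.bot α = A.bot κ := h₂
  have h₃' : A.top β = 𝟙 X' := h₃
  have h₄' : A.bot β = t := h₄
  have hc' : hA.und c = hA.und b ≫ A.bot κ := hc
  refine ⟨⟨X', s, c, ?_, ?_, ?_⟩⟩
  · rw [hc', ← Category.assoc, hst, Category.assoc, hκb, Category.comp_id]
  · intro X'' Y'' b'' s' t' h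
    obtain ⟨γ, ht, hb⟩ := ex b'' s' t' h
    refine ⟨A.hcomp β γ, ?_, ?_⟩
    · rw [A.top_hcomp, h₃', Category.id_comp, ht]
    · rw [A.bot_hcomp, h₄', hb]
  · intro X'' Y'' b'' γ δ ht hb
    -- Uniqueness for `b` passes to `c` because the square `β` is a section of `α`; faithfulness
    -- reduces this to the top and bottom sides.
    have hαβ : A.hcomp β α = A.hid c := by
      have := hU.faithful
      refine hA.toArrow.map_injective (X := ⟨c⟩) (Y := ⟨c⟩) (Arrow.hom_ext _ _ ?_ ?_)
      · change A.top (A.hcomp β α) = A.top (A.hid c)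
        rw [A.top_hcomp, h₁', h₃', A.top_hid, Category.comp_id]
        rfl
      · change A.bot (A.hcomp β α) = A.bot (A.hid c)
        rw [A.bot_hcomp, h₂', h₄', A.bot_hid, hκb]
        rfl
    have e : A.hcomp α γ = A.hcomp α δ := ext
      (by rw [A.top_hcomp, A.top_hcomp, h₁', Category.id_comp, Category.id_comp, ht])
      (by rw [A.bot_hcomp, A.bot_hcomp, hb])
    have e' := congrArg (A.hcomp β) e
    rwa [← A.hassoc, ← A.hassoc, hαβ, A.hid_hcomp, A.hid_hcomp] at e'

end DoubleCat

/-- An algebraic weak factorisation system from its components. -/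
def AWFS.ofComponents {C : Type u} [Category.{v} C] (F : FunctorialFactorisation C)
    (c : ∀ {X Y : C} (f : X ⟶ Y), F.mid f ⟶ F.mid (F.left f))
    (m : ∀ {X Y : C} (f : X ⟶ Y), F.mid (F.right f) ⟶ F.mid f)
    (left_c : ∀ {X Y : C} (f : X ⟶ Y), F.left f ≫ c f = F.left (F.left f))
    (midMap_c : ∀ {X Y X' Y' : C} {f : X ⟶ Y} {g : X' ⟶ Y'} (a : X ⟶ X') (b : Y ⟶ Y')
      (h : a ≫ g = f ≫ b), F.midMap a b h ≫ c g =
        c f ≫ F.midMap a (F.midMap a b h) (F.left_midMap a b h).symm)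
    (c_right : ∀ {X Y : C} (f : X ⟶ Y), c f ≫ F.right (F.left f) = 𝟙 _)
    (c_midMap : ∀ {X Y : C} (f : X ⟶ Y), c f ≫ F.midMap (𝟙 X) (F.right f)
      ((Category.id_comp _).trans (F.left_right f).symm) = 𝟙 _)
    (c_c : ∀ {X Y : C} (f : X ⟶ Y), c f ≫ c (F.left f) = c f ≫ F.midMap (𝟙 X) (c f)
      ((Category.id_comp _).trans (left_c f).symm))
    (m_right : ∀ {X Y : C} (f : X ⟶ Y), m f ≫ F.right f = F.right (F.right f))
    (midMap_m : ∀ {X Y X' Y' : C} {f : X ⟶ Y} {g : X' ⟶ Y'} (a : X ⟶ X') (b : Y ⟶ Y')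
      (h : a ≫ g = f ≫ b), F.midMap (F.midMap a b h) b (F.midMap_right a b h) ≫ m g =
        m f ≫ F.midMap a b h)
    (left_m : ∀ {X Y : C} (f : X ⟶ Y), F.left (F.right f) ≫ m f = 𝟙 _)
    (midMap_left_m : ∀ {X Y : C} (f : X ⟶ Y), F.midMap (F.left f) (𝟙 Y)
      ((F.left_right f).trans (Category.comp_id _).symm) ≫ m f = 𝟙 _)
    (m_m : ∀ {X Y : C} (f : X ⟶ Y), m (F.right f) ≫ m f =
      F.midMap (m f) (𝟙 Y) ((m_right f).trans (Category.comp_id _).symm) ≫ m f)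
    (m_c : ∀ {X Y : C} (f : X ⟶ Y), m f ≫ c f = c (F.right f) ≫
      F.midMap (c f) (m f) ((c_right f).trans (left_m f).symm) ≫ m (F.left f)) : AWFS C where
  F := F
  Δ :=
    { app := fun f => Arrow.homMk (f := Arrow.mk (F.left f.hom))
        (g := Arrow.mk (F.left (F.left f.hom))) (𝟙 _) (c f.hom)
        ((Category.id_comp _).trans (left_c f.hom).symm)
      naturality := fun _ _ φ => Arrow.hom_ext _ _
        ((Category.comp_id φ.left).trans (Category.id_comp φ.left).symm)
        (midMap_c φ.left φ.right (Arrow.w φ)) }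
  left_counit f := Arrow.hom_ext _ _ (Category.id_comp _) (c_right f.hom)
  right_counit f := Arrow.hom_ext _ _ (Category.id_comp _) (c_midMap f.hom)
  coassoc f := Arrow.hom_ext _ _ rfl (c_c f.hom).symm
  μ :=
    { app := fun f => Arrow.homMk (f := Arrow.mk (F.right (F.right f.hom)))
        (g := Arrow.mk (F.right f.hom)) (m f.hom) (𝟙 _)
        ((m_right f.hom).trans (Category.comp_id _).symm)
      naturality := fun _ _ φ => Arrow.hom_ext _ _
        (midMap_m φ.left φ.right (Arrow.w φ))
        ((Category.comp_id φ.right).trans (Category.id_comp φ.right).symm) }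
  left_unit f := Arrow.hom_ext _ _ (left_m f.hom) (Category.id_comp _)
  right_unit f := Arrow.hom_ext _ _ (midMap_left_m f.hom) (Category.id_comp _)
  assoc f := Arrow.hom_ext _ _ (m_m f.hom).symm rfl
  -- The components of `δ` are prescribed. Each of its four axioms splits into two equations in `C`;
  -- apart from `m_c`, which occurs once in `δ_mul` and once in `δ_comul`, these are comonad or
  -- monad laws.
  δ :=
    { app := fun f => Arrow.homMk (f := Arrow.mk (F.left (F.right f.hom)))
        (g := Arrow.mk (F.right (F.left f.hom))) (c f.hom) (m f.hom)
        ((c_right f.hom).trans (left_m f.hom).symm)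
      naturality := fun _ _ φ => Arrow.hom_ext _ _
        (midMap_c φ.left φ.right (Arrow.w φ)) (midMap_m φ.left φ.right (Arrow.w φ)) }
  δ_unit f := Arrow.hom_ext _ _ (left_c f.hom) (midMap_left_m f.hom)
  δ_mul f := Arrow.hom_ext _ _ (m_c f.hom)
    ((m_m f.hom).symm.trans (congrArg (m (F.right f.hom) ≫ ·) (Category.comp_id _).symm))
  δ_counit f := Arrow.hom_ext _ _ (c_midMap f.hom) (m_right f.hom)
  δ_comul f := Arrow.hom_ext _ _
    ((c_c f.hom).symm.trans (Category.id_comp _).symm) (m_c f.hom)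
  dom_δ _ := rfl
  cod_δ _ := rfl

/-! ### The algebraic weak factorisation system of a monadic right-connected double category -/

namespace DoubleCat

/-- A choice of free vertical arrows in a right-connected double category. -/
structure FreeSystem {A : DoubleCat.{v, u, w}} (hA : A.RightConnected) where
  free {X Y : A.Obj} (f : X ⟶ Y) : FreeVert hA f

namespace FreeSystem

section

variable {A : DoubleCat.{v, u, w}} {hA : A.RightConnected} (S : FreeSystem hA)
  {X Y X' Y' X'' Y'' : A.Obj}

/-- The domain of the free vertical arrow on `f`. -/
def mid (f : X ⟶ Y) : A.Obj := (S.free f).mid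

/-- The unit of the free vertical arrow on `f`. -/
def left (f : X ⟶ Y) : X ⟶ S.mid f := (S.free f).left

/-- The free vertical arrow on `f`. -/
def vert (f : X ⟶ Y) : A.Vert (S.mid f) Y := (S.free f).vert

/-- The arrow underlying the free vertical arrow on `f`. -/
noncomputable def right (f : X ⟶ Y) : S.mid f ⟶ Y := hA.und (S.vert f)

lemma fac (f : X ⟶ Y) : S.left f ≫ S.right f = f := (S.free f).fac

/-- The square out of a free vertical arrow induced by a commutative square. -/
noncomputable def lift {f : X ⟶ Y} (b : A.Vert X' Y') (s : X ⟶ X') (t : Y ⟶ Y')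
    (h : s ≫ hA.und b = f ≫ t) : A.Sq (S.vert f) b :=
  ((S.free f).exists_lift b s t h).choose

@[simp]
lemma left_lift {f : X ⟶ Y} (b : A.Vert X' Y') (s : X ⟶ X') (t : Y ⟶ Y')
    (h : s ≫ hA.und b = f ≫ t) : S.left f ≫ A.top (S.lift b s t h) = s :=
  ((S.free f).exists_lift b s t h).choose_spec.1

@[simp]
lemma left_lift_assoc {f : X ⟶ Y} (b : A.Vert X' Y') (s : X ⟶ X') (t : Y ⟶ Y')
    (h : s ≫ hA.und b = f ≫ t) {Z : A.Obj} (k : X' ⟶ Z) :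
    S.left f ≫ A.top (S.lift b s t h) ≫ k = s ≫ k := by
  rw [← Category.assoc, left_lift]

@[simp]
lemma bot_lift {f : X ⟶ Y} (b : A.Vert X' Y') (s : X ⟶ X') (t : Y ⟶ Y')
    (h : s ≫ hA.und b = f ≫ t) : A.bot (S.lift b s t h) = t :=
  ((S.free f).exists_lift b s t h).choose_spec.2

/-- Used to prove the axioms of the factorisation system: both sides are realised as top sides of
squares out of a free vertical arrow, and are then compared after the unit and on the bottom. -/
lemma top_ext {f : X ⟶ Y} {b : A.Vert X' Y'} (α β : A.Sq (S.vert f) b)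
    (ht : S.left f ≫ A.top α = S.left f ≫ A.top β) (hb : A.bot α = A.bot β) :
    A.top α = A.top β :=
  congrArg A.top ((S.free f).ext ht hb)

/-- The map of free vertical arrows induced by a commutative square. -/
noncomputable def midSq {f : X ⟶ Y} {g : X' ⟶ Y'} (a : X ⟶ X') (b : Y ⟶ Y')
    (h : a ≫ g = f ≫ b) : A.Sq (S.vert f) (S.vert g) :=
  S.lift (S.vert g) (a ≫ S.left g) b ((Category.assoc _ _ _).trans
    ((congrArg (a ≫ ·) (S.fac g)).trans h))

/-- The multiplication square. -/
noncomputable def mulSq (f : X ⟶ Y) : A.Sq (S.vert (S.right f)) (S.vert f) :=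
  S.lift (S.vert f) (𝟙 _) (𝟙 Y) ((Category.id_comp _).trans (Category.comp_id _).symm)

/-- The comultiplication square. -/
noncomputable def comulSq (f : X ⟶ Y) :
    A.Sq (S.vert f) (A.vcomp (S.vert (S.left f)) (S.vert f)) :=
  S.lift _ (S.left (S.left f)) (𝟙 Y) (by
    rw [hA.und_vcomp, ← Category.assoc, Category.comp_id]
    exact (congrArg (· ≫ hA.und (S.vert f)) (S.fac (S.left f))).trans (S.fac f))

/-- The counit square from the free vertical arrow on the underlying arrow of `a`. -/
noncomputable def counitSq (a : A.Vert X Y) : A.Sq (S.vert (hA.und a)) a :=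
  S.lift a (𝟙 X) (𝟙 Y) ((Category.id_comp _).trans (Category.comp_id _).symm)

/-- The functorial factorisation through free vertical arrows. -/
noncomputable def factorisation : FunctorialFactorisation A.Obj where
  E :=
    { obj := fun f => S.mid f.hom
      map := fun φ => A.top (S.midSq φ.left φ.right (Arrow.w φ))
      map_id := fun f => by
        rw [← A.top_hid]
        exact S.top_ext _ _ (by
          rw [midSq, left_lift, A.top_hid]
          exact (Category.id_comp _).trans (Category.comp_id _).symm)
          ((S.bot_lift _ _ _ _).trans (A.bot_hid _).symm)
      map_comp := fun φ ψ => by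
        rw [← A.top_hcomp]
        exact S.top_ext _ _ (by
          simp only [midSq, left_lift, A.top_hcomp, left_lift_assoc, Category.assoc]
          exact Category.assoc _ _ _) (by simp only [midSq, bot_lift, A.bot_hcomp]; rfl) }
  l :=
    { app := fun f => S.left f.hom
      naturality := fun _ _ _ => (S.left_lift _ _ _ _).symm }
  r :=
    { app := fun f => S.right f.hom
      naturality := fun _ _ φ => (hA.sq_w (S.midSq φ.left φ.right (Arrow.w φ))).trans
        (congrArg (_ ≫ ·) (S.bot_lift _ _ _ _)) }
  fac f := S.fac f.hom

/-- The algebraic weak factorisation system of a choice of free vertical arrows. -/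
noncomputable def awfs : AWFS A.Obj := by
  have left_c : ∀ {X Y : A.Obj} (f : X ⟶ Y),
      S.left f ≫ A.top (S.comulSq f) = S.left (S.left f) := fun f => S.left_lift _ _ _ _
  have left_m : ∀ {X Y : A.Obj} (f : X ⟶ Y),
      S.left (S.right f) ≫ A.top (S.mulSq f) = 𝟙 _ := fun f => S.left_lift _ _ _ _
  have c_right : ∀ {X Y : A.Obj} (f : X ⟶ Y),
      A.top (S.comulSq f) ≫ S.right (S.left f) = 𝟙 _ := fun {X Y} f => by
    -- This square, from the vertical composite to its second factor, has top side `S.right (S.left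
    -- f)`, so the left-hand side is the top of a square from the free vertical arrow to itself.
    obtain ⟨σ, ht, hb⟩ := hA.exists_comp_sq (S.vert (S.left f)) (S.vert f)
    rw [right, ← ht, ← A.top_hcomp, ← A.top_hid]
    refine S.top_ext _ _ ?_ ?_
    · rw [A.top_hcomp, ← Category.assoc, left_c, ht, A.top_hid, Category.comp_id]
      exact S.fac (S.left f)
    · rw [A.bot_hcomp, hb, comulSq, bot_lift, A.bot_hid, Category.comp_id]
  have m_right : ∀ {X Y : A.Obj} (f : X ⟶ Y),
      A.top (S.mulSq f) ≫ S.right f = S.right (S.right f) := fun {X Y} f => by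
    refine (hA.sq_w (S.mulSq f)).trans ?_
    rw [mulSq, bot_lift, Category.comp_id]; rfl
  exact AWFS.ofComponents S.factorisation (fun f => A.top (S.comulSq f))
    (fun f => A.top (S.mulSq f))
    (left_c := left_c)
    (midMap_c := fun {X Y X' Y' f g} a b h => by
      -- The square of free vertical arrows on the left parts can be pasted above the square for `f`
      -- and `g`: the bottom of one is the top of the other.
      have hm : A.bot (S.midSq (f := S.left f) (g := S.left g) a (A.top (S.midSq a b h))
          (S.left_lift _ _ _ _).symm) = A.top (S.midSq a b h) := S.bot_lift _ _ _ _
      refine ((A.top_hcomp (S.midSq a b h) (S.comulSq g)).symm.trans (S.top_ext _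
        (A.hcomp (S.comulSq f) (A.vcompSq _ (S.midSq a b h) hm)) ?_ ?_)).trans
          ((A.top_hcomp _ _).trans (congrArg (_ ≫ ·) (A.top_vcompSq _ _ _)))
      · simp only [A.top_hcomp, A.top_vcompSq, midSq, comulSq, left_lift_assoc, left_lift,
          Category.assoc]
      · simp only [A.bot_hcomp, A.bot_vcompSq, midSq, comulSq, bot_lift, Category.comp_id,
          Category.id_comp])
    (c_right := c_right)
    (c_midMap := fun {X Y} f => by
      -- The pasting partner is the unit square of the free vertical arrow. The right side of the
      -- pasting ends in a vertical identity, removed by `vcomp_vid`.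
      have hm : A.bot (S.midSq (f := S.left f) (g := f) (𝟙 X) (S.right f)
          ((Category.id_comp _).trans (S.fac f).symm)) = A.top (hA.unit (S.vert f)) :=
        S.bot_lift _ _ _ _
      obtain ⟨σ, ht, hb⟩ := exists_sq_of_eq (A.vcompSq _ _ hm) rfl (A.vcomp_vid _)
      rw [A.top_vcompSq] at ht
      rw [A.bot_vcompSq, hA.bot_unit] at hb
      refine (congrArg (A.top (S.comulSq f) ≫ ·) ht.symm).trans ((A.top_hcomp _ _).symm.trans
        ((S.top_ext _ (A.hid _) ?_ ?_).trans (A.top_hid _)))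
      · rw [A.top_hcomp, ht, A.top_hid, Category.comp_id, comulSq, left_lift_assoc, midSq,
          left_lift, Category.id_comp]
      · rw [A.bot_hcomp, hb, comulSq, bot_lift, A.bot_hid, Category.comp_id])
    (c_c := fun {X Y} f => by
      -- Both sides are realised as squares into the triple vertical composite: `h₁` applies the
      -- comultiplication square of `S.left f` to the first factor, `h₂` applies that of `f` to the
      -- second. The two bracketings are matched by `vassoc`.
      have h₁ : A.bot (S.comulSq (S.left f)) = A.top (A.hid (S.vert f)) :=
        (S.bot_lift _ _ _ _).trans (A.top_hid _).symm
      have h₂ : A.bot (S.midSq (f := S.left f) (g := S.left (S.left f)) (𝟙 X)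
          (A.top (S.comulSq f)) ((Category.id_comp _).trans (left_c f).symm)) =
            A.top (S.comulSq f) := S.bot_lift _ _ _ _
      obtain ⟨σ, ht, hb⟩ := exists_sq_of_eq (A.vcompSq _ _ h₁) rfl (A.vassoc _ _ _)
      rw [A.top_vcompSq] at ht
      rw [A.bot_vcompSq, A.bot_hid] at hb
      refine (congrArg (A.top (S.comulSq f) ≫ ·) ht.symm).trans ((A.top_hcomp _ _).symm.trans
        ((S.top_ext _ (A.hcomp (S.comulSq f) (A.vcompSq _ _ h₂)) ?_ ?_).trans
          ((A.top_hcomp _ _).trans (congrArg (_ ≫ ·) (A.top_vcompSq _ _ _)))))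
      · simp only [A.top_hcomp, A.top_vcompSq, ht, midSq, comulSq, left_lift_assoc, left_lift,
          Category.id_comp]
      · simp only [A.bot_hcomp, A.bot_vcompSq, hb, comulSq, bot_lift])
    (m_right := m_right)
    (midMap_m := fun {X Y X' Y' f g} a b h => by
      refine (A.top_hcomp (S.midSq (f := S.right f) (g := S.right g) (A.top (S.midSq a b h)) b
        ((hA.sq_w (S.midSq a b h)).trans (congrArg (_ ≫ ·) (S.bot_lift _ _ _ _))))
        (S.mulSq g)).symm.trans ((S.top_ext _ (A.hcomp (S.mulSq f) (S.midSq a b h)) ?_ ?_).trans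
          (A.top_hcomp _ _))
      · simp only [A.top_hcomp, midSq, mulSq, left_lift_assoc, left_lift, Category.assoc,
          Category.comp_id, Category.id_comp]
      · simp only [A.bot_hcomp, midSq, mulSq, bot_lift, Category.comp_id, Category.id_comp])
    (left_m := left_m)
    (midMap_left_m := fun {X Y} f => by
      refine (A.top_hcomp (S.midSq (f := f) (g := S.right f) (S.left f) (𝟙 Y)
        ((S.fac f).trans (Category.comp_id _).symm)) (S.mulSq f)).symm.trans
          ((S.top_ext _ (A.hid _) ?_ ?_).trans (A.top_hid _))
      · simp only [A.top_hcomp, A.top_hid, midSq, mulSq, left_lift_assoc, left_lift,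
          Category.assoc, Category.comp_id]
      · simp only [A.bot_hcomp, A.bot_hid, midSq, mulSq, bot_lift, Category.comp_id])
    (m_m := fun {X Y} f => by
      refine (A.top_hcomp (S.mulSq (S.right f)) (S.mulSq f)).symm.trans
        ((S.top_ext _ (A.hcomp (S.midSq (f := S.right (S.right f)) (g := S.right f)
          (A.top (S.mulSq f)) (𝟙 Y) ((m_right f).trans (Category.comp_id _).symm))
            (S.mulSq f)) ?_ ?_).trans (A.top_hcomp _ _))
      · simp only [A.top_hcomp, midSq, mulSq, left_lift_assoc, left_lift,
          Category.assoc, Category.comp_id, Category.id_comp]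
      · simp only [A.bot_hcomp, midSq, mulSq, bot_lift])
    (m_c := fun {X Y} f => by
      -- On the right, the comultiplication square at `S.right f` is followed by a vertical pasting:
      -- the upper square ends in the multiplication at `S.left f`, and its bottom side is the top
      -- of the multiplication square at `f`.
      have h₁ : A.bot (A.hcomp (S.midSq (f := S.left (S.right f)) (g := S.right (S.left f))
          (A.top (S.comulSq f)) (A.top (S.mulSq f)) ((c_right f).trans (left_m f).symm))
            (S.mulSq (S.left f))) = A.top (S.mulSq f) := by
        simp only [A.bot_hcomp, midSq, bot_lift]
        refine (congrArg (A.top (S.mulSq f) ≫ ·) (S.bot_lift _ _ _ _)).trans ?_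
        exact Category.comp_id _
      refine (A.top_hcomp (S.mulSq f) (S.comulSq f)).symm.trans
        ((S.top_ext _ (A.hcomp (S.comulSq (S.right f)) (A.vcompSq _ _ h₁)) ?_ ?_).trans
          ((A.top_hcomp _ _).trans (congrArg (_ ≫ ·) ((A.top_vcompSq _ _ _).trans
            (A.top_hcomp _ _)))))
      · simp only [A.top_hcomp, A.top_vcompSq, midSq, mulSq, comulSq, left_lift_assoc, left_lift,
          Category.assoc, Category.comp_id, Category.id_comp]
      · simp only [A.bot_hcomp, A.bot_vcompSq, mulSq, comulSq, bot_lift])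

end

end FreeSystem

end DoubleCat

/-! ### Reconstruction of a monadic right-connected double category -/

namespace DoubleCat

/-- The one-sided analogue of `exists_vert_of_obj_eq`: eliminating the equality of arrows gives a
vertical arrow with exactly the prescribed endpoints and a square into it. -/
lemma exists_vert_of_hom {A : DoubleCat.{v, u, w}} (hA : A.RightConnected) {a b : A.One}
    {X Y : A.Obj} {g : X ⟶ Y} (hb : hA.toArrow.obj b = Arrow.mk g) (ψ : a ⟶ b)
    (p : hA.toArrow.obj a ⟶ Arrow.mk g) (hp : hA.toArrow.map ψ ≫ eqToHom hb = p) :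
    ∃ c : A.Vert X Y, hA.und c = g ∧ ∃ α : A.Sq a.vert c, A.top α = p.left ∧ A.bot α = p.right := by
  have key : ∀ (f : Arrow A.Obj) (h : hA.toArrow.obj b = f) (q : hA.toArrow.obj a ⟶ f),
      hA.toArrow.map ψ ≫ eqToHom h = q →
      ∃ c : A.Vert f.left f.right, hA.und c = f.hom ∧
        ∃ α : A.Sq a.vert c, A.top α = q.left ∧ A.bot α = q.right := by
    rintro _ rfl _ rfl
    exact ⟨b.vert, rfl, ψ, (Category.comp_id _).symm, (Category.comp_id _).symm⟩
  exact key (Arrow.mk g) hb p hp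

lemma eqToHom_arrowMk {C : Type u} [Category.{v} C] {X Y : C} {f g : X ⟶ Y} (h : f = g)
    (h' : Arrow.mk f = Arrow.mk g) (q : 𝟙 X ≫ g = f ≫ 𝟙 Y) :
    eqToHom h' = Arrow.homMk (f := Arrow.mk f) (g := Arrow.mk g) (𝟙 X) (𝟙 Y) q := by
  subst h; rfl

/-- A monadic right-connected double category is flat. -/
lemma sq_ext {A : DoubleCat.{v, u, w}} (hA : A.RightConnected)
    (hU : IsStrictlyMonadic hA.toArrow) {X Y X' Y' : A.Obj} {a : A.Vert X Y} {a' : A.Vert X' Y'}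
    {α β : A.Sq a a'} (ht : A.top α = A.top β) (hb : A.bot α = A.bot β) : α = β := by
  have := hU.faithful
  have e : hA.toArrow.map (X := ⟨a⟩) (Y := ⟨a'⟩) α = hA.toArrow.map β := Arrow.hom_ext _ _ ht hb
  exact hA.toArrow.map_injective e

lemma sq_heq {A : DoubleCat.{v, u, w}} (hA : A.RightConnected)
    (hU : IsStrictlyMonadic hA.toArrow) {X Y X' Y' : A.Obj} {a b : A.Vert X Y}
    {a' b' : A.Vert X' Y'} (h : a = b) (h' : a' = b') {α : A.Sq a a'} {β : A.Sq b b'}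
    (ht : A.top α = A.top β) (hb : A.bot α = A.bot β) : α ≍ β := by
  subst h h'; exact heq_of_eq (sq_ext hA hU ht hb)

namespace FreeSystem

open AWFS

variable {A : DoubleCat.{v, u, max v w}} {hA : A.RightConnected} (S : FreeSystem hA)
  {X Y Z X' Y' : A.Obj}

/-- Both composites are tops of squares out of the free vertical arrow on `hA.und a` with the same
restriction along the unit. It is the condition for a square to be a map of algebras. -/
lemma counitSq_top_comp (a : A.Vert X Y) {b : A.Vert X' Y'} (α : A.Sq a b) :
    A.top (S.counitSq a) ≫ A.top α =
      A.top (S.midSq (A.top α) (A.bot α) (hA.sq_w α)) ≫ A.top (S.counitSq b) := by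
  refine (A.top_hcomp _ _).symm.trans ((S.top_ext _ (A.hcomp (S.midSq (A.top α) (A.bot α)
    (hA.sq_w α)) (S.counitSq b)) ?_ ?_).trans (A.top_hcomp _ _))
  · simp only [A.top_hcomp, midSq, counitSq, left_lift_assoc, left_lift, Category.assoc,
      Category.comp_id, Category.id_comp]
  · simp only [A.bot_hcomp, midSq, counitSq, bot_lift, Category.comp_id, Category.id_comp]

lemma counitSq_w (a : A.Vert X Y) :
    A.top (S.counitSq a) ≫ hA.und a = S.right (hA.und a) ≫ 𝟙 Y :=
  (hA.sq_w (S.counitSq a)).trans (congrArg (_ ≫ ·) (S.bot_lift _ _ _ _))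

/-- By the same uniqueness principle; it is the associativity law of the algebra attached to `a`. -/
lemma mulSq_top_comp_counitSq (a : A.Vert X Y) :
    A.top (S.mulSq (hA.und a)) ≫ A.top (S.counitSq a) =
      A.top (S.midSq (f := S.right (hA.und a)) (g := hA.und a) (A.top (S.counitSq a)) (𝟙 Y)
        (S.counitSq_w a)) ≫ A.top (S.counitSq a) := by
  refine (A.top_hcomp _ _).symm.trans ((S.top_ext _ (A.hcomp (S.midSq (f := S.right (hA.und a))
    (g := hA.und a) (A.top (S.counitSq a)) (𝟙 Y) (S.counitSq_w a)) (S.counitSq a)) ?_ ?_).trans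
      (A.top_hcomp _ _))
  · simp only [A.top_hcomp, midSq, mulSq, counitSq, left_lift_assoc, left_lift, Category.assoc,
      Category.comp_id, Category.id_comp]
  · simp only [A.bot_hcomp, midSq, mulSq, counitSq, bot_lift]

/-- The algebra given by a vertical arrow. -/
noncomputable def alg (a : A.Vert X Y) : RAlg.{v, u, w} S.awfs X Y where
  hom := hA.und a
  str := A.top (S.counitSq a)
  str_hom := (S.counitSq_w a).trans (Category.comp_id _)
  unit := S.left_lift _ _ _ _
  assoc := S.mulSq_top_comp_counitSq a

/-- The map of algebras given by a square. -/
noncomputable def algSq {a : A.Vert X Y} {b : A.Vert X' Y'} (α : A.Sq a b) :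
    RAlg.Sq (S.alg a) (S.alg b) where
  top := A.top α
  bot := A.bot α
  comm := hA.sq_w α
  str := S.counitSq_top_comp a α

lemma alg_vid (X : A.Obj) : S.alg (A.vid X) = RAlg.id.{v, u, w} S.awfs X := by
  refine RAlg.ext' (hA.und_vid X) ?_
  refine Eq.trans ?_ (S.awfs.F.midMap_right (f := hA.und (A.vid X)) (g := 𝟙 X) (𝟙 X) (𝟙 X)
    ((congrArg (𝟙 X ≫ ·) (hA.und_vid X).symm).trans
      ((Category.id_comp _).trans (Category.comp_id _).symm))).symm
  refine Eq.trans ?_ (S.counitSq_w (A.vid X))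
  exact ((congrArg (A.top (S.counitSq (A.vid X)) ≫ ·) (hA.und_vid X)).trans
    (Category.comp_id _)).symm

/-- The comultiplication was defined by a square into a vertical composite of free vertical arrows.
Pasting counit squares onto it yields a square into `A.vcomp a b` that must be the counit square of
the composite, and whose top side is the filler first against `b` and then against `a`. -/
lemma alg_vcomp (a : A.Vert X Y) (b : A.Vert Y Z) :
    S.alg (A.vcomp a b) = RAlg.comp (S.alg a) (S.alg b) := by
  refine RAlg.ext' (hA.und_vcomp a b) ?_
  have h₂ : hA.und a ≫ hA.und b = (hA.und a ≫ hA.und b) ≫ 𝟙 Z := (Category.comp_id _).symm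
  -- The top of `ρ₂` is the filler against `b`. The square `ρ₁` below fills against `a` with that
  -- filler as its bottom side, so the two can be pasted vertically.
  let ρ₂ : A.Sq (S.vert (hA.und a ≫ hA.und b)) b := A.hcomp (S.midSq _ _ h₂) (S.counitSq b)
  have e₂ : RAlg.compMid (S.alg a) (S.alg b) = A.top ρ₂ :=
    (RAlg.compMid_eq _ _).trans (A.top_hcomp _ _).symm
  have h₁ : 𝟙 X ≫ hA.und a = S.left (hA.und a ≫ hA.und b) ≫ A.top ρ₂ :=
    (Category.id_comp _).trans ((RAlg.left_compMid (S.alg a) (S.alg b)).symm.trans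
      (congrArg (S.left (hA.und a ≫ hA.und b) ≫ ·) e₂))
  let ρ₁ : A.Sq (S.vert (S.left (hA.und a ≫ hA.und b))) a :=
    A.hcomp (S.midSq _ _ h₁) (S.counitSq a)
  have hρ : A.bot ρ₁ = A.top ρ₂ := by
    simp only [ρ₁, A.bot_hcomp, midSq, counitSq, bot_lift, Category.comp_id]
  -- The underlying arrow of `A.vcomp a b` is only propositionally the composite, so the two free
  -- vertical arrows are compared along identity sides.
  have h₀ : 𝟙 X ≫ hA.und a ≫ hA.und b = hA.und (A.vcomp a b) ≫ 𝟙 Z := by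
    rw [hA.und_vcomp, Category.id_comp, Category.comp_id]
  have e : A.top (S.counitSq (A.vcomp a b)) = A.top (S.midSq _ _ h₀) ≫
      A.top (S.comulSq (hA.und a ≫ hA.und b)) ≫ A.top (S.midSq _ _ h₁) ≫ A.top (S.counitSq a) := by
    refine (S.top_ext _ (A.hcomp (S.midSq _ _ h₀) (A.hcomp (S.comulSq (hA.und a ≫ hA.und b))
      (A.vcompSq ρ₁ ρ₂ hρ))) ?_ ?_).trans ?_
    · simp only [A.top_hcomp, A.top_vcompSq, ρ₁, midSq, comulSq, counitSq, left_lift_assoc,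
        left_lift, Category.id_comp]
    · simp only [A.bot_hcomp, A.bot_vcompSq, ρ₂, midSq, comulSq, counitSq, bot_lift,
        Category.id_comp]
    · simp only [A.top_hcomp, A.top_vcompSq, ρ₁]
  refine e.trans (congrArg (A.top (S.midSq _ _ h₀) ≫ ·) ?_)
  exact (RAlg.lift_congr (g := S.alg a) (s := S.awfs.c (hA.und a ≫ hA.und b)) rfl e₂.symm :
    RAlg.lift (S.awfs.c (hA.und a ≫ hA.und b)) (S.alg a) (𝟙 X) (A.top ρ₂) h₁ = _)

/-- The double functor from a double category to the algebras of its algebraic weak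
factorisation system. -/
noncomputable def toDAlg : DoubleFunctor A (DAlg.{v, u, w} S.awfs) where
  H := 𝟭 A.Obj
  V a := S.alg a
  S α := S.algSq α
  V_vid := S.alg_vid
  V_vcomp := S.alg_vcomp
  top_S _ := rfl
  bot_S _ := rfl
  S_hid a := RAlg.Sq.ext (A.top_hid a) (A.bot_hid a)
  S_hcomp α β := RAlg.Sq.ext (A.top_hcomp α β) (A.bot_hcomp α β)
  S_vidSq f := RAlg.Sq.heq (S.alg_vid _) (S.alg_vid _) (A.top_vidSq f) (A.bot_vidSq f)
  S_vcompSq α β h := RAlg.Sq.heq (S.alg_vcomp _ _) (S.alg_vcomp _ _) (A.top_vcompSq α β h)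
    (A.bot_vcompSq α β h)

variable (hU : IsStrictlyMonadic hA.toArrow)

include hU

/-- The counit square of `a` is split by the unit after passing to underlying arrows, and the
condition for `β` to be a map of algebras is exactly the compatibility required by
`exists_lift_hom`. -/
lemma exists_sq {a : A.Vert X Y} {b : A.Vert X' Y'} (β : RAlg.Sq (S.alg a) (S.alg b)) :
    ∃ α : A.Sq a b, A.top α = β.top ∧ A.bot α = β.bot := by
  obtain ⟨α, hα⟩ := hU.exists_lift_hom (F := ⟨S.vert (hA.und a)⟩) (b := ⟨a⟩) (b' := ⟨b⟩)
    (l := Arrow.homMk (f := Arrow.mk (hA.und a)) (g := Arrow.mk (S.right (hA.und a)))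
      (S.left (hA.und a)) (𝟙 Y) ((S.fac _).trans (Category.comp_id _).symm))
    (S.counitSq a) (Arrow.hom_ext _ _ (S.left_lift _ _ _ _)
      ((Category.id_comp _).trans (S.bot_lift _ _ _ _)))
    (A.hcomp (S.midSq β.top β.bot β.comm) (S.counitSq b))
    (Arrow.homMk (f := Arrow.mk (hA.und a)) (g := Arrow.mk (hA.und b)) β.top β.bot β.comm)
    (Arrow.hom_ext _ _ ((A.top_hcomp _ _).trans β.str.symm) (by
      refine (A.bot_hcomp _ _).trans ?_
      change _ = A.bot (S.counitSq a) ≫ β.bot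
      simp only [midSq, counitSq, bot_lift, Category.id_comp]
      exact (congrArg (β.bot ≫ ·) (S.bot_lift _ _ _ _)).trans (Category.comp_id _)))
  exact ⟨α, congrArg (fun t => t.left) hα, congrArg (fun t => t.right) hα⟩

/-- Equal algebras are related by a map with identity sides. It lifts to a square, and a strictly
monadic functor identifies objects joined by an arrow over an identity. -/
lemma alg_injective {a b : A.Vert X Y} (h : S.alg a = S.alg b) : a = b := by
  obtain ⟨β, ht, hb⟩ : ∃ β : RAlg.Sq (S.alg a) (S.alg b), β.top = 𝟙 X ∧ β.bot = 𝟙 Y := by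
    rw [h]; exact ⟨RAlg.Sq.hid _, rfl, rfl⟩
  obtain ⟨α, hα, hα'⟩ := S.exists_sq hU β
  have hu : hA.und a = hA.und b := congrArg RAlg.hom h
  have hw : 𝟙 X ≫ hA.und b = hA.und a ≫ 𝟙 Y := by rw [hu, Category.id_comp, Category.comp_id]
  have k := hU.eq_of_hom (b := ⟨a⟩) (b' := ⟨b⟩) (congrArg Arrow.mk hu) α
    ((Arrow.hom_ext _ _ (hα.trans ht) (hα'.trans hb) : hA.toArrow.map (X := ⟨a⟩) (Y := ⟨b⟩) α =
      Arrow.homMk (f := Arrow.mk (hA.und a)) (g := Arrow.mk (hA.und b)) (𝟙 X) (𝟙 Y)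
        hw).trans (eqToHom_arrowMk hu _ _).symm)
  exact eq_of_heq (DoubleCat.One.mk.inj k).2.2

lemma alg_surjective (g : RAlg.{v, u, w} S.awfs X Y) : ∃ a : A.Vert X Y, S.alg a = g := by
  have hw : g.str ≫ g.hom = S.right g.hom ≫ 𝟙 Y := g.str_hom.trans (Category.comp_id _).symm
  -- The retraction is the structure map `g.str`. The parallel pair consists of the multiplication
  -- and the free vertical arrow functor applied to `g.str`, and the associativity law of `g` says
  -- that `g.str` coequalises it.
  obtain ⟨b, hb, q, hq⟩ := hU.exists_lift_algebra (S.free g.hom).isFree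
    (F := ⟨S.vert g.hom⟩) (F' := ⟨S.vert (S.right g.hom)⟩)
    (l' := Arrow.homMk (f := Arrow.mk (S.right g.hom)) (g := Arrow.mk (S.right (S.right g.hom)))
      (S.left (S.right g.hom)) (𝟙 Y) ((S.fac _).trans (Category.comp_id _).symm))
    (Arrow.homMk (f := Arrow.mk (S.right g.hom)) (g := Arrow.mk g.hom) g.str (𝟙 Y) hw)
    (S.mulSq g.hom) (S.midSq (f := S.right g.hom) (g := g.hom) g.str (𝟙 Y) hw)
    (Arrow.hom_ext _ _ g.unit (Category.id_comp _))
    (Arrow.hom_ext _ _ (S.left_lift _ _ _ _) ((Category.id_comp _).trans (S.bot_lift _ _ _ _)))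
    (Arrow.hom_ext _ _ (S.left_lift _ _ _ _) (congrArg (𝟙 Y ≫ ·) (S.bot_lift _ _ _ _)))
    (Arrow.hom_ext _ _ g.assoc (congrArg (· ≫ 𝟙 Y)
      ((S.bot_lift _ _ _ _).trans (S.bot_lift _ _ _ _).symm)))
  obtain ⟨c, hc, α, ht, hb'⟩ := exists_vert_of_hom hA hb q _ hq
  have ht' : A.top α = g.str := ht
  have hb'' : A.bot α = 𝟙 Y := hb'
  refine ⟨c, RAlg.ext' hc ?_⟩
  have h₀ : 𝟙 X ≫ g.hom = hA.und c ≫ 𝟙 Y := by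
    rw [hc, Category.id_comp, Category.comp_id]
  -- The structure map of `S.alg c` is compared with `g.str` through the square `α` over `g.str`:
  -- both squares out of the free vertical arrow restrict to the identity along the unit.
  refine (S.top_ext (S.counitSq c) (A.hcomp (S.midSq _ _ h₀) α) ?_ ?_).trans
    ((A.top_hcomp _ _).trans (congrArg (A.top (S.midSq _ _ h₀) ≫ ·) ht'))
  · refine (S.left_lift _ _ _ _).trans (Eq.trans ?_ (congrArg (S.left (hA.und c) ≫ ·)
      (A.top_hcomp _ _).symm))
    have hu : (𝟙 X ≫ S.left g.hom) ≫ A.top α = 𝟙 X := by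
      rw [ht', Category.id_comp]; exact g.unit
    exact hu.symm.trans (S.left_lift_assoc (S.vert g.hom) _ (𝟙 Y) _ (A.top α)).symm
  · simp only [A.bot_hcomp, midSq, counitSq, bot_lift, Category.id_comp, hb'']

/-- A monadic right-connected double category is isomorphic to the double category of algebras of
its algebraic weak factorisation system. -/
theorem exists_inverse : ∃ K : DoubleFunctor (DAlg.{v, u, w} S.awfs) A,
    S.toDAlg.comp K = DoubleFunctor.id A ∧ K.comp S.toDAlg = DoubleFunctor.id _ := by
  let e (X Y : A.Obj) : A.Vert X Y ≃ RAlg.{v, u, w} S.awfs X Y :=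
    Equiv.ofBijective S.alg ⟨fun _ _ h => S.alg_injective hU h, S.alg_surjective hU⟩
  have he : ∀ {X Y : A.Obj} (g : RAlg.{v, u, w} S.awfs X Y), S.alg ((e X Y).symm g) = g :=
    fun {X Y} g => (e X Y).apply_symm_apply g
  have he' : ∀ {X Y : A.Obj} (a : A.Vert X Y), (e X Y).symm (S.alg a) = a :=
    fun {X Y} a => (e X Y).symm_apply_apply a
  -- By surjectivity both algebras may be taken to come from vertical arrows; the lifted square is
  -- then moved along the equalities `he'`.
  have ex : ∀ (X Y X' Y' : A.Obj) (g : RAlg.{v, u, w} S.awfs X Y) (g' : RAlg.{v, u, w} S.awfs X' Y')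
      (β : RAlg.Sq g g'), ∃ α : A.Sq ((e X Y).symm g) ((e X' Y').symm g'),
        A.top α = β.top ∧ A.bot α = β.bot := by
    intro X Y X' Y' g g' β
    obtain ⟨a, rfl⟩ := S.alg_surjective hU g
    obtain ⟨a', rfl⟩ := S.alg_surjective hU g'
    obtain ⟨α, ht, hb⟩ := S.exists_sq hU β
    obtain ⟨α', ht', hb'⟩ := exists_sq_of_eq α (he' a).symm (he' a').symm
    exact ⟨α', ht'.trans ht, hb'.trans hb⟩
  choose s st sb using ex
  have s_vid : ∀ X : A.Obj, (e X X).symm (RAlg.id.{v, u, w} S.awfs X) = A.vid X := fun X =>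
    (congrArg (e X X).symm (S.alg_vid X).symm).trans (he' _)
  have s_comp : ∀ {X Y Z : A.Obj} (g : RAlg.{v, u, w} S.awfs X Y) (h : RAlg.{v, u, w} S.awfs Y Z),
      (e X Z).symm (RAlg.comp g h) = A.vcomp ((e X Y).symm g) ((e Y Z).symm h) := by
    intro X Y Z g h
    refine (Equiv.symm_apply_eq _).2 ?_
    refine Eq.trans ?_ (S.alg_vcomp _ _).symm
    rw [he, he]
  let K : DoubleFunctor (DAlg.{v, u, w} S.awfs) A :=
    { H := 𝟭 A.Obj
      V := fun {X Y} g => (e X Y).symm g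
      S := fun {X Y X' Y' g g'} β => s X Y X' Y' g g' β
      V_vid := s_vid
      V_vcomp := s_comp
      top_S := fun β => st _ _ _ _ _ _ β
      bot_S := fun β => sb _ _ _ _ _ _ β
      S_hid := fun g => sq_ext hA hU ((st _ _ _ _ _ _ _).trans (A.top_hid _).symm)
        ((sb _ _ _ _ _ _ _).trans (A.bot_hid _).symm)
      S_hcomp := fun α β => sq_ext hA hU ((st _ _ _ _ _ _ _).trans
          ((A.top_hcomp _ _).trans (congrArg₂ (· ≫ ·) (st _ _ _ _ _ _ _) (st _ _ _ _ _ _ _))).symm)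
        ((sb _ _ _ _ _ _ _).trans
          ((A.bot_hcomp _ _).trans (congrArg₂ (· ≫ ·) (sb _ _ _ _ _ _ _) (sb _ _ _ _ _ _ _))).symm)
      S_vidSq := fun f => sq_heq hA hU (s_vid _) (s_vid _)
        ((st _ _ _ _ _ _ _).trans (A.top_vidSq f).symm)
        ((sb _ _ _ _ _ _ _).trans (A.bot_vidSq f).symm)
      S_vcompSq := fun α β h => sq_heq hA hU (s_comp _ _) (s_comp _ _)
        ((st _ _ _ _ _ _ _).trans ((A.top_vcompSq _ _ _).trans (st _ _ _ _ _ _ α)).symm)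
        ((sb _ _ _ _ _ _ _).trans ((A.bot_vcompSq _ _ _).trans (sb _ _ _ _ _ _ β)).symm) }
  refine ⟨K, ?_, ?_⟩
  · exact DoubleFunctor.ext' rfl (fun a => heq_of_eq (he' a)) fun α =>
      sq_heq hA hU (he' _) (he' _) (st _ _ _ _ _ _ _) (sb _ _ _ _ _ _ _)
  · exact DoubleFunctor.ext' rfl (fun g => heq_of_eq (he g)) fun α =>
      RAlg.Sq.heq (he _) (he _) (st _ _ _ _ _ _ _) (sb _ _ _ _ _ _ _)

end FreeSystem

/-- A monadic right-connected double category is isomorphic to the double category of algebras of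
an algebraic weak factorisation system. -/
theorem MonadicRightConnected.exists_awfs {A : DoubleCat.{v, u, max v w}}
    (h : A.MonadicRightConnected) : ∃ (W : AWFSLax.{v, u}) (i : AWFS.DAlg.{v, u, w} W.awfs ⟶ A)
      (j : A ⟶ AWFS.DAlg.{v, u, w} W.awfs), i ≫ j = 𝟙 _ ∧ j ≫ i = 𝟙 _ := by
  obtain ⟨hA, hU⟩ := h
  let S : FreeSystem hA := ⟨fun f => (exists_freeVert hA hU f).some⟩
  obtain ⟨K, h₁, h₂⟩ := S.exists_inverse hU
  exact ⟨⟨A.Obj, S.awfs⟩, K, S.toDAlg, h₂, h₁⟩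

end DoubleCat

/-! ### Strict 2-functors into full sub-2-categories -/

section Induced

open Bicategory

universe w₁ w₂ v₁ v₂ u₁ u₂ u₃

variable {B : Type u₁} [Bicategory.{w₁, v₁} B] {C : Type u₂} [Bicategory.{w₂, v₂} C]
  {D : Type u₃} {p : D → C}

lemma InducedBicategory.hom_bijective (X Y : InducedBicategory C p) :
    Function.Bijective (fun f : X ⟶ Y => f.hom) :=
  ⟨fun _ _ h => InducedBicategory.hom_ext h, fun f => ⟨InducedBicategory.mkHom f, rfl⟩⟩

lemma InducedBicategory.hom₂_bijective {X Y : InducedBicategory C p} (f g : X ⟶ Y) :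
    Function.Bijective (fun η : f ⟶ g => η.hom) :=
  ⟨fun _ _ h => InducedBicategory.hom₂_ext h, fun η => ⟨⟨η⟩, rfl⟩⟩

lemma InducedBicategory.eqToHom_conj_hom {X Y : InducedBicategory C p} {f f' g g' : X ⟶ Y}
    (h : f = g) (η : g ⟶ g') (h' : g' = f') : (eqToHom h ≫ η ≫ eqToHom h').hom =
      eqToHom (congrArg InducedBicategory.Hom.hom h) ≫ η.hom ≫
        eqToHom (congrArg InducedBicategory.Hom.hom h') := by
  subst h h'
  exact (congrArg InducedBicategory.Hom₂.hom
    ((Category.id_comp _).trans (Category.comp_id η))).trans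
      ((Category.id_comp _).trans (Category.comp_id _)).symm

variable [Strict B] [Strict C]

/-- The strictness data are taken as separate hypotheses on a prelax functor. It can then be
destructured and its object map replaced by `fun X => p (ob X)`, after which the lift to the full
sub-2-category has the same 1-cells and 2-cells on the nose. -/
lemma exists_comp_forget_eq_of_prelax (F : PrelaxFunctor B C) (ob : B → InducedBicategory C p)
    (h : ∀ X, p (ob X) = F.obj X) (map_id : ∀ X, F.map (𝟙 X) = 𝟙 (F.obj X))
    (map_comp : ∀ {X Y Z : B} (f : X ⟶ Y) (g : Y ⟶ Z), F.map (f ≫ g) = F.map f ≫ F.map g)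
    (map₂_whiskerLeft : ∀ {X Y Z : B} (f : X ⟶ Y) {g h : Y ⟶ Z} (η : g ⟶ h), F.map₂ (f ◁ η) =
      eqToHom (map_comp f g) ≫ F.map f ◁ F.map₂ η ≫ eqToHom (map_comp f h).symm)
    (map₂_whiskerRight : ∀ {X Y Z : B} {f g : X ⟶ Y} (η : f ⟶ g) (h : Y ⟶ Z), F.map₂ (η ▷ h) =
      eqToHom (map_comp f h) ≫ F.map₂ η ▷ F.map h ≫ eqToHom (map_comp g h).symm) :
    ∃ E : StrictPseudofunctor B (InducedBicategory C p),
      (E.comp InducedBicategory.forget).toPrelaxFunctor = F ∧ ∀ X, E.obj X = ob X := by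
  obtain ⟨⟨⟨obj, map⟩, map₂⟩, map₂_id, map₂_comp⟩ := F
  obtain rfl : obj = fun X => p (ob X) := funext fun X => (h X).symm
  refine ⟨StrictPseudofunctor.mk''
    { obj := ob
      map := fun f => InducedBicategory.mkHom (map f)
      map₂ := fun η => InducedBicategory.mkHom₂ (map₂ η)
      map₂_id := fun f => InducedBicategory.hom₂_ext (map₂_id f)
      map₂_comp := fun η θ => InducedBicategory.hom₂_ext (map₂_comp η θ)
      map_id := fun X => InducedBicategory.hom_ext (map_id X)
      map_comp := fun f g => InducedBicategory.hom_ext (map_comp f g)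
      map₂_whisker_left := fun {X Y Z} f g h η => InducedBicategory.hom₂_ext
        ((map₂_whiskerLeft f η).trans ?_)
      map₂_whisker_right := fun {X Y Z f g} η h => InducedBicategory.hom₂_ext
        ((map₂_whiskerRight η h).trans ?_) }, rfl, fun _ => rfl⟩
  · exact (InducedBicategory.eqToHom_conj_hom (p := p) (X := ob X) (Y := ob Z)
      (f := InducedBicategory.mkHom (map (f ≫ g))) (f' := InducedBicategory.mkHom (map (f ≫ h)))
      (InducedBicategory.hom_ext (map_comp f g))
      (InducedBicategory.mkHom (map f) ◁ InducedBicategory.mkHom₂ (map₂ η))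
      (InducedBicategory.hom_ext (map_comp f h).symm)).symm
  · exact (InducedBicategory.eqToHom_conj_hom (p := p) (X := ob X) (Y := ob Z)
      (f := InducedBicategory.mkHom (map (f ≫ h))) (f' := InducedBicategory.mkHom (map (g ≫ h)))
      (g := InducedBicategory.mkHom (map f) ≫ InducedBicategory.mkHom (map h))
      (g' := InducedBicategory.mkHom (map g) ≫ InducedBicategory.mkHom (map h))
      (InducedBicategory.hom_ext (map_comp f h))
      (Bicategory.whiskerRight (a := ob X) (b := ob Y) (c := ob Z)
        (InducedBicategory.mkHom₂ (a := ob X) (b := ob Y) (map₂ η))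
        (InducedBicategory.mkHom (X := ob Y) (Y := ob Z) (map h)))
      (InducedBicategory.hom_ext (map_comp g h).symm)).symm

/-- A strict 2-functor whose values on objects lie in a full sub-2-category factors through it. -/
lemma exists_comp_forget_eq (F : StrictPseudofunctor B C) (ob : B → D)
    (h : ∀ X, p (ob X) = F.obj X) :
    ∃ E : StrictPseudofunctor B (InducedBicategory C p),
      E.comp InducedBicategory.forget = F ∧ ∀ X, E.obj X = ob X := by
  obtain ⟨E, hE, hE'⟩ := exists_comp_forget_eq_of_prelax F.toPrelaxFunctor ob h F.map_id
    (fun f g => F.map_comp f g) (fun f _ _ η => strict_map₂_whiskerLeft F f η)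
    (fun η h => strict_map₂_whiskerRight F η h)
  exact ⟨E, strictPseudofunctor_ext hE, hE'⟩

/-- A strict 2-functor that is bijective on 1-cells and 2-cells is an equivalence onto any full
sub-2-category whose objects are, up to isomorphism, its values. -/
theorem exists_isTwoEquivalence (F : StrictPseudofunctor B C) (ob : B → D)
    (h : ∀ X, p (ob X) = F.obj X)
    (h₁ : ∀ X Y : B, Function.Bijective (fun f : X ⟶ Y => F.map f))
    (h₂ : ∀ {X Y : B} (f g : X ⟶ Y), Function.Bijective (fun η : f ⟶ g => F.map₂ η))
    (h₃ : ∀ Z : D, ∃ (X : B) (i : F.obj X ⟶ p Z) (j : p Z ⟶ F.obj X),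
      i ≫ j = 𝟙 _ ∧ j ≫ i = 𝟙 _) :
    ∃ E : StrictPseudofunctor B (InducedBicategory C p),
      E.comp InducedBicategory.forget = F ∧ IsTwoEquivalence E := by
  obtain ⟨E, rfl, -⟩ := exists_comp_forget_eq F ob h
  refine ⟨E, rfl, isTwoEquivalence_of_bijective E (fun X Y => ?_) (fun f g => ?_) fun Z => ?_⟩
  · exact Function.Bijective.of_comp_left (f := fun f : E.obj X ⟶ E.obj Y => f.hom) (h₁ X Y)
      (InducedBicategory.hom_bijective _ _).1
  · exact Function.Bijective.of_comp_left
      (f := fun η : E.map f ⟶ E.map g => η.hom) (h₂ f g)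
      (InducedBicategory.hom₂_bijective _ _).1
  · obtain ⟨X, i, j, hij, hji⟩ := h₃ Z
    exact ⟨X, InducedBicategory.mkHom i, InducedBicategory.mkHom j,
      InducedBicategory.hom_ext hij, InducedBicategory.hom_ext hji⟩

end Induced

/-! ### The equivalences -/

/-- The double category of algebras as a strict 2-functor. -/
abbrev algebras : StrictPseudofunctor AWFSLax.{v, u} DoubleCat.{v, u, max v w} :=
  semantics.{v, u, w}.comp (ArrowTwo.source DoubleCat.{v, u, max v w})

lemma algebras_map_bijective (W W' : AWFSLax.{v, u}) :
    Function.Bijective (fun F : W ⟶ W' => algebras.{v, u, w}.map F) :=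
  LaxMor.dAlg_bijective.{v, u, w} (W := W.awfs) (W' := W'.awfs)

lemma algebras_map₂_bijective {W W' : AWFSLax.{v, u}} (F G : W ⟶ W') :
    Function.Bijective (fun σ : F ⟶ G => algebras.{v, u, w}.map₂ σ) :=
  LaxTrans.dAlg_bijective.{v, u, w} F G

lemma semObj_eq_arrowTwo (W : AWFSLax.{v, u}) : semObj.{v, u, w} W =
    DoubleCat.RightConnected.arrowTwo (AWFS.rightConnected_dAlg.{v, u, w} W.awfs) :=
  congrArg (fun V => (⟨AWFS.DAlg.{v, u, w} W.awfs, SqD.{v, u, w} W.carrier, V⟩ :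
    ArrowTwo DoubleCat.{v, u, max v w})) (AWFS.forget_eq_toSqD.{v, u, w} W.awfs)

lemma toArrowTwo_eq_arrowTwo (A : ConcreteDouble.{v, u, w}) (h : A.RightConnected) :
    ∃ hA : A.dbl.RightConnected, A.toArrowTwo = hA.arrowTwo := by
  obtain ⟨hA, hV⟩ := A.exists_rightConnected h
  exact ⟨hA, congrArg (fun V => (⟨A.dbl, SqD.{v, u, w} A.dbl.Obj, V⟩ :
    ArrowTwo DoubleCat.{v, u, max v w})) hV⟩

/-- The forgetful double functor is the canonical one of a right-connected double category, so the
general bijection applies. -/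
lemma semObj_top_bijective (W W' : AWFSLax.{v, u}) : Function.Bijective
    (fun f : semObj.{v, u, w} W ⟶ semObj.{v, u, w} W' => f.top) := by
  have := DoubleCat.RightConnected.top_bijective (AWFS.rightConnected_dAlg.{v, u, w} W.awfs)
    (AWFS.rightConnected_dAlg.{v, u, w} W'.awfs)
  unfold DoubleCat.RightConnected.arrowTwo at this
  rw [← AWFS.forget_eq_toSqD, ← AWFS.forget_eq_toSqD] at this
  exact this

lemma semObj_top₂_bijective {W W' : AWFSLax.{v, u}}
    (f g : semObj.{v, u, w} W ⟶ semObj.{v, u, w} W') :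
    Function.Bijective (fun η : f ⟶ g => η.top) := by
  have := DoubleCat.RightConnected.top₂_bijective (AWFS.rightConnected_dAlg.{v, u, w} W.awfs)
    (AWFS.rightConnected_dAlg.{v, u, w} W'.awfs)
  unfold DoubleCat.RightConnected.arrowTwo at this
  rw [← AWFS.forget_eq_toSqD, ← AWFS.forget_eq_toSqD] at this
  exact this f g

/-- A monadic right-connected concrete double category is isomorphic to the double category of
algebras of an algebraic weak factorisation system, over the double categories of squares. -/
theorem ConcreteDouble.MonadicRightConnected.exists_awfs {A : ConcreteDouble.{v, u, w}}
    (h : A.MonadicRightConnected) : ∃ (W : AWFSLax.{v, u}) (i : semObj.{v, u, w} W ⟶ A.toArrowTwo)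
      (j : A.toArrowTwo ⟶ semObj.{v, u, w} W), i ≫ j = 𝟙 _ ∧ j ≫ i = 𝟙 _ := by
  obtain ⟨W, i, j, hij, hji⟩ := h.dbl.exists_awfs
  obtain ⟨hA, e⟩ := toArrowTwo_eq_arrowTwo A h.2
  refine ⟨W, ?_⟩
  rw [e, semObj_eq_arrowTwo]
  have hW : (AWFS.DAlg.{v, u, w} W.awfs).RightConnected := AWFS.rightConnected_dAlg W.awfs
  -- An isomorphism of double categories lifts to the arrow 2-category because top sides determine
  -- 1-cells there; the inverse laws are checked on top sides.
  obtain ⟨i', hi⟩ := (DoubleCat.RightConnected.top_bijective hW hA).2 i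
  obtain ⟨j', hj⟩ := (DoubleCat.RightConnected.top_bijective hA hW).2 j
  refine ⟨i', j', (DoubleCat.RightConnected.top_bijective hW hW).1 ?_,
    (DoubleCat.RightConnected.top_bijective hA hA).1 ?_⟩
  · exact (congrArg₂ (· ≫ ·) hi hj).trans hij
  · exact (congrArg₂ (· ≫ ·) hj hi).trans hji

/-- Taking top sides after `semantics` gives `algebras`, which is bijective on 1-cells, and taking
top sides is injective. -/
lemma semantics_map_bijective (W W' : AWFSLax.{v, u}) :
    Function.Bijective (fun F : W ⟶ W' => semantics.{v, u, w}.map F) :=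
  Function.Bijective.of_comp_left (f := fun f : semObj.{v, u, w} W ⟶ semObj.{v, u, w} W' => f.top)
    (algebras_map_bijective.{v, u, w} W W')
    (semObj_top_bijective.{v, u, w} W W').1

lemma semantics_map₂_bijective {W W' : AWFSLax.{v, u}} (F G : W ⟶ W') :
    Function.Bijective (fun σ : F ⟶ G => semantics.{v, u, w}.map₂ σ) :=
  Function.Bijective.of_comp_left
    (f := fun η : semMap.{v, u, w} F ⟶ semMap.{v, u, w} G => η.top) (algebras_map₂_bijective.{v, u, w} F G)
    (semObj_top₂_bijective.{v, u, w} _ _).1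

end DoubleBeck

open DoubleBeck

theorem mainTheorem4 :
    (∃ E : StrictPseudofunctor AWFSLax.{v, u} MRCConcrete.{v, u, w},
      E.comp Bicategory.InducedBicategory.forget = semantics.{v, u, w} ∧ IsTwoEquivalence E) ∧
    (∃ E : StrictPseudofunctor AWFSLax.{v, u} MRCDouble.{v, u, max v w},
      E.comp Bicategory.InducedBicategory.forget =
        semantics.{v, u, w}.comp (ArrowTwo.source DoubleCat.{v, u, max v w}) ∧
      IsTwoEquivalence E) := by
  refine ⟨exists_isTwoEquivalence semantics.{v, u, w}
    (fun W => ⟨AWFS.concrete.{v, u, w} W.awfs, AWFS.concrete_monadicRightConnected W.awfs⟩)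
    (fun _ => rfl) semantics_map_bijective semantics_map₂_bijective
    (fun A => A.2.exists_awfs), exists_isTwoEquivalence algebras.{v, u, w}
    (fun W => ⟨AWFS.DAlg.{v, u, w} W.awfs, (AWFS.concrete_monadicRightConnected W.awfs).dbl⟩)
    (fun _ => rfl) algebras_map_bijective algebras_map₂_bijective
    (fun A => A.2.exists_awfs)⟩
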